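/- **Setting.** A time-varying graph has satellites $\mathcal I=\{1,\dots,I\}$ and snapshots $1,\dots,K$ ($K\ge 1$). Its nodes are the copies $i\S k$ of satellite $i$ in snapshot $k$. Its arcs $(u,v)$ are: intra-snapshot arcs from $i\S k$ to $j\S k$ ($i\ne j$) with given rational capacities $p_{uv}\ge 0$ (capacity $0$ meaning that there is no link), where the two directions of a link may have different capacities; and caching arcs from $i\S k$ to $i\S(k+1)$, with capacity $\sum_m q_m|\mathcal C_m|$, which does not restrict any routing. There are $M$ federated learning (FL) models with a common server satellite $s$. Model $m$ has rational size $q_m>0$ and a set $\mathcal C_m\subseteq\mathcal I$ of clients; the client sets may overlap. A *splittable unicast routing* sends, for each model $m$ and each client $c\in\mathcal C_m$, the amount $q_m$ along finitely many simple directed paths from $s\S 1$ to copies of $c$, each path carrying a positive amount and delivering its data in the snapshot of the first copy of $c$ on it; the total amount on any arc, over all models and clients, must not exceed its capacity. Let $k_c$ be the last snapshot in which data destined to client $c$ are delivered to it. The min-max objective is to minimize $\max_{c\in\bigcup_m\mathcal C_m}k_c$ (taken to be $0$ if there are no clients). **Corollary (2-SF-MM).** The problem is solvable in polynomial time for any number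 $M$ of models ($M$ being part of the input), in particular for two models (2-SF-MM) and for one model (1-SF-MM): there is an algorithm which, for every instance, outputs a feasible splittable unicast routing with rational amounts that minimizes the min-max objective among all feasible routings (with arbitrary real amounts), or reports correctly that there is no feasible routing, in time polynomial in the bit length of the instance. Here time is measured as the logarithmic cost on a random access machine, and includes the writing of the output. Moreover, for every trial snapshot $k\in\{1,\dots,K\}$, there is a feasible routing with objective value at most $k$ if and only if the following linear program is feasible: find a single-commodity flow $x_{uv}$, $0\le x_{uv}\le p_{uv}$, on the arcs between nodes of the snapshots $1,\dots,k$, with supply $\sum_m q_m|\mathcal C_m|$ at $s\S 1$, with demand $\sum_{m:\,c\in\mathcal C_m}q_m$ at $c\S k$ for each client $c$, and with flow conservation otherwise (if $s\S 1=c\S k$, supply and demand at this node are offset against each other). -/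

import Mathlib

/-! ## Polynomial time: random access programs with logarithmic cost

A program works on finitely many named integer registers and finitely many named arrays of
natural numbers, all addressable at random.  Every evaluated (sub)expression is charged the
bit length of its value plus one, so that the cost is the logarithmic cost of a RAM with addition,
truncated subtraction, multiplication, integer division and indirect addressing. -/

namespace RAM

/-- Memory contents: `reg x` is register `x`, and `arr a i` is cell `i` of array `a`. -/
structure State where
  reg : ℕ → ℕ
  arr : ℕ → ℕ → ℕ

/-- Expressions; `cell a e` reads the cell of array `a` whose index is the value of `e`. -/
inductive Expr where
  | const (n : ℕ)
  | reg (x : ℕ)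
  | cell (a : ℕ) (e : Expr)
  | add (e₁ e₂ : Expr)
  | sub (e₁ e₂ : Expr)
  | mul (e₁ e₂ : Expr)
  | div (e₁ e₂ : Expr)

/-- The value of an expression. -/
def Expr.val (σ : State) : Expr → ℕ
  | .const n => n
  | .reg x => σ.reg x
  | .cell a e => σ.arr a (e.val σ)
  | .add e₁ e₂ => e₁.val σ + e₂.val σ
  | .sub e₁ e₂ => e₁.val σ - e₂.val σ
  | .mul e₁ e₂ => e₁.val σ * e₂.val σ
  | .div e₁ e₂ => e₁.val σ / e₂.val σ

/-- The logarithmic cost of evaluating an expression. -/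
def Expr.cost (σ : State) : Expr → ℕ
  | .const n => n.size + 1
  | .reg x => (σ.reg x).size + 1
  | .cell a e => (σ.arr a (e.val σ)).size + 1 + e.cost σ
  | .add e₁ e₂ => (e₁.val σ + e₂.val σ).size + 1 + e₁.cost σ + e₂.cost σ
  | .sub e₁ e₂ => (e₁.val σ - e₂.val σ).size + 1 + e₁.cost σ + e₂.cost σ
  | .mul e₁ e₂ => (e₁.val σ * e₂.val σ).size + 1 + e₁.cost σ + e₂.cost σ
  | .div e₁ e₂ => (e₁.val σ / e₂.val σ).size + 1 + e₁.cost σ + e₂.cost σ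

/-- Programs.  A test succeeds if the value of the expression is not zero. -/
inductive Program where
  | skip
  | assign (x : ℕ) (e : Expr)
  | store (a : ℕ) (i e : Expr)
  | seq (P Q : Program)
  | ite (e : Expr) (P Q : Program)
  | loop (e : Expr) (P : Program)

/-- `Exec P σ σ' t`: started in `σ`, the program `P` halts in `σ'` at total cost `t`. -/
inductive Exec : Program → State → State → ℕ → Prop where
  | skip (σ : State) : Exec .skip σ σ 1
  | assign (σ : State) (x : ℕ) (e : Expr) :
      Exec (.assign x e) σ { σ with reg := Function.update σ.reg x (e.val σ) } (e.cost σ + 1)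
  | store (σ : State) (a : ℕ) (i e : Expr) :
      Exec (.store a i e) σ
        { σ with
          arr := Function.update σ.arr a (Function.update (σ.arr a) (i.val σ) (e.val σ)) }
        (i.cost σ + e.cost σ + 1)
  | seq {P Q : Program} {σ₁ σ₂ σ₃ : State} {t₁ t₂ : ℕ} :
      Exec P σ₁ σ₂ t₁ → Exec Q σ₂ σ₃ t₂ → Exec (.seq P Q) σ₁ σ₃ (t₁ + t₂)
  | ite_true {e : Expr} {P Q : Program} {σ σ' : State} {t : ℕ} :
      e.val σ ≠ 0 → Exec P σ σ' t → Exec (.ite e P Q) σ σ' (e.cost σ + 1 + t)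
  | ite_false {e : Expr} {P Q : Program} {σ σ' : State} {t : ℕ} :
      e.val σ = 0 → Exec Q σ σ' t → Exec (.ite e P Q) σ σ' (e.cost σ + 1 + t)
  | loop_done {e : Expr} {P : Program} {σ : State} :
      e.val σ = 0 → Exec (.loop e P) σ σ (e.cost σ + 1)
  | loop_step {e : Expr} {P : Program} {σ₁ σ₂ σ₃ : State} {t₁ t₂ : ℕ} :
      e.val σ₁ ≠ 0 → Exec P σ₁ σ₂ t₁ → Exec (.loop e P) σ₂ σ₃ t₂ →
        Exec (.loop e P) σ₁ σ₃ (e.cost σ₁ + 1 + t₁ + t₂)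

/-- The input is stored in array `0` and its length in register `0`; all other cells are `0`. -/
def State.init (inp : List ℕ) : State where
  reg x := if x = 0 then inp.length else 0
  arr a i := if a = 0 then inp.getD i 0 else 0

/-- The output consists of the first cells of array `1`, as many as register `1` says. -/
def State.output (σ : State) : List ℕ :=
  (List.range (σ.reg 1)).map (σ.arr 1)

/-- The length of a list of numbers, written in binary with separators. -/
def bitSize (l : List ℕ) : ℕ :=
  (l.map fun n => n.size + 1).sum

/-- The search problem "given `a`, find some `b` with `Sol a b`" is solvable in polynomial time:
there are one program and one polynomial such that on (the encoding of) every instance `a` the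
program halts with (the encoding of) some `b` with `Sol a b` as its output, and the cost of the
run, the writing of the output included, is at most the polynomial at the size of the input. -/
def PolyTimeSolvable {α : Type} {β : α → Type} (enc : α → List ℕ)
    (encOut : (a : α) → β a → List ℕ) (Sol : (a : α) → β a → Prop) : Prop :=
  ∃ (P : Program) (p : Polynomial ℕ), ∀ a : α, ∃ b : β a, Sol a b ∧
    ∃ (σ : State) (t : ℕ), Exec P (State.init (enc a)) σ t ∧ σ.output = encOut a b ∧
      t + bitSize (encOut a b) ≤ p.eval (bitSize (enc a))

end RAM

/-! ## Model distribution over a time-varying graph -/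

namespace FLRouting

/-- An instance: `I` satellites, `K ≥ 1` snapshots, the capacities of the directed intra-snapshot
links (capacity `0` where there is no link), and `M` federated learning models with a common
server, each with its size and its set of clients.  The client sets may overlap. -/
structure Instance where
  I : ℕ
  K : ℕ
  K_pos : 0 < K
  cap : Fin K → Fin I → Fin I → ℚ≥0
  server : Fin I
  M : ℕ
  size : Fin M → ℚ≥0
  size_pos : ∀ m, 0 < size m
  clients : Fin M → Finset (Fin I)

namespace Instance

variable (N : Instance)

/-- The node `(k, i)` is the copy of satellite `i` in snapshot `k`. The snapshot with the
0-based position `k : Fin K` has the index `k + 1`. -/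
abbrev Node : Type := Fin N.K × Fin N.I

/-- The copy of the server in the first snapshot. -/
def source : N.Node := (⟨0, N.K_pos⟩, N.server)

/-- The total amount of data to be delivered, `∑ m, q_m * |C_m|`. -/
def totalDemand : ℚ≥0 := ∑ m, N.size m * (N.clients m).card

/-- The amount of data to be delivered to satellite `c`: the sum of the sizes of the models of
which `c` is a client. -/
def clientDemand (c : Fin N.I) : ℚ≥0 := ∑ m, if c ∈ N.clients m then N.size m else 0

/-- Arc capacities: intra-snapshot links have the given capacities, the caching arcs from a
satellite to itself in the next snapshot have capacity `∑ m, q_m * |C_m|`, which does not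
constrain the routing, and there are no other arcs. -/
def arcCap (u v : N.Node) : ℚ≥0 :=
  if u.1 = v.1 ∧ u.2 ≠ v.2 then N.cap u.1 u.2 v.2
  else if (u.1 : ℕ) + 1 = v.1 ∧ u.2 = v.2 then N.totalDemand
  else 0

end Instance

/-- One part of a splittable unicast routing: `amount` of the data of `model` is sent to `client`
along `path`. -/
structure PathFlow (N : Instance) (R : Type) where
  model : Fin N.M
  client : Fin N.I
  path : List N.Node
  amount : R

/-- A splittable unicast routing: each model goes to each of its clients along any finite number
of paths, each of which carries some amount. -/
abbrev Routing (N : Instance) (R : Type) : Type := List (PathFlow N R)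

variable {N : Instance}

/-- The path of `e` is a simple directed path from the server in the first snapshot to some copy
of the client of `e`. -/
structure PathFlow.IsPath {R : Type} (e : PathFlow N R) : Prop where
  nodup : e.path.Nodup
  head : e.path.head? = some N.source
  last : ∃ k, e.path.getLast? = some (k, e.client)
  chain : e.path.IsChain fun u v => 0 < N.arcCap u v

/-- The index (in `1, …, K`) of the snapshot in which the data of `e` arrive at the client:
that of the first copy of the client on the path. -/
def PathFlow.arrival {R : Type} (e : PathFlow N R) : ℕ :=
  (e.path.find? fun u => u.2 = e.client).elim 0 fun u => (u.1 : ℕ) + 1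

/-- The amount of data delivered to `c` of model `m`. -/
def Routing.delivered {R : Type} [Semifield R] (r : Routing N R) (m : Fin N.M) (c : Fin N.I) : R :=
  ((r.filter fun e => e.model = m ∧ e.client = c).map PathFlow.amount).sum

/-- The total amount of data on the arc from `u` to `v`. -/
def Routing.load {R : Type} [Semifield R] (r : Routing N R) (u v : N.Node) : R :=
  (r.map fun e => ((e.path.zip e.path.tail).count (u, v) : R) * e.amount).sum

/-- A routing is feasible if every client receives each of its models completely, and no arc
carries more than its capacity. -/
structure Routing.Feasible {R : Type} [Semifield R] [LinearOrder R] (r : Routing N R) : Prop where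
  client_mem : ∀ e ∈ r, e.client ∈ N.clients e.model
  isPath : ∀ e ∈ r, e.IsPath
  amount_pos : ∀ e ∈ r, 0 < e.amount
  delivered : ∀ m, ∀ c ∈ N.clients m, r.delivered m c = (N.size m : R)
  capacity : ∀ u v, r.load u v ≤ (N.arcCap u v : R)

/-- The index of the snapshot by which client `c` has received everything sent to it. -/
def Routing.completion {R : Type} (r : Routing N R) (c : Fin N.I) : ℕ :=
  ((r.filter fun e => e.client = c).map PathFlow.arrival).foldr max 0

/-- The min-max objective: the maximum completion snapshot over all clients of all models
(`0` if there are no clients). -/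
def Routing.makespan {R : Type} (r : Routing N R) : ℕ :=
  (Finset.univ.biUnion N.clients).sup r.completion

/-- Read amounts given as fractions `(numerator, denominator)` as rational numbers. -/
def Routing.ofFractions (r : Routing N (ℕ × ℕ)) : Routing N ℚ≥0 :=
  r.map fun e => ⟨e.model, e.client, e.path, (e.amount.1 : ℚ≥0) / (e.amount.2 : ℚ≥0)⟩

/-- The answer `none` says that there is no feasible routing; the answer `some r` is a feasible
routing that is optimal for the min-max objective among all feasible routings with real amounts. -/
def IsOptimalAnswer (N : Instance) : Option (Routing N (ℕ × ℕ)) → Prop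
  | none => ∀ r' : Routing N ℝ, ¬ r'.Feasible
  | some r => r.ofFractions.Feasible ∧
      ∀ r' : Routing N ℝ, r'.Feasible → r.ofFractions.makespan ≤ r'.makespan

/-- A feasible single-commodity flow in the snapshots up to `k`: supply `∑ m, q_m * |C_m|` at the
server in the first snapshot, and at each satellite `c` in snapshot `k` a demand equal to the sum
of the sizes of the models of which `c` is a client. -/
structure IsFeasibleFlow (N : Instance) (k : Fin N.K) (x : N.Node → N.Node → ℝ) : Prop where
  nonneg : ∀ u v, 0 ≤ x u v
  capacity : ∀ u v, x u v ≤ (N.arcCap u v : ℝ)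
  support : ∀ u v, k < u.1 ∨ k < v.1 → x u v = 0
  conservation : ∀ u : N.Node,
    ∑ v, x u v - ∑ v, x v u =
      (if u = N.source then (N.totalDemand : ℝ) else 0)
        - (if u.1 = k then (N.clientDemand u.2 : ℝ) else 0)

/-- The input: the dimensions, the server, all capacities and model sizes as fractions in lowest
terms, and the client sets as bit vectors. -/
def encodeInstance (N : Instance) : List ℕ :=
  [N.I, N.K, N.M, N.server]
    ++ ((List.finRange N.K).flatMap fun k => (List.finRange N.I).flatMap fun i =>
          (List.finRange N.I).flatMap fun j => [(N.cap k i j).num, (N.cap k i j).den])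
    ++ ((List.finRange N.M).flatMap fun m => [(N.size m).num, (N.size m).den])
    ++ ((List.finRange N.M).flatMap fun m =>
          (List.finRange N.I).map fun c => if c ∈ N.clients m then 1 else 0)

/-- The output: `0` for "infeasible", otherwise `1`, the number of path flows, and for each of
them its model, client, amount, number of nodes, and nodes. -/
def encodeAnswer (N : Instance) : Option (Routing N (ℕ × ℕ)) → List ℕ
  | none => [0]
  | some r => 1 :: r.length :: r.flatMap fun e =>
      [(e.model : ℕ), (e.client : ℕ), e.amount.1, e.amount.2, e.path.length]
        ++ e.path.flatMap fun u => [(u.1 : ℕ), (u.2 : ℕ)]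

end FLRouting

/-!
A feasible routing with objective value at most `k` exists if and only if the single-commodity
network for the trial snapshot `k` has a feasible flow.

From a routing to a flow (`exists_flow_of_routing`): every path is cut off at the first copy of its
client and extended by caching arcs to the copy in snapshot `k`.  The new path uses no further
intra-snapshot arc, and a caching arc has room for the whole data, so that the sum of the path flows
is a feasible flow.

From a flow to a routing: all data of all models start at the same node, so that it does not matter
which data take which path.  Scaling all amounts by a common denominator makes the network integral,
and an integral maximum flow meets all demands if a feasible flow exists, because some cut is
saturated (`IsNetwork.le_val`).  Such a flow is decomposed into simple paths
(`IsPartial.not_separated`, `IsPartial.step`): as long as client `c` still needs data of model `m`,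
conservation gives a path from the source to `c` on arcs that carry flow, and the largest possible
amount on it is assigned to `m` and `c`.  Each path either serves the pair `m`, `c` completely or
empties an arc.  Paths end in snapshot `k` at the latest, so that the objective value is at most `k`.

The algorithm `distribute` does this for the first snapshot for which the maximum flow meets the
demands; it is optimal by the first part (`isOptimalAnswer_some`).  The maximum flow is computed by
capacity scaling, which needs polynomially many augmentations in the bit length of the capacities
(`wp_maxFlow`).

The cost is accounted for by a weakest precondition `wp T`, which requires that every loop stop after
at most `T` rounds and that every product have a second factor of at most `T` bits.  Then the number
of steps is polynomial in `T`, every step adds at most `T + 1` bits to the longest number in the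
memory, and hence the logarithmic cost is polynomial as well (`exists_run`,
`polyTimeSolvable_of_wp`).  The same correctness theorem `wp_distribute` also provides the routing
for a given flow in the equivalence above (`exists_routing_of_flow`).
-/

/-! ### Weakest preconditions and polynomial cost -/

namespace RAM

instance : Add Expr := ⟨.add⟩
instance : Sub Expr := ⟨.sub⟩
instance : Mul Expr := ⟨.mul⟩
instance : Div Expr := ⟨.div⟩
instance (n : ℕ) : OfNat Expr n := ⟨.const n⟩

infixr:30 " ;; " => Program.seq

/-- Register `x` set to `v`. -/
def State.set (σ : State) (x v : ℕ) : State := { σ with reg := Function.update σ.reg x v }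

/-- Cell `i` of array `a` set to `v`. -/
def State.put (σ : State) (a i v : ℕ) : State :=
  { σ with arr := Function.update σ.arr a (Function.update (σ.arr a) i v) }

/-- The number of nodes of an expression, constants counting with their bit lengths. -/
def Expr.weight : Expr → ℕ
  | .const n => n.size + 1
  | .reg _ => 1
  | .cell _ e => e.weight + 1
  | .add e₁ e₂ | .sub e₁ e₂ | .mul e₁ e₂ | .div e₁ e₂ => e₁.weight + e₂.weight + 1

/-- The second factor of every product in the expression has bit length at most `T`.  Without such
a restriction repeated squaring would double the bit length in every step. -/
def Expr.MulOk (T : ℕ) (σ : State) : Expr → Prop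
  | .const _ => True
  | .reg _ => True
  | .cell _ e => e.MulOk T σ
  | .add e₁ e₂ | .sub e₁ e₂ | .div e₁ e₂ => e₁.MulOk T σ ∧ e₂.MulOk T σ
  | .mul e₁ e₂ => e₁.MulOk T σ ∧ e₂.MulOk T σ ∧ (e₂.val σ).size ≤ T

/-- All memory cells have bit length at most `S`. -/
def State.Bounded (S : ℕ) (σ : State) : Prop :=
  (∀ x, (σ.reg x).size ≤ S) ∧ ∀ a i, (σ.arr a i).size ≤ S

theorem State.Bounded.mono {S S' : ℕ} {σ : State} (h : σ.Bounded S) (hS : S ≤ S') :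
    σ.Bounded S' :=
  ⟨fun x => (h.1 x).trans hS, fun a i => (h.2 a i).trans hS⟩

theorem State.Bounded.set {S : ℕ} {σ : State} (h : σ.Bounded S) {x v : ℕ} (hv : v.size ≤ S) :
    (σ.set x v).Bounded S := by
  refine ⟨fun y => ?_, h.2⟩
  by_cases hy : y = x
  · simpa [State.set, hy] using hv
  · simpa [State.set, Function.update_apply, hy] using h.1 y

theorem State.Bounded.put {S : ℕ} {σ : State} (h : σ.Bounded S) {a i v : ℕ} (hv : v.size ≤ S) :
    (σ.put a i v).Bounded S := by
  refine ⟨h.1, fun b j => ?_⟩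
  by_cases hb : b = a
  · subst hb
    by_cases hj : j = i
    · simpa [State.put, hj] using hv
    · simpa [State.put, Function.update_apply, hj] using h.2 b j
  · simpa [State.put, Function.update_apply, hb] using h.2 b j

theorem Nat.size_add_le {a b n : ℕ} (ha : a.size ≤ n) (hb : b.size ≤ n) :
    (a + b).size ≤ n + 1 := by
  rw [Nat.size_le] at *
  rw [pow_succ]
  omega

theorem Nat.size_mul_le (a b : ℕ) : (a * b).size ≤ a.size + b.size := by
  rw [Nat.size_le, pow_add]
  exact Nat.mul_lt_mul'' (Nat.lt_size_self a) (Nat.lt_size_self b)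

/-- A value grows by at most `T + 1` bits per node of the expression. -/
theorem Expr.size_val_le {T S : ℕ} {σ : State} (hσ : σ.Bounded S) (e : Expr) (he : e.MulOk T σ) :
    (e.val σ).size ≤ S + e.weight * (T + 1) := by
  induction e with
  | const n => simp only [Expr.val, Expr.weight]; nlinarith
  | reg x => exact (hσ.1 x).trans (Nat.le_add_right _ _)
  | cell a e ih => exact (hσ.2 a _).trans (Nat.le_add_right _ _)
  | add e₁ e₂ ih₁ ih₂ =>
    have h1 := ih₁ he.1
    have h2 := ih₂ he.2
    have := Nat.size_add_le (n := S + (e₁.weight + e₂.weight) * (T + 1))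
      (h1.trans (by gcongr; omega)) (h2.trans (by gcongr; omega))
    simp only [Expr.val, Expr.weight]
    nlinarith
  | sub e₁ e₂ ih₁ ih₂ =>
    have h1 := ih₁ he.1
    have : (e₁.val σ - e₂.val σ).size ≤ (e₁.val σ).size := Nat.size_le_size (Nat.sub_le _ _)
    simp only [Expr.val, Expr.weight]
    nlinarith
  | mul e₁ e₂ ih₁ ih₂ =>
    have h1 := ih₁ he.1
    have h3 := he.2.2
    have := Nat.size_mul_le (e₁.val σ) (e₂.val σ)
    simp only [Expr.val, Expr.weight]
    nlinarith
  | div e₁ e₂ ih₁ ih₂ =>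
    have h1 := ih₁ he.1
    have : (e₁.val σ / e₂.val σ).size ≤ (e₁.val σ).size := Nat.size_le_size (Nat.div_le_self _ _)
    simp only [Expr.val, Expr.weight]
    nlinarith

theorem Expr.cost_le {T S : ℕ} {σ : State} (hσ : σ.Bounded S) (e : Expr) (he : e.MulOk T σ) :
    e.cost σ ≤ e.weight * (S + e.weight * (T + 1) + 1) := by
  have key : ∀ B, S + e.weight * (T + 1) ≤ B → e.cost σ ≤ e.weight * (B + 1) := by
    induction e with
    | const n => intro B hB; simp only [Expr.cost, Expr.weight] at *; nlinarith
    | reg x =>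
      intro B hB
      have := hσ.1 x
      simp only [Expr.cost, Expr.weight] at *
      omega
    | cell a e ih =>
      intro B hB
      have := hσ.2 a (e.val σ)
      have := ih he B (hB.trans' (by simp only [Expr.weight]; gcongr; omega))
      simp only [Expr.cost, Expr.weight] at *
      nlinarith
    | add e₁ e₂ ih₁ ih₂ | sub e₁ e₂ ih₁ ih₂ | div e₁ e₂ ih₁ ih₂ =>
      intro B hB
      have h := Expr.size_val_le hσ _ he
      have h1 := ih₁ he.1 B (hB.trans' (by simp only [Expr.weight]; gcongr; omega))
      have h2 := ih₂ he.2 B (hB.trans' (by simp only [Expr.weight]; gcongr; omega))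
      have h3 := h.trans hB
      simp only [Expr.cost, Expr.weight, Expr.val] at *
      nlinarith
    | mul e₁ e₂ ih₁ ih₂ =>
      intro B hB
      have h := Expr.size_val_le hσ _ he
      have h1 := ih₁ he.1 B (hB.trans' (by simp only [Expr.weight]; gcongr; omega))
      have h2 := ih₂ he.2.1 B (hB.trans' (by simp only [Expr.weight]; gcongr; omega))
      have h3 := h.trans hB
      simp only [Expr.cost, Expr.weight, Expr.val] at *
      nlinarith
  exact key _ le_rfl

/-- The weakest precondition of `P` for the postcondition `Q`, where moreover every loop must stop
after at most `T` rounds and the second factor of every product must have at most `T` bits. -/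
def wp (T : ℕ) : Program → (State → Prop) → State → Prop
  | .skip, Q => Q
  | .assign x e, Q => fun σ => e.MulOk T σ ∧ Q (σ.set x (e.val σ))
  | .store a i e, Q => fun σ => i.MulOk T σ ∧ e.MulOk T σ ∧ Q (σ.put a (i.val σ) (e.val σ))
  | .seq P R, Q => wp T P (wp T R Q)
  | .ite e P R, Q => fun σ =>
      e.MulOk T σ ∧ (e.val σ ≠ 0 → wp T P Q σ) ∧ (e.val σ = 0 → wp T R Q σ)
  | .loop e P, Q => (fun X σ =>
      e.MulOk T σ ∧ (e.val σ ≠ 0 → wp T P X σ) ∧ (e.val σ = 0 → Q σ))^[T + 1] fun _ => False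

/-- A polynomial in `T` that bounds the total weight of the expressions evaluated in a run in which
every loop stops after at most `T` rounds. -/
noncomputable def Program.steps : Program → Polynomial ℕ
  | .skip => 1
  | .assign _ e => .C (e.weight + 1)
  | .store _ i e => .C (i.weight + e.weight + 1)
  | .seq P R => P.steps + R.steps
  | .ite e P R => .C (e.weight + 1) + (P.steps + R.steps)
  | .loop e P => .C (e.weight + 1) + .X * (.C (e.weight + 1) + P.steps)

/-- Register `1` is only ever incremented by one or set to a constant `0`, `1`, or `2`, so that the
length of the output is at most twice the number of steps. -/
def Program.SlowOutput : Program → Prop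
  | .skip => True
  | .assign x e =>
      x = 1 → e = .add (.reg 1) (.const 1) ∨ e = .const 0 ∨ e = .const 1 ∨ e = .const 2
  | .store _ _ _ => True
  | .seq P R => P.SlowOutput ∧ R.SlowOutput
  | .ite _ P R => P.SlowOutput ∧ R.SlowOutput
  | .loop _ P => P.SlowOutput

/-- A run of `P` from `σ` to `σ'` in `n` steps: whatever the initial bound on the memory cells,
every step adds at most `T + 1` bits to it, and costs at most the final bound. -/
def Run (T : ℕ) (P : Program) (σ σ' : State) (n : ℕ) : Prop :=
  (P.SlowOutput → σ'.reg 1 ≤ σ.reg 1 + 2 * n) ∧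
  ∀ S, σ.Bounded S → σ'.Bounded (S + n * (T + 1)) ∧
    ∃ t, Exec P σ σ' t ∧ t ≤ n * (S + n * (T + 1) + 1)

/-- The cost bounds of two consecutive runs, of `n` and of `m` steps, add up to that of a run of
`n + m` steps: the second run starts with the memory bound with which the first one ended. -/
theorem cost_seq_le {a b c d n m B : ℕ} (h₁ : a ≤ n * (B + n * d + 1))
    (h₂ : b ≤ m * (B + n * d + m * d + 1)) (hc : c = a + b) :
    c ≤ (n + m) * (B + (n + m) * d + 1) := by
  have : n * (B + n * d + 1) ≤ n * (B + (n + m) * d + 1) := by gcongr; omega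
  have : m * (B + n * d + m * d + 1) = m * (B + (n + m) * d + 1) := by ring
  rw [add_mul, hc]
  omega

/-- The cost bound of a test followed by that of a run that starts with the same memory bound. -/
theorem cost_ite_le {a b n m B d : ℕ} (h₁ : a ≤ n * (B + n * d + 1))
    (h₂ : b ≤ m * (B + m * d + 1)) : a + 1 + b ≤ (n + 1 + m) * (B + (n + 1 + m) * d + 1) := by
  have h₃ : n * (B + n * d + 1) ≤ n * (B + (n + 1 + m) * d + 1) := by gcongr; omega
  have h₄ : m * (B + m * d + 1) ≤ m * (B + (n + 1 + m) * d + 1) := by gcongr; omega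
  rw [add_mul, add_mul]
  omega

/-- A weakest precondition guarantees a run to the postcondition, in polynomially many steps. -/
theorem exists_run {T : ℕ} (P : Program) : ∀ {Q : State → Prop} {σ : State}, wp T P Q σ →
    ∃ σ' n, Q σ' ∧ n ≤ P.steps.eval T ∧ Run T P σ σ' n := by
  induction P with
  | skip =>
    intro Q σ h
    refine ⟨σ, 1, h, by simp [Program.steps], fun _ => by omega, fun S hS =>
      ⟨hS.mono (by omega), 1, .skip σ, by omega⟩⟩
  | assign x e =>
    intro Q σ h
    refine ⟨_, e.weight + 1, h.2, by simp [Program.steps], fun hs => ?_,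
      fun S hS => ⟨?_, _, .assign σ x e, ?_⟩⟩
    · by_cases hx : x = 1
      · subst hx
        rcases hs rfl with h | h | h | h <;> subst h <;> simp [State.set, Expr.val] <;> omega
      · simp [State.set, Ne.symm hx]
    · exact (hS.mono (Nat.le_add_right _ _)).set
        ((e.size_val_le hS h.1).trans (by gcongr; omega))
    · have := e.cost_le hS h.1
      nlinarith
  | store a i e =>
    intro Q σ h
    refine ⟨_, i.weight + e.weight + 1, h.2.2, by simp [Program.steps], fun hs => ?_,
      fun S hS => ⟨?_, _, .store σ a i e, ?_⟩⟩
    · simp [State.put]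
    · exact (hS.mono (Nat.le_add_right _ _)).put
        ((e.size_val_le hS h.2.1).trans (by gcongr; omega))
    · have h1 := i.cost_le hS h.1
      have h2 := e.cost_le hS h.2.1
      have := cost_ite_le h1 h2
      rwa [add_right_comm, add_right_comm i.weight] at this
  | seq P R ihP ihR =>
    intro Q σ h
    obtain ⟨σ₁, n, h₁, hn, hs₁, hr₁⟩ := ihP h
    obtain ⟨σ₂, m, h₂, hm, hs₂, hr₂⟩ := ihR h₁
    refine ⟨σ₂, n + m, h₂, by simp only [Program.steps, Polynomial.eval_add]; omega,
      fun hs => ?_, fun S hS => ?_⟩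
    · have := hs₁ hs.1
      have := hs₂ hs.2
      omega
    · obtain ⟨hb₁, t₁, he₁, ht₁⟩ := hr₁ S hS
      obtain ⟨hb₂, t₂, he₂, ht₂⟩ := hr₂ _ hb₁
      exact ⟨hb₂.mono (by rw [add_mul]; omega), _, .seq he₁ he₂, cost_seq_le ht₁ ht₂ rfl⟩
  | ite e P R ihP ihR =>
    intro Q σ h
    by_cases hv : e.val σ = 0
    · obtain ⟨σ₁, n, h₁, hn, hs₁, hr₁⟩ := ihR (h.2.2 hv)
      refine ⟨σ₁, (e.weight + 1) + n, h₁, by simp [Program.steps]; omega,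
        fun hs => by have := hs₁ hs.2; omega, fun S hS => ?_⟩
      obtain ⟨hb₁, t₁, he₁, ht₁⟩ := hr₁ S hS
      refine ⟨hb₁.mono (by gcongr; omega), _, .ite_false hv he₁, ?_⟩
      exact cost_ite_le (e.cost_le hS h.1) ht₁
    · obtain ⟨σ₁, n, h₁, hn, hs₁, hr₁⟩ := ihP (h.2.1 hv)
      refine ⟨σ₁, (e.weight + 1) + n, h₁, by simp [Program.steps]; omega,
        fun hs => by have := hs₁ hs.1; omega, fun S hS => ?_⟩
      obtain ⟨hb₁, t₁, he₁, ht₁⟩ := hr₁ S hS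
      refine ⟨hb₁.mono (by gcongr; omega), _, .ite_true hv he₁, ?_⟩
      exact cost_ite_le (e.cost_le hS h.1) ht₁
  | loop e P ih =>
    intro Q σ h
    have key : ∀ k : ℕ, ∀ σ : State,
        (fun X σ => e.MulOk T σ ∧ (e.val σ ≠ 0 → wp T P X σ) ∧ (e.val σ = 0 → Q σ))^[k + 1]
          (fun _ => False) σ →
        ∃ σ' n, Q σ' ∧ n ≤ e.weight + 1 + k * (e.weight + 1 + P.steps.eval T) ∧
          Run T (.loop e P) σ σ' n := by
      intro k
      induction k with
      | zero =>
        intro σ h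
        simp only [Function.iterate_succ, Function.iterate_zero, Function.comp, id] at h
        have hv : e.val σ = 0 := by
          by_contra hv
          obtain ⟨_, _, h, _⟩ := ih (h.2.1 hv)
          exact h
        refine ⟨σ, e.weight + 1, h.2.2 hv, by omega, fun _ => by omega, fun S hS =>
          ⟨hS.mono (by omega), _, .loop_done hv, ?_⟩⟩
        have := e.cost_le hS h.1
        nlinarith
      | succ k ihk =>
        intro σ h
        rw [Function.iterate_succ_apply'] at h
        by_cases hv : e.val σ = 0
        · refine ⟨σ, e.weight + 1, h.2.2 hv, by omega, fun _ => by omega, fun S hS =>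
            ⟨hS.mono (by omega), _, .loop_done hv, ?_⟩⟩
          have := e.cost_le hS h.1
          nlinarith
        · obtain ⟨σ₁, n, h₁, hn, hs₁, hr₁⟩ := ih (h.2.1 hv)
          obtain ⟨σ₂, m, h₂, hm, hs₂, hr₂⟩ := ihk _ h₁
          refine ⟨σ₂, (e.weight + 1 + n) + m, h₂, ?_, fun hs => ?_, fun S hS => ?_⟩
          · rw [add_mul k 1, one_mul]; omega
          · have := hs₁ hs
            have := hs₂ hs
            omega
          · obtain ⟨hb₁, t₁, he₁, ht₁⟩ := hr₁ S hS
            obtain ⟨hb₂, t₂, he₂, ht₂⟩ := hr₂ _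
              (hb₁.mono (show _ ≤ S + (e.weight + 1 + n) * (T + 1) by gcongr; omega))
            refine ⟨hb₂.mono (by rw [add_mul _ m]; omega), _, .loop_step hv he₁ he₂,
              cost_seq_le (a := e.cost σ + 1 + t₁) ?_ ht₂ rfl⟩
            exact cost_ite_le (e.cost_le hS h.1) ht₁
    obtain ⟨σ', n, h₁, h₂, h₃⟩ := key T σ h
    refine ⟨σ', n, h₁, h₂.trans_eq ?_, h₃⟩
    simp only [Program.steps, Polynomial.eval_add, Polynomial.eval_mul, Polynomial.eval_C,
      Polynomial.eval_X]


/-! ### Rules for reasoning about programs -/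

/-- The registers that a program may change. -/
def Program.regs : Program → List ℕ
  | .skip => []
  | .assign x _ => [x]
  | .store _ _ _ => []
  | .seq P R => P.regs ++ R.regs
  | .ite _ P R => P.regs ++ R.regs
  | .loop _ P => P.regs

/-- The arrays that a program may change. -/
def Program.arrs : Program → List ℕ
  | .skip => []
  | .assign _ _ => []
  | .store a _ _ => [a]
  | .seq P R => P.arrs ++ R.arrs
  | .ite _ P R => P.arrs ++ R.arrs
  | .loop _ P => P.arrs

/-- The states `σ` and `τ` agree outside the registers and arrays that `P` may change. -/
structure Program.Frame (P : Program) (σ τ : State) : Prop where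
  reg : ∀ x, x ∉ P.regs → τ.reg x = σ.reg x
  arr : ∀ a, a ∉ P.arrs → τ.arr a = σ.arr a

@[simp] theorem State.reg_set (σ : State) (x v y : ℕ) :
    (σ.set x v).reg y = if y = x then v else σ.reg y := by
  simp [State.set, Function.update_apply]

@[simp] theorem State.arr_set (σ : State) (x v : ℕ) : (σ.set x v).arr = σ.arr := rfl

@[simp] theorem State.reg_put (σ : State) (a i v : ℕ) : (σ.put a i v).reg = σ.reg := rfl

@[simp] theorem State.arr_put (σ : State) (a i v b : ℕ) :
    (σ.put a i v).arr b = if b = a then Function.update (σ.arr a) i v else σ.arr b := by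
  simp [State.put, Function.update_apply]

section Expr

variable (σ : State) (T : ℕ) (e₁ e₂ : Expr)

@[simp] theorem Expr.val_const (n : ℕ) : (Expr.const n).val σ = n := rfl
@[simp] theorem Expr.val_reg (x : ℕ) : (Expr.reg x).val σ = σ.reg x := rfl
@[simp] theorem Expr.val_cell (a : ℕ) : (Expr.cell a e₁).val σ = σ.arr a (e₁.val σ) := rfl
@[simp] theorem Expr.val_add : (e₁ + e₂).val σ = e₁.val σ + e₂.val σ := rfl
@[simp] theorem Expr.val_sub : (e₁ - e₂).val σ = e₁.val σ - e₂.val σ := rfl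
@[simp] theorem Expr.val_mul : (e₁ * e₂).val σ = e₁.val σ * e₂.val σ := rfl
@[simp] theorem Expr.val_div : (e₁ / e₂).val σ = e₁.val σ / e₂.val σ := rfl
@[simp] theorem Expr.val_zero : (0 : Expr).val σ = 0 := rfl
@[simp] theorem Expr.val_one : (1 : Expr).val σ = 1 := rfl
@[simp] theorem Expr.val_two : (2 : Expr).val σ = 2 := rfl

@[simp] theorem Expr.mulOk_const (n : ℕ) : (Expr.const n).MulOk T σ := trivial
@[simp] theorem Expr.mulOk_reg (x : ℕ) : (Expr.reg x).MulOk T σ := trivial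
@[simp] theorem Expr.mulOk_cell (a : ℕ) : (Expr.cell a e₁).MulOk T σ ↔ e₁.MulOk T σ := Iff.rfl
@[simp] theorem Expr.mulOk_add :
    (e₁ + e₂).MulOk T σ ↔ e₁.MulOk T σ ∧ e₂.MulOk T σ := Iff.rfl
@[simp] theorem Expr.mulOk_sub :
    (e₁ - e₂).MulOk T σ ↔ e₁.MulOk T σ ∧ e₂.MulOk T σ := Iff.rfl
@[simp] theorem Expr.mulOk_div :
    (e₁ / e₂).MulOk T σ ↔ e₁.MulOk T σ ∧ e₂.MulOk T σ := Iff.rfl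
@[simp] theorem Expr.mulOk_mul : (e₁ * e₂).MulOk T σ ↔
    e₁.MulOk T σ ∧ e₂.MulOk T σ ∧ (e₂.val σ).size ≤ T := Iff.rfl
@[simp] theorem Expr.mulOk_zero : (0 : Expr).MulOk T σ := trivial
@[simp] theorem Expr.mulOk_one : (1 : Expr).MulOk T σ := trivial
@[simp] theorem Expr.mulOk_two : (2 : Expr).MulOk T σ := trivial

end Expr

variable {T : ℕ} {Q Q' : State → Prop} {σ : State} {e : Expr} {P : Program}

@[simp] theorem wp_skip : wp T .skip Q σ ↔ Q σ := Iff.rfl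
@[simp] theorem wp_assign {x : ℕ} :
    wp T (.assign x e) Q σ ↔ e.MulOk T σ ∧ Q (σ.set x (e.val σ)) := Iff.rfl
@[simp] theorem wp_store {a : ℕ} {i : Expr} : wp T (.store a i e) Q σ ↔
    i.MulOk T σ ∧ e.MulOk T σ ∧ Q (σ.put a (i.val σ) (e.val σ)) := Iff.rfl
@[simp] theorem wp_seq {R : Program} : wp T (P ;; R) Q σ ↔ wp T P (wp T R Q) σ := Iff.rfl
@[simp] theorem wp_ite {R : Program} : wp T (.ite e P R) Q σ ↔
    e.MulOk T σ ∧ (e.val σ ≠ 0 → wp T P Q σ) ∧ (e.val σ = 0 → wp T R Q σ) := Iff.rfl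

theorem wp_mono (P : Program) : ∀ {Q Q' : State → Prop} {σ : State}, wp T P Q σ →
    (∀ τ, Q τ → Q' τ) → wp T P Q' σ := by
  induction P with
  | skip => intro Q Q' σ h hQ; exact hQ _ h
  | assign x e => intro Q Q' σ h hQ; exact ⟨h.1, hQ _ h.2⟩
  | store a i e => intro Q Q' σ h hQ; exact ⟨h.1, h.2.1, hQ _ h.2.2⟩
  | seq P R ihP ihR => intro Q Q' σ h hQ; exact ihP h fun τ hτ => ihR hτ hQ
  | ite e P R ihP ihR =>
    intro Q Q' σ h hQ
    exact ⟨h.1, fun hv => ihP (h.2.1 hv) hQ, fun hv => ihR (h.2.2 hv) hQ⟩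
  | loop e P ih =>
    intro Q Q' σ h hQ
    simp only [wp] at h ⊢
    generalize T + 1 = k at h ⊢
    induction k generalizing σ with
    | zero => exact h
    | succ k ihk =>
      rw [Function.iterate_succ_apply'] at h ⊢
      exact ⟨h.1, fun hv => ih (h.2.1 hv) fun τ => ihk, fun hv => hQ _ (h.2.2 hv)⟩

theorem wp_frame (P : Program) : ∀ {Q : State → Prop} {σ : State}, wp T P Q σ →
    wp T P (fun τ => Q τ ∧ P.Frame σ τ) σ := by
  induction P with
  | skip => intro Q σ h; exact ⟨h, fun _ _ => rfl, fun _ _ => rfl⟩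
  | assign x e =>
    intro Q σ h
    exact ⟨h.1, h.2, fun y hy => by simp_all [Program.regs], fun _ _ => rfl⟩
  | store a i e =>
    intro Q σ h
    exact ⟨h.1, h.2.1, h.2.2, fun _ _ => rfl, fun b hb => by simp_all [Program.arrs]⟩
  | seq P R ihP ihR =>
    intro Q σ h
    refine wp_mono P (ihP h) fun τ hτ => wp_mono R (ihR hτ.1) fun τ' hτ' => ⟨hτ'.1, ?_, ?_⟩
    · intro x hx
      simp only [Program.regs, List.mem_append, not_or] at hx
      rw [hτ'.2.reg x hx.2, hτ.2.reg x hx.1]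
    · intro x hx
      simp only [Program.arrs, List.mem_append, not_or] at hx
      rw [hτ'.2.arr x hx.2, hτ.2.arr x hx.1]
  | ite e P R ihP ihR =>
    intro Q σ h
    refine ⟨h.1, fun hv => wp_mono P (ihP (h.2.1 hv)) fun τ hτ => ⟨hτ.1, ?_, ?_⟩,
      fun hv => wp_mono R (ihR (h.2.2 hv)) fun τ hτ => ⟨hτ.1, ?_, ?_⟩⟩ <;> intro x hx
    · exact hτ.2.reg x (by simp_all [Program.regs])
    · exact hτ.2.arr x (by simp_all [Program.arrs])
    · exact hτ.2.reg x (by simp_all [Program.regs])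
    · exact hτ.2.arr x (by simp_all [Program.arrs])
  | loop e P ih =>
    intro Q σ h
    have key : ∀ (k : ℕ) (τ : State), Program.Frame (.loop e P) σ τ →
        (fun X σ => e.MulOk T σ ∧ (e.val σ ≠ 0 → wp T P X σ) ∧ (e.val σ = 0 → Q σ))^[k]
          (fun _ => False) τ →
        (fun X τ => e.MulOk T τ ∧ (e.val τ ≠ 0 → wp T P X τ) ∧
          (e.val τ = 0 → Q τ ∧ Program.Frame (.loop e P) σ τ))^[k] (fun _ => False) τ := by
      intro k
      induction k with
      | zero => exact fun _ _ h => h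
      | succ k ihk =>
        intro τ hτ h
        rw [Function.iterate_succ_apply'] at h ⊢
        refine ⟨h.1, fun hv => wp_mono P (ih (h.2.1 hv)) fun τ' hτ' => ihk _ ⟨?_, ?_⟩ hτ'.1,
          fun hv => ⟨h.2.2 hv, hτ⟩⟩
        · exact fun x hx => (hτ'.2.reg x hx).trans (hτ.reg x hx)
        · exact fun x hx => (hτ'.2.arr x hx).trans (hτ.arr x hx)
    exact key _ _ ⟨fun _ _ => rfl, fun _ _ => rfl⟩ h

/-- The consequence rule; nothing outside the frame of the program is affected. -/
theorem wp_call (h : wp T P Q' σ) (hQ : ∀ τ, P.Frame σ τ → Q' τ → Q τ) : wp T P Q σ :=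
  wp_mono P (wp_frame P h) fun τ hτ => hQ τ hτ.2 hτ.1

/-- The rule for loops: `n` is a bound on the number of the remaining rounds. -/
theorem wp_loop (Inv : ℕ → State → Prop) (n : ℕ) (hn : n ≤ T) (h₀ : Inv n σ)
    (h : ∀ n τ, n ≤ T → Inv n τ → P.Frame σ τ → e.MulOk T τ ∧
      (e.val τ ≠ 0 → wp T P (fun τ' => ∃ n' < n, Inv n' τ') τ) ∧ (e.val τ = 0 → Q τ)) :
    wp T (.loop e P) Q σ := by
  have key : ∀ k n τ, n < k → n ≤ T → Inv n τ → P.Frame σ τ →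
      (fun X σ => e.MulOk T σ ∧ (e.val σ ≠ 0 → wp T P X σ) ∧ (e.val σ = 0 → Q σ))^[k]
        (fun _ => False) τ := by
    intro k
    induction k with
    | zero => intro n τ hn; omega
    | succ k ih =>
      intro n τ hn hnT hi hf
      rw [Function.iterate_succ_apply']
      obtain ⟨h₁, h₂, h₃⟩ := h n τ hnT hi hf
      refine ⟨h₁, fun hv => wp_call (h₂ hv) ?_, h₃⟩
      rintro τ' hf' ⟨n', hn', hi'⟩
      exact ih n' τ' (by omega) (by omega) hi' ⟨fun x hx => (hf'.reg x hx).trans (hf.reg x hx),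
        fun x hx => (hf'.arr x hx).trans (hf.arr x hx)⟩
  exact key (T + 1) n σ (by omega) hn h₀ ⟨fun _ _ => rfl, fun _ _ => rfl⟩

/-- `for i = 0, …, e - 1 do P`. -/
def Program.for (i : ℕ) (e : Expr) (P : Program) : Program :=
  .assign i 0 ;; .loop (e - .reg i) (P ;; .assign i (.reg i + 1))

/-- The rule for counting loops: `Inv j` holds before the round number `j`. -/
theorem wp_for {i : ℕ} (Inv : ℕ → State → Prop) (N : ℕ) (hN : N ≤ T) (hi : i ∉ P.regs)
    (he : ∀ τ, (Program.for i e P).Frame σ τ → e.MulOk T τ ∧ e.val τ = N)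
    (h₀ : Inv 0 (σ.set i 0))
    (h : ∀ j < N, ∀ τ, (Program.for i e P).Frame σ τ → τ.reg i = j → Inv j τ →
      wp T P (fun τ' => Inv (j + 1) (τ'.set i (j + 1))) τ)
    (hQ : ∀ τ, (Program.for i e P).Frame σ τ → τ.reg i = N → Inv N τ → Q τ) :
    wp T (Program.for i e P) Q σ := by
  have hfr : ∀ τ, (P ;; .assign i (.reg i + 1)).Frame (σ.set i 0) τ →
      (Program.for i e P).Frame σ τ := by
    refine fun τ hτ => ⟨fun x hx => ?_, fun a ha => ?_⟩
    · have : x ≠ i := by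
        rintro rfl
        simp [Program.for, Program.regs] at hx
      rw [hτ.reg x (by simpa [Program.for, Program.regs, this] using hx)]
      simp [this]
    · rw [hτ.arr a (by simpa [Program.for, Program.arrs] using ha)]
      rfl
  refine ⟨trivial, ?_⟩
  refine wp_loop (fun n τ => ∃ j, j + n = N ∧ τ.reg i = j ∧ Inv j τ) N hN
    ⟨0, by simp, by simp, h₀⟩ ?_
  rintro n τ hn ⟨j, hj, hij, hI⟩ hf
  have he' := he τ (hfr τ hf)
  refine ⟨by simpa using he'.1, fun hv => ?_, fun hv => ?_⟩
  · simp only [Expr.val_sub, Expr.val_reg, he'.2, hij] at hv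
    rw [wp_seq]
    refine wp_call (h j (by omega) τ (hfr τ hf) hij hI) fun τ' hf' hI' => ?_
    have hr : τ'.reg i = j := by rw [hf'.reg i hi, hij]
    simp only [wp_assign, Expr.mulOk_add, Expr.mulOk_reg, Expr.mulOk_one, Expr.val_add,
      Expr.val_reg, Expr.val_one, hr, and_self, true_and]
    exact ⟨N - (j + 1), by omega, j + 1, by omega, by simp, hI'⟩
  · simp only [Expr.val_sub, Expr.val_reg, he'.2, hij] at hv
    obtain rfl : j = N := by omega
    exact hQ τ (hfr τ hf) hij hI

theorem bitSize_le {l : List ℕ} {B : ℕ} (h : ∀ n ∈ l, n.size ≤ B) :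
    bitSize l ≤ l.length * (B + 1) := by
  unfold bitSize
  rw [← smul_eq_mul, ← List.length_map (fun n : ℕ => n.size + 1)]
  refine List.sum_le_card_nsmul _ _ fun x hx => ?_
  obtain ⟨n, hn, rfl⟩ := List.mem_map.1 hx
  have := h n hn
  omega

theorem length_le_bitSize (l : List ℕ) : l.length ≤ bitSize l := by
  induction l with
  | nil => simp
  | cons a l ih => simp only [bitSize, List.map_cons, List.sum_cons, List.length_cons] at *; omega

theorem size_le_bitSize {l : List ℕ} {n : ℕ} (h : n ∈ l) : n.size + 1 ≤ bitSize l :=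
  List.single_le_sum (by simp) _ (List.mem_map_of_mem h)

theorem size_getD_le_bitSize (l : List ℕ) (i : ℕ) : (l.getD i 0).size ≤ bitSize l := by
  by_cases h : i < l.length
  · rw [List.getD_eq_getElem _ _ h]
    have := size_le_bitSize (List.getElem_mem h)
    omega
  · rw [List.getD_eq_default _ _ (by omega)]
    simp

theorem _root_.Nat.size_le_self (n : ℕ) : n.size ≤ n :=
  Nat.size_le.2 Nat.lt_two_pow_self

theorem init_bounded (l : List ℕ) : (State.init l).Bounded (bitSize l) := by
  refine ⟨fun x => ?_, fun a i => ?_⟩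
  · by_cases hx : x = 0
    · simpa [State.init, hx] using (Nat.size_le_self _).trans (length_le_bitSize l)
    · simp [State.init, hx]
  · by_cases ha : a = 0
    · simpa [State.init, ha] using size_getD_le_bitSize l i
    · simp [State.init, ha]

/-- A correct program whose loops stop after polynomially many rounds, and that multiplies only
by factors of polynomial bit length, solves the problem in polynomial time. -/
theorem polyTimeSolvable_of_wp {α : Type} {β : α → Type} {enc : α → List ℕ}
    {encOut : (a : α) → β a → List ℕ} {Sol : (a : α) → β a → Prop} (P : Program)
    (hP : P.SlowOutput) (q : Polynomial ℕ)
    (h : ∀ a, wp (q.eval (bitSize (enc a))) P (fun σ => ∃ b, Sol a b ∧ σ.output = encOut a b)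
      (State.init (enc a))) : PolyTimeSolvable enc encOut Sol := by
  refine ⟨P, 3 * (P.steps.comp q * (.X + P.steps.comp q * (q + 1) + 1)), fun a => ?_⟩
  obtain ⟨σ, n, ⟨b, hb, hout⟩, hn, hs, hr⟩ := exists_run P (h a)
  obtain ⟨hB, t, ht, htn⟩ := hr _ (init_bounded _)
  refine ⟨b, hb, σ, t, ht, hout, ?_⟩
  simp only [Polynomial.eval_mul, Polynomial.eval_add, Polynomial.eval_X, Polynomial.eval_one,
    Polynomial.eval_comp, Polynomial.eval_ofNat]
  set L := bitSize (enc a)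
  set T := q.eval L
  set N := P.steps.eval T
  have h1 : σ.reg 1 ≤ 2 * n := by simpa [State.init] using hs hP
  have h2 : bitSize (encOut a b) ≤ σ.reg 1 * (L + n * (T + 1) + 1) := by
    rw [← hout]
    refine (bitSize_le (B := L + n * (T + 1)) fun m hm => ?_).trans_eq
      (by simp [State.output])
    obtain ⟨i, -, rfl⟩ := List.mem_map.1 hm
    exact hB.2 1 i
  calc t + bitSize (encOut a b)
      ≤ n * (L + n * (T + 1) + 1) + 2 * n * (L + n * (T + 1) + 1) :=
        add_le_add htn (h2.trans (by gcongr))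
    _ = 3 * (n * (L + n * (T + 1) + 1)) := by ring
    _ ≤ 3 * (N * (L + N * (T + 1) + 1)) := by gcongr

end RAM

namespace FLRouting

open RAM

/-! ### Registers and arrays -/

/-- Number of satellites. -/
abbrev rI : ℕ := 2
/-- Number of snapshots. -/
abbrev rK : ℕ := 3
/-- Number of models. -/
abbrev rM : ℕ := 4
/-- The server, which is also the number of the source node. -/
abbrev rServer : ℕ := 5
/-- Number of nodes. -/
abbrev rN : ℕ := 6
/-- Row length of the matrices. -/
abbrev rW : ℕ := 7
/-- The common denominator. -/
abbrev rDen : ℕ := 8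
/-- The scaled total demand. -/
abbrev rTotal : ℕ := 9
/-- The trial snapshot. -/
abbrev rTrial : ℕ := 10
/-- The least entry of the matrix that counts as an arc in a search. -/
abbrev rThr : ℕ := 11
/-- The value of the flow. -/
abbrev rVal : ℕ := 12
/-- A search uses the nodes below this number. -/
abbrev rCount : ℕ := 13
/-- The node at which a search starts. -/
abbrev rSrc : ℕ := 14
/-- The node that a search has to reach. -/
abbrev rDst : ℕ := 15
/-- The number of nodes on the path that was found, `0` if there is none. -/
abbrev rLen : ℕ := 16
/-- The number of nodes in the queue. -/
abbrev rTail : ℕ := 17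
/-- The position in the queue. -/
abbrev rHead : ℕ := 18
/-- A scratch register, often for the first index of a matrix entry. -/
abbrev rU : ℕ := 19
/-- A scratch register, often for the second index of a matrix entry. -/
abbrev rV : ℕ := 20
/-- A scratch register, often for a position on a path. -/
abbrev rJ : ℕ := 21
/-- The model whose data are being routed. -/
abbrev rModel : ℕ := 22
/-- The client whose data are being routed. -/
abbrev rClient : ℕ := 23
/-- The amount still to be routed. -/
abbrev rNeed : ℕ := 24
/-- The amount on a path. -/
abbrev rAmount : ℕ := 25
/-- The number of path flows written. -/
abbrev rPieces : ℕ := 26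

/-- The scaled capacities and sizes. -/
abbrev aScaled : ℕ := 2
/-- The scaled demands of the satellites. -/
abbrev aDemand : ℕ := 3
/-- The capacity matrix. -/
abbrev aCap : ℕ := 4
/-- The matrix on which searches run: residual capacities, and later the transposed flow. -/
abbrev aMat : ℕ := 5
/-- The queue. -/
abbrev aQueue : ℕ := 6
/-- The queue positions of the predecessors of the nodes in the queue. -/
abbrev aPred : ℕ := 7
/-- One plus the queue position of a node, `0` if the node is not in the queue. -/
abbrev aPos : ℕ := 8
/-- The path that was found, from the end to the start of the search. -/
abbrev aPath : ℕ := 9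

/-! ### Searching for a path -/

/-- Breadth-first search from `rSrc`, along the entries of `aMat` that are at least `rThr`. -/
def bfs : Program :=
  .for rV (.reg rCount) (.store aPos (.reg rV) 0) ;;
  .store aQueue 0 (.reg rSrc) ;;
  .store aPos (.reg rSrc) 1 ;;
  .assign rTail 1 ;;
  .assign rHead 0 ;;
  .loop (.reg rTail - .reg rHead) (
    .assign rU (.cell aQueue (.reg rHead)) ;;
    .for rV (.reg rCount) (
      .ite (1 - .cell aPos (.reg rV)) (
        .ite (.cell aMat (.reg rU * .reg rW + .reg rV) + 1 - .reg rThr) (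
          .store aQueue (.reg rTail) (.reg rV) ;;
          .store aPred (.reg rTail) (.reg rHead) ;;
          .assign rTail (.reg rTail + 1) ;;
          .store aPos (.reg rV) (.reg rTail))
        .skip)
      .skip) ;;
    .assign rHead (.reg rHead + 1))

/-- Search for a path and write it to `aPath`, following the predecessors back from `rDst`. -/
def findPath : Program :=
  bfs ;;
  .assign rLen 0 ;;
  .ite (.cell aPos (.reg rDst)) (
    .assign rJ (.cell aPos (.reg rDst) - 1) ;;
    .store aPath 0 (.reg rDst) ;;
    .assign rLen 1 ;;
    .loop (.reg rJ) (
      .assign rJ (.cell aPred (.reg rJ)) ;;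
      .store aPath (.reg rLen) (.cell aQueue (.reg rJ)) ;;
      .assign rLen (.reg rLen + 1)))
  .skip

/-- `path 0, …, path (len - 1)` is a simple path from `dst` back to `src`. -/
structure IsPathTo (adj : ℕ → ℕ → Prop) (w src dst : ℕ) (path : ℕ → ℕ) (len : ℕ) : Prop where
  pos : 0 < len
  first : path 0 = dst
  last : path (len - 1) = src
  lt : ∀ i < len, path i < w
  inj : ∀ i j, i < j → j < len → path i ≠ path j
  adj : ∀ i, i + 1 < len → adj (path (i + 1)) (path i)

/-- No arc leaves some set of nodes that contains `src` but not `dst`. -/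
def Separated (adj : ℕ → ℕ → Prop) (w src dst : ℕ) : Prop :=
  ∃ S ⊆ Finset.range w, src ∈ S ∧ dst ∉ S ∧ ∀ u ∈ S, ∀ v < w, v ∉ S → ¬ adj u v

/-- The invariant of the search: the arcs out of the first `head` nodes of the queue, and those
from the next node to the nodes below `j`, have been explored. -/
structure SearchInv (adj : ℕ → ℕ → Prop) (w src : ℕ) (queue pred pos : ℕ → ℕ)
    (tail head j : ℕ) : Prop where
  tail_pos : 0 < tail
  first : queue 0 = src
  queue_lt : ∀ p < tail, queue p < w
  pos_queue : ∀ p < tail, pos (queue p) = p + 1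
  pred_lt : ∀ p < tail, 0 < p → pred p < p
  pred_adj : ∀ p < tail, 0 < p → adj (queue (pred p)) (queue p)
  pos_le : ∀ v < w, pos v ≤ tail
  queue_pos : ∀ v < w, pos v ≠ 0 → queue (pos v - 1) = v
  closed : ∀ p < tail, ∀ v < w, p < head ∨ p = head ∧ v < j → adj (queue p) v → pos v ≠ 0

namespace SearchInv

variable {adj : ℕ → ℕ → Prop} {w src tail head j : ℕ} {queue pred pos : ℕ → ℕ}

theorem init (hs : src < w) (h : ∀ v < w, pos v = 0) :
    SearchInv adj w src (Function.update queue 0 src) pred (Function.update pos src 1) 1 0 0 where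
  tail_pos := one_pos
  first := by simp
  queue_lt p hp := by obtain rfl : p = 0 := by omega
                      simpa using hs
  pos_queue p hp := by obtain rfl : p = 0 := by omega
                       simp
  pred_lt p hp h0 := by omega
  pred_adj p hp h0 := by omega
  pos_le v hv := by
    rw [Function.update_apply]
    split_ifs
    · exact le_rfl
    · simp [h v hv]
  queue_pos v hv h0 := by
    rw [Function.update_apply] at h0
    split_ifs at h0 with hvs
    · simp [hvs]
    · exact absurd (h v hv) h0
  closed p hp v hv hc := by omega

/-- The node `j` has been visited before or is not adjacent, and is passed over. -/
theorem skip (h : SearchInv adj w src queue pred pos tail head j)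
    (hj : pos j ≠ 0 ∨ ¬ adj (queue head) j) :
    SearchInv adj w src queue pred pos tail head (j + 1) :=
  { h with
    closed := fun p hp v hv hc ha => by
      by_cases hpv : p = head ∧ v = j
      · obtain ⟨rfl, rfl⟩ := hpv
        tauto
      · exact h.closed p hp v hv (by omega) ha }

/-- The node `j` is appended to the queue. -/
theorem push (h : SearchInv adj w src queue pred pos tail head j) (hj : j < w)
    (hh : head < tail) (h0 : pos j = 0) (ha : adj (queue head) j) :
    SearchInv adj w src (Function.update queue tail j) (Function.update pred tail head)
      (Function.update pos j (tail + 1)) (tail + 1) head (j + 1) := by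
  have hne : ∀ p < tail, queue p ≠ j := by
    rintro p hp rfl
    have := h.pos_queue p hp
    omega
  have hq : ∀ p < tail, Function.update queue tail j p = queue p := fun p hp => by
    rw [Function.update_of_ne (by omega)]
  constructor
  · omega
  · rw [hq _ h.tail_pos, h.first]
  · intro p hp
    rcases Nat.lt_succ_iff_lt_or_eq.1 hp with hp | rfl
    · rw [hq p hp]
      exact h.queue_lt p hp
    · simpa using hj
  · intro p hp
    rcases Nat.lt_succ_iff_lt_or_eq.1 hp with hp | rfl
    · rw [hq p hp, Function.update_of_ne (hne p hp), h.pos_queue p hp]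
    · simp
  · intro p hp h1
    rcases Nat.lt_succ_iff_lt_or_eq.1 hp with hp | rfl
    · rw [Function.update_of_ne (by omega)]
      exact h.pred_lt p hp h1
    · simpa using hh
  · intro p hp h1
    rcases Nat.lt_succ_iff_lt_or_eq.1 hp with hp | rfl
    · have := h.pred_lt p hp h1
      rw [Function.update_of_ne (a := p) (by omega), hq p hp, hq _ (by omega)]
      exact h.pred_adj p hp h1
    · simpa [hq head hh] using ha
  · intro v hv
    rw [Function.update_apply]
    split_ifs
    · exact le_rfl
    · exact (h.pos_le v hv).trans (Nat.le_succ _)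
  · intro v hv hv0
    by_cases hvj : v = j
    · simp [hvj]
    · rw [Function.update_of_ne hvj] at hv0 ⊢
      have := h.pos_le v hv
      rw [hq _ (by omega), h.queue_pos v hv hv0]
  · intro p hp v hv hc hav
    by_cases hvj : v = j
    · simp [hvj]
    · rw [Function.update_of_ne hvj]
      have hp' : p < tail := by omega
      rw [hq p hp'] at hav
      exact h.closed p hp' v hv (by omega) hav

theorem next (h : SearchInv adj w src queue pred pos tail head w) :
    SearchInv adj w src queue pred pos tail (head + 1) 0 :=
  { h with
    closed := fun p hp v hv hc ha => h.closed p hp v hv (by omega) ha }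

theorem tail_le (h : SearchInv adj w src queue pred pos tail head j) : tail ≤ w := by
  have : (Finset.range tail).card ≤ (Finset.range w).card := by
    refine Finset.card_le_card_of_injOn queue (fun p hp => ?_) fun p hp q hq hpq => ?_
    · exact Finset.mem_coe.2 (Finset.mem_range.2 (h.queue_lt p (Finset.mem_range.1 hp)))
    · have h1 := h.pos_queue p (Finset.mem_range.1 hp)
      have h2 := h.pos_queue q (Finset.mem_range.1 hq)
      rw [hpq] at h1
      omega
  simpa using this

theorem separated (h : SearchInv adj w src queue pred pos tail head j) (hh : tail ≤ head)
    {dst : ℕ} (hd : pos dst = 0) : Separated adj w src dst := by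
  refine ⟨(Finset.range tail).image queue, ?_, ?_, ?_, ?_⟩
  · intro v hv
    obtain ⟨p, hp, rfl⟩ := Finset.mem_image.1 hv
    exact Finset.mem_range.2 (h.queue_lt p (Finset.mem_range.1 hp))
  · exact Finset.mem_image.2 ⟨0, Finset.mem_range.2 h.tail_pos, h.first⟩
  · intro hv
    obtain ⟨p, hp, rfl⟩ := Finset.mem_image.1 hv
    have := h.pos_queue p (Finset.mem_range.1 hp)
    omega
  · intro u hu v hv hvS ha
    obtain ⟨p, hp, rfl⟩ := Finset.mem_image.1 hu
    have hp := Finset.mem_range.1 hp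
    have h0 := h.closed p hp v hv (by omega) ha
    have := h.pos_le v hv
    exact hvS (Finset.mem_image.2 ⟨pos v - 1, Finset.mem_range.2 (by omega), h.queue_pos v hv h0⟩)

end SearchInv

theorem wp_bfs {T w W src thr : ℕ} {σ : State} (hw : σ.reg rCount = w) (hW : σ.reg rW = W)
    (hsrc : σ.reg rSrc = src) (hthr : σ.reg rThr = thr) (hs : src < w) (hT : w ≤ T)
    (hTW : W.size ≤ T) :
    wp T bfs (fun τ => ∃ tail head, tail ≤ head ∧
      SearchInv (fun u v => thr ≤ σ.arr aMat (u * W + v)) w src (τ.arr aQueue) (τ.arr aPred)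
        (τ.arr aPos) tail head 0) σ := by
  unfold bfs
  rw [wp_seq]
  refine wp_for (fun j τ => ∀ v < j, τ.arr aPos v = 0) w hT (by decide) (fun τ hf => ?_) ?_ ?_ ?_
  · simp [hf.reg rCount (by decide), hw]
  · simp
  · intro j hj τ hf hij hI
    simp +decide only [wp_store, Expr.mulOk_reg, Expr.mulOk_zero, true_and, State.arr_set,
      State.arr_put, if_true, Expr.val_reg, hij, Expr.val_zero]
    intro v hv
    rw [Function.update_apply]
    split_ifs with h
    · rfl
    · exact hI v (by omega)
  rintro τ hf - hpos
  have hsrc' : τ.reg rSrc = src := by rw [hf.reg rSrc (by decide), hsrc]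
  simp +decide only [wp_seq, wp_store, wp_assign, Expr.mulOk_reg, Expr.mulOk_zero, Expr.mulOk_one,
    true_and, Expr.val_reg, Expr.val_zero, Expr.val_one, hsrc', State.reg_put]
  refine wp_loop (fun n τ' => ∃ tail head, τ'.reg rTail = tail ∧ τ'.reg rHead = head ∧
    n + head = w ∧ SearchInv (fun u v => thr ≤ σ.arr aMat (u * W + v)) w src (τ'.arr aQueue)
      (τ'.arr aPred) (τ'.arr aPos) tail head 0) w hT ⟨1, 0, ?_⟩ ?_
  · simpa using SearchInv.init hs hpos
  rintro n τ₁ hn ⟨tail, head, htail, hhead, hnh, hI⟩ hf₁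
  refine ⟨by simp, fun hv => ?_, fun hv => ⟨tail, head, by simp [htail, hhead] at hv; omega, hI⟩⟩
  simp only [Expr.val_sub, Expr.val_reg, htail, hhead] at hv
  have hht : head < tail := by omega
  simp +decide only [wp_seq, wp_assign, Expr.mulOk_reg, Expr.mulOk_cell, Expr.val_cell,
    Expr.val_reg, true_and, hhead]
  refine wp_for (fun j τ' => ∃ tail', head < tail' ∧ τ'.reg rTail = tail' ∧
    τ'.arr aQueue head = τ₁.arr aQueue head ∧
    SearchInv (fun u v => thr ≤ σ.arr aMat (u * W + v)) w src (τ'.arr aQueue)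
      (τ'.arr aPred) (τ'.arr aPos) tail' head j) w hT (by decide) (fun τ' hf' => ?_) ?_ ?_ ?_
  · rw [Expr.val_reg, hf'.reg rCount (by decide)]
    simp [hf₁.reg rCount (by decide), hf.reg rCount (by decide), hw]
  · exact ⟨tail, hht, by simpa using htail, by simp, by simpa using hI⟩
  · rintro j hj τ₂ hf₂ hij ⟨tail', hht', htail', hq, hI'⟩
    have hu : τ₂.reg rU = τ₁.arr aQueue head := by rw [hf₂.reg rU (by decide)]; simp
    have hW' : τ₂.reg rW = W := by
      rw [hf₂.reg rW (by decide)]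
      simp [hf₁.reg rW (by decide), hf.reg rW (by decide), hW]
    have hthr' : τ₂.reg rThr = thr := by
      rw [hf₂.reg rThr (by decide)]
      simp [hf₁.reg rThr (by decide), hf.reg rThr (by decide), hthr]
    have hhead' : τ₂.reg rHead = head := by
      rw [hf₂.reg rHead (by decide)]
      simp [hhead]
    have hmat : τ₂.arr aMat = σ.arr aMat := by
      rw [hf₂.arr aMat (by decide)]
      simp [hf₁.arr aMat (by decide), hf.arr aMat (by decide)]
    simp +decide only [wp_ite, wp_seq, wp_store, wp_assign, wp_skip, Expr.mulOk_reg,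
      Expr.mulOk_cell, Expr.mulOk_sub, Expr.mulOk_add, Expr.mulOk_mul, Expr.mulOk_one, Expr.val_reg, Expr.val_cell,
      Expr.val_add, Expr.val_sub, Expr.val_mul, Expr.val_one, hu, hW', hthr', hhead', hmat, hij,
      htail', true_and, and_true, hTW, State.reg_put, State.reg_set, State.arr_put, State.arr_set]
    refine ⟨fun h0 => ⟨fun h1 => ?_, fun h1 => ?_⟩, fun h0 => ?_⟩
    · refine ⟨tail' + 1, by omega, by simp, ?_, ?_⟩
      · simpa [Function.update_of_ne hht'.ne] using hq
      · simpa using hI'.push hj hht' (by omega) (by rw [hq]; omega)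
    · refine ⟨tail', hht', by simp, by simpa using hq, ?_⟩
      simpa using hI'.skip (.inr (by rw [hq]; omega))
    · refine ⟨tail', hht', by simp, by simpa using hq, ?_⟩
      simpa using hI'.skip (.inl (by omega))
  · rintro τ₂ hf₂ - ⟨tail', hht', htail', hq, hI'⟩
    have hhead' : τ₂.reg rHead = head := by
      rw [hf₂.reg rHead (by decide)]
      simp [hhead]
    have := hI'.tail_le
    simp only [wp_assign, Expr.mulOk_add, Expr.mulOk_reg, Expr.mulOk_one, and_self, Expr.val_add,
      Expr.val_reg, hhead', Expr.val_one, true_and]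
    exact ⟨w - (head + 1), by omega, tail', head + 1, by simpa using htail', by simp, by omega,
      by simpa using hI'.next⟩

/-- The search finds a simple path, or else the nodes reached show that there is none. -/
theorem wp_findPath {T w W src dst thr : ℕ} {σ : State} (hw : σ.reg rCount = w)
    (hW : σ.reg rW = W) (hsrc : σ.reg rSrc = src) (hdst : σ.reg rDst = dst)
    (hthr : σ.reg rThr = thr) (hs : src < w) (hd : dst < w) (hT : w ≤ T) (hTW : W.size ≤ T) :
    wp T findPath (fun τ =>
      (τ.reg rLen ≠ 0 → IsPathTo (fun u v => thr ≤ σ.arr aMat (u * W + v)) w src dst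
        (τ.arr aPath) (τ.reg rLen)) ∧
      (τ.reg rLen = 0 → Separated (fun u v => thr ≤ σ.arr aMat (u * W + v)) w src dst)) σ := by
  unfold findPath
  rw [wp_seq]
  refine wp_call (wp_bfs hw hW hsrc hthr hs hT hTW) ?_
  rintro τ hf ⟨tail, head, hth, hI⟩
  have hdst' : τ.reg rDst = dst := by rw [hf.reg rDst (by decide), hdst]
  simp +decide only [wp_ite, wp_seq, wp_store, wp_assign, wp_skip, Expr.mulOk_reg, Expr.mulOk_cell,
      Expr.mulOk_sub, Expr.mulOk_one, Expr.mulOk_zero, Expr.val_reg, Expr.val_cell,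
      Expr.val_sub, Expr.val_one, Expr.val_zero, hdst', true_and, State.reg_set, State.arr_set,
      if_false]
  constructor
  swap
  · intro h0
    simpa using hI.separated hth h0
  intro h0
  have hpd := hI.pos_le dst hd
  have htw := hI.tail_le
  refine wp_loop (fun n τ' => τ'.reg rJ = n ∧ n < tail ∧ ∃ len, τ'.reg rLen = len + 1 ∧
    τ'.arr aPath 0 = dst ∧ τ'.arr aPath len = τ.arr aQueue n ∧
    (∀ i ≤ len, τ'.arr aPath i < w ∧ n + 1 ≤ τ.arr aPos (τ'.arr aPath i)) ∧
    (∀ i j, i < j → j ≤ len → τ.arr aPos (τ'.arr aPath j) < τ.arr aPos (τ'.arr aPath i)) ∧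
    ∀ i < len, thr ≤ σ.arr aMat (τ'.arr aPath (i + 1) * W + τ'.arr aPath i))
    (τ.arr aPos dst - 1) (by omega) ?_ ?_
  · refine ⟨by simp, by omega, 0, by simp, by simp, by simp [hI.queue_pos dst hd h0], ?_, ?_, ?_⟩
    · intro i hi
      obtain rfl : i = 0 := by omega
      simp +decide only [State.arr_set, State.arr_put, if_true, Function.update_self]
      exact ⟨hd, by omega⟩
    · intro i j hij hj
      omega
    · intro i hi
      omega
  rintro n τ₁ hn ⟨hJ, hnt, len, hlen, hp0, hpl, hlt, hdec, hadj⟩ hf₁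
  refine ⟨by simp, fun hv => ?_, fun hv => ?_⟩
  · simp only [Expr.val_reg, hJ] at hv
    have hQ : τ₁.arr aQueue = τ.arr aQueue := by
      rw [hf₁.arr aQueue (by decide)]
      simp
    have hP : τ₁.arr aPred = τ.arr aPred := by
      rw [hf₁.arr aPred (by decide)]
      simp
    have hlt' := hI.pred_lt n hnt (by omega)
    set n' := τ.arr aPred n with hn'
    simp +decide only [wp_seq, wp_store, wp_assign, Expr.mulOk_reg, Expr.mulOk_cell, Expr.mulOk_add,
      Expr.mulOk_one, Expr.val_reg, Expr.val_cell, Expr.val_add, Expr.val_one, true_and, and_true,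
      State.reg_set, State.arr_set, State.reg_put, State.arr_put, hJ, hlen, hQ, hP, if_true,
      if_false, ← hn']
    have hup : ∀ i ≤ len, Function.update (τ₁.arr aPath) (len + 1) (τ.arr aQueue n') i =
        τ₁.arr aPath i := fun i hi => Function.update_of_ne (by omega) _ _
    refine ⟨n', hlt', rfl, by omega, len + 1, rfl, ?_, by simp, ?_, ?_, ?_⟩
    · rw [hup 0 (by omega), hp0]
    · intro i hi
      rcases Nat.le_succ_iff.1 hi with hi | rfl
      · rw [hup i hi]
        exact ⟨(hlt i hi).1, by have := (hlt i hi).2; omega⟩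
      · simp only [Nat.succ_eq_add_one, Function.update_self]
        exact ⟨hI.queue_lt _ (by omega), (hI.pos_queue _ (by omega)).ge⟩
    · intro i j hij hj
      rw [hup i (by omega)]
      rcases Nat.le_succ_iff.1 hj with hj | rfl
      · rw [hup j hj]
        exact hdec i j hij hj
      · simp only [Nat.succ_eq_add_one, Function.update_self]
        rw [hI.pos_queue _ (by omega)]
        have := (hlt i (by omega)).2
        omega
    · intro i hi
      rw [hup i (by omega)]
      rcases Nat.lt_succ_iff_lt_or_eq.1 hi with hi | rfl
      · rw [hup _ (by omega)]
        exact hadj i hi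
      · simp only [Function.update_self, hpl]
        exact hI.pred_adj n hnt (by omega)
  · simp only [Expr.val_reg, hJ] at hv
    subst hv
    refine ⟨fun _ => ?_, fun h => by omega⟩
    rw [hlen]
    refine ⟨by omega, hp0, ?_, fun i hi => (hlt i (by omega)).1, fun i j hij hj h => ?_,
      fun i hi => hadj i (by omega)⟩
    · rw [Nat.add_sub_cancel, hpl, hI.first]
    · have := hdec i j hij (by omega)
      rw [h] at this
      omega

end FLRouting

namespace FLRouting

open RAM

/-! ### Maximum flows by capacity scaling -/

/-- The matrix stored row by row, with rows of length `W`, in the array `A`. -/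
def mat (A : ℕ → ℕ) (W u v : ℕ) : ℕ := A (u * W + v)

theorem mul_add_inj {W u v x y : ℕ} (hv : v < W) (hy : y < W) :
    u * W + v = x * W + y ↔ u = x ∧ v = y := by
  refine ⟨fun h => ?_, fun ⟨h₁, h₂⟩ => by rw [h₁, h₂]⟩
  have h1 : (u * W + v) / W = u := by
    rw [mul_comm, Nat.mul_add_div (by omega), Nat.div_eq_of_lt hv, add_zero]
  have h2 : (x * W + y) / W = x := by
    rw [mul_comm, Nat.mul_add_div (by omega), Nat.div_eq_of_lt hy, add_zero]
  have : u = x := by rw [← h1, h, h2]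
  subst this
  exact ⟨rfl, by omega⟩

theorem mat_update {W x y : ℕ} (A : ℕ → ℕ) (hy : y < W) (z u v : ℕ) (hv : v < W) :
    mat (Function.update A (x * W + y) z) W u v = if u = x ∧ v = y then z else mat A W u v := by
  simp only [mat, Function.update_apply, mul_add_inj hv hy]

/-- How often the arc from `u` to `v` is among the first `j` arcs of the path, which is traversed
backwards. -/
def pathCount (path : ℕ → ℕ) (j u v : ℕ) : ℕ :=
  ∑ i ∈ Finset.range j, if path (i + 1) = u ∧ path i = v then 1 else 0

theorem pathCount_succ (path : ℕ → ℕ) (j u v : ℕ) : pathCount path (j + 1) u v =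
    pathCount path j u v + if path (j + 1) = u ∧ path j = v then 1 else 0 :=
  Finset.sum_range_succ _ _

theorem sum_pathCount {path : ℕ → ℕ} {W j : ℕ} (h : ∀ i < j, path i < W) (u : ℕ) :
    ∑ v ∈ Finset.range W, pathCount path j u v =
      ∑ i ∈ Finset.range j, if path (i + 1) = u then 1 else 0 := by
  unfold pathCount
  rw [Finset.sum_comm]
  refine Finset.sum_congr rfl fun i hi => ?_
  have := h i (Finset.mem_range.1 hi)
  by_cases hu : path (i + 1) = u <;> simp [hu, this]

theorem sum_pathCount' {path : ℕ → ℕ} {W j : ℕ} (h : ∀ i < j, path (i + 1) < W) (u : ℕ) :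
    ∑ v ∈ Finset.range W, pathCount path j v u =
      ∑ i ∈ Finset.range j, if path i = u then 1 else 0 := by
  unfold pathCount
  rw [Finset.sum_comm]
  refine Finset.sum_congr rfl fun i hi => ?_
  have := h i (Finset.mem_range.1 hi)
  by_cases hu : path i = u <;> simp [hu, this]

/-- A path enters every node as often as it leaves it, except for its two ends. -/
theorem sum_pathCount_add {path : ℕ → ℕ} {W j : ℕ} (h : ∀ i ≤ j, path i < W) (u : ℕ) :
    (∑ v ∈ Finset.range W, pathCount path j u v) + (if u = path 0 then 1 else 0) =
      (∑ v ∈ Finset.range W, pathCount path j v u) + if u = path j then 1 else 0 := by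
  rw [sum_pathCount fun i hi => h i hi.le, sum_pathCount' fun i hi => h (i + 1) hi]
  simp only [eq_comm (a := u)]
  rw [← Finset.sum_range_succ (fun i => if path i = u then 1 else 0), Finset.sum_range_succ']

theorem IsPathTo.pathCount_eq_zero {adj : ℕ → ℕ → Prop} {w src dst len j : ℕ} {path : ℕ → ℕ}
    (h : IsPathTo adj w src dst path len) (hj : j + 1 < len) :
    pathCount path j (path (j + 1)) (path j) = 0 := by
  refine Finset.sum_eq_zero fun i hi => if_neg fun hi' => ?_
  exact h.inj i j (Finset.mem_range.1 hi) (by omega) hi'.2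

theorem IsPathTo.len_le {adj : ℕ → ℕ → Prop} {w src dst len : ℕ} {path : ℕ → ℕ}
    (h : IsPathTo adj w src dst path len) : len ≤ w := by
  have := Finset.card_le_card_of_injOn (s := Finset.range len) (t := Finset.range w) path
    (fun i hi => Finset.mem_coe.2 (Finset.mem_range.2 (h.lt i (Finset.mem_range.1 hi))))
    (fun i hi j hj hij => by
      have hi := Finset.mem_range.1 hi
      have hj := Finset.mem_range.1 hj
      rcases lt_trichotomy i j with hlt | heq | hlt
      · exact absurd hij (h.inj i j hlt hj)
      · exact heq
      · exact absurd hij.symm (h.inj j i hlt hi))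
  simpa using this

/-- Send the amount `rThr` along the path, updating the residual capacities. -/
def augment : Program :=
  .for rJ (.reg rLen - 1) (
    .assign rU (.cell aPath (.reg rJ + 1)) ;;
    .assign rV (.cell aPath (.reg rJ)) ;;
    .store aMat (.reg rU * .reg rW + .reg rV)
      (.cell aMat (.reg rU * .reg rW + .reg rV) - .reg rThr) ;;
    .store aMat (.reg rV * .reg rW + .reg rU)
      (.cell aMat (.reg rV * .reg rW + .reg rU) + .reg rThr))

theorem wp_augment {T W src dst thr len : ℕ} {σ : State} (hW : σ.reg rW = W)
    (hthr : σ.reg rThr = thr) (hlen : σ.reg rLen = len)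
    (hp : IsPathTo (fun u v => thr ≤ mat (σ.arr aMat) W u v) W src dst (σ.arr aPath) len)
    (hTl : len ≤ T) (hTW : W.size ≤ T) :
    wp T augment (fun τ => ∀ u < W, ∀ v < W,
      mat (τ.arr aMat) W u v + thr * pathCount (σ.arr aPath) (len - 1) u v =
        mat (σ.arr aMat) W u v + thr * pathCount (σ.arr aPath) (len - 1) v u) σ := by
  set path := σ.arr aPath with hpath
  refine wp_for (fun j τ => ∀ u < W, ∀ v < W,
      mat (τ.arr aMat) W u v + thr * pathCount path j u v =
        mat (σ.arr aMat) W u v + thr * pathCount path j v u) (len - 1) (by omega) (by decide)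
    (fun τ hf => ?_) ?_ ?_ fun τ _ _ h => h
  · simp [hf.reg rLen (by decide), hlen]
  · simp [pathCount]
  intro j hj τ hf hij hI
  have hy := hp.lt j (by omega)
  have hx := hp.lt (j + 1) (by omega)
  have hxy := hp.inj j (j + 1) (by omega) (by omega)
  have hle : thr ≤ mat (τ.arr aMat) W (path (j + 1)) (path j) := by
    have h1 := hI _ hx _ hy
    rw [hp.pathCount_eq_zero (by omega)] at h1
    have h2 := hp.adj j (by omega)
    omega
  simp +decide only [wp_seq, wp_assign, wp_store, Expr.mulOk_cell, Expr.mulOk_add, Expr.mulOk_sub,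
    Expr.mulOk_mul, Expr.mulOk_reg, Expr.mulOk_one, Expr.val_reg, Expr.val_cell, Expr.val_add,
    Expr.val_sub, Expr.val_mul, Expr.val_one, State.reg_set, State.reg_put, State.arr_set,
    State.arr_put, if_true, if_false, true_and, and_true, hf.reg rW (by decide), hW,
    hf.reg rThr (by decide), hthr, hf.arr aPath (by decide), ← hpath, hij, hTW]
  intro u hu v hv
  have h1 := hI u hu v hv
  rw [mat_update _ hx _ _ _ hv, mat_update _ hy _ _ _ hv, pathCount_succ, pathCount_succ]
  have hcell : Function.update (τ.arr aMat) (path (j + 1) * W + path j)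
      (τ.arr aMat (path (j + 1) * W + path j) - thr) (path j * W + path (j + 1)) =
      mat (τ.arr aMat) W (path j) (path (j + 1)) :=
    Function.update_of_ne (fun h => hxy ((mul_add_inj hx hy).1 h).1) _ _
  rw [hcell]
  clear hcell
  change thr ≤ τ.arr aMat (path (j + 1) * W + path j) at hle
  rw [mul_add, mul_add, ← add_assoc, ← add_assoc]
  by_cases h2 : u = path (j + 1) ∧ v = path j
  · obtain ⟨rfl, rfl⟩ := h2
    rw [if_neg (fun h => hxy h.1.symm), if_pos ⟨rfl, rfl⟩, if_pos ⟨rfl, rfl⟩,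
      if_neg (fun h => hxy h.1.symm)]
    simp only [mat] at h1 ⊢
    omega
  · rw [if_neg (c := path (j + 1) = u ∧ path j = v) (fun h => h2 ⟨h.1.symm, h.2.symm⟩)]
    by_cases h3 : u = path j ∧ v = path (j + 1)
    · obtain ⟨rfl, rfl⟩ := h3
      rw [if_pos ⟨rfl, rfl⟩, if_pos ⟨rfl, rfl⟩]
      simp only [mat] at h1 ⊢
      omega
    · rw [if_neg h3, if_neg h2, if_neg (fun h => h3 ⟨h.2.symm, h.1.symm⟩)]
      omega

/-- The capacities `R` are what remains of the capacities `C` under some flow of the given value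
from `s` to `t`; the net flow from `u` to `v` is `C u v - R u v`. -/
structure IsResidual (C R : ℕ → ℕ → ℕ) (W s t val : ℕ) : Prop where
  pair : ∀ u < W, ∀ v < W, R u v + R v u = C u v + C v u
  row : ∀ u < W, (∑ v ∈ Finset.range W, R u v) + (if u = s then val else 0) =
    (∑ v ∈ Finset.range W, C u v) + if u = t then val else 0

/-- The total capacity of the arcs that leave `S`. -/
def cut (A : ℕ → ℕ → ℕ) (W : ℕ) (S : Finset ℕ) : ℕ :=
  ∑ u ∈ S, ∑ v ∈ Finset.range W \ S, A u v

theorem IsResidual.refl (C : ℕ → ℕ → ℕ) (W s t : ℕ) : IsResidual C C W s t 0 :=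
  ⟨fun _ _ _ _ => rfl, fun _ _ => by simp⟩

/-- Every cut loses exactly the value of the flow. -/
theorem IsResidual.cut_add {C R : ℕ → ℕ → ℕ} {W s t val : ℕ} (h : IsResidual C R W s t val)
    {S : Finset ℕ} (hS : S ⊆ Finset.range W) (hs : s ∈ S) (ht : t ∉ S) :
    cut R W S + val = cut C W S := by
  have hsum : ∀ A : ℕ → ℕ → ℕ, ∑ u ∈ S, ∑ v ∈ Finset.range W, A u v =
      cut A W S + ∑ u ∈ S, ∑ v ∈ S, A u v := by
    intro A
    rw [cut, ← Finset.sum_add_distrib]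
    exact Finset.sum_congr rfl fun u _ => (Finset.sum_sdiff hS).symm
  have hlt : ∀ u ∈ S, u < W := fun u hu => Finset.mem_range.1 (hS hu)
  have hin : ∑ u ∈ S, ∑ v ∈ S, R u v = ∑ u ∈ S, ∑ v ∈ S, C u v := by
    have h2 : ∀ A : ℕ → ℕ → ℕ,
        2 * ∑ u ∈ S, ∑ v ∈ S, A u v = ∑ u ∈ S, ∑ v ∈ S, (A u v + A v u) := by
      intro A
      simp only [Finset.sum_add_distrib]
      rw [Finset.sum_comm (f := fun u v => A v u)]
      ring
    have := (h2 R).trans ((Finset.sum_congr rfl fun u hu => Finset.sum_congr rfl fun v hv =>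
      h.pair u (hlt u hu) v (hlt v hv)).trans (h2 C).symm)
    omega
  have hrow := Finset.sum_congr rfl fun u hu => h.row u (hlt u hu)
  rw [Finset.sum_add_distrib, Finset.sum_add_distrib, hsum, hsum, hin] at hrow
  simp only [Finset.sum_ite_eq', hs, ht, if_true, if_false] at hrow
  omega

/-- Sending `thr` along a path from `s` to `t` increases the value of the flow by `thr`. -/
theorem IsResidual.augment {C R R' : ℕ → ℕ → ℕ} {W s t val thr len : ℕ} {path : ℕ → ℕ}
    (h : IsResidual C R W s t val) {adj : ℕ → ℕ → Prop} (hp : IsPathTo adj W s t path len)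
    (hR : ∀ u < W, ∀ v < W, R' u v + thr * pathCount path (len - 1) u v =
      R u v + thr * pathCount path (len - 1) v u) : IsResidual C R' W s t (val + thr) := by
  constructor
  · intro u hu v hv
    have := hR u hu v hv
    have := hR v hv u hu
    have := h.pair u hu v hv
    omega
  · intro u hu
    have h1 := Finset.sum_congr rfl fun v hv => hR u hu v (Finset.mem_range.1 hv)
    simp only [Finset.sum_add_distrib, ← Finset.mul_sum] at h1
    have hpos := hp.pos
    have h2 := congrArg (thr * ·) (sum_pathCount_add (path := path) (W := W) (j := len - 1)
      (fun i hi => hp.lt i (by omega)) u)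
    simp only [mul_add, hp.first, hp.last, mul_ite, mul_one, mul_zero] at h2
    have h3 := h.row u hu
    split_ifs at h2 h3 ⊢ <;> omega

/-- Capacity scaling: search for a path along which at least `rThr` can be sent, and send as
much; if there is none, halve `rThr`. -/
def maxFlow : Program :=
  .assign rThr (.reg rTotal) ;;
  .assign rVal 0 ;;
  .assign rCount (.reg rW) ;;
  .assign rSrc (.reg rServer) ;;
  .assign rDst (.reg rN) ;;
  .loop (.reg rThr) (
    findPath ;;
    .ite (.reg rLen)
      (augment ;; .assign rVal (.reg rVal + .reg rThr))
      (.assign rThr (.reg rThr / 2)))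

/-- Capacity scaling ends with a flow for which some cut has no residual capacity. -/
theorem wp_maxFlow {T n s total : ℕ} {σ : State} (hn : σ.reg rN = n) (hW : σ.reg rW = n + 1)
    (hserver : σ.reg rServer = s) (htotal : σ.reg rTotal = total) (hs : s < n)
    (hT : 1 + (2 * (n + 1) ^ 2 + 1) * total.size ≤ T) (hnT : n + 1 ≤ T)
    (hcap : ∑ u ∈ Finset.range n, mat (σ.arr aMat) (n + 1) u n = total) :
    wp T maxFlow (fun τ => IsResidual (mat (σ.arr aMat) (n + 1)) (mat (τ.arr aMat) (n + 1))
        (n + 1) s n (τ.reg rVal) ∧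
      ∃ S ⊆ Finset.range (n + 1), s ∈ S ∧ n ∉ S ∧
        cut (mat (τ.arr aMat) (n + 1)) (n + 1) S = 0) σ := by
  unfold maxFlow
  simp +decide only [wp_seq, wp_assign, Expr.mulOk_reg, Expr.mulOk_zero, Expr.val_reg,
    Expr.val_zero, State.reg_set, if_false, true_and, hn, hW, hserver, htotal]
  have hTW : (n + 1).size ≤ T := (Nat.size_le_self _).trans hnT
  set C := mat (σ.arr aMat) (n + 1) with hC
  -- With `b` the number of halvings that are left, at most `a` augmentations can take place before
  -- the next one, since some cut has a residual capacity of at most `a * rThr`.  When a search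
  -- fails, the set of the nodes it reached is such a cut for the halved threshold.
  refine wp_loop (fun k τ => ∃ a b, k = a + (2 * (n + 1) ^ 2 + 1) * b ∧ τ.reg rThr < 2 ^ b ∧
    IsResidual C (mat (τ.arr aMat) (n + 1)) (n + 1) s n (τ.reg rVal) ∧
    ∃ S ⊆ Finset.range (n + 1), s ∈ S ∧ n ∉ S ∧
        cut (mat (τ.arr aMat) (n + 1)) (n + 1) S ≤ a * τ.reg rThr) _ hT
    ⟨1, total.size, rfl, ?_, ?_, Finset.range n, ?_⟩ ?_
  · simpa using Nat.lt_size_self total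
  · simpa using IsResidual.refl C (n + 1) s n
  · refine ⟨Finset.range_mono (by omega), by simpa using hs, by simp, ?_⟩
    simp +decide only [State.reg_set, if_true, if_false, State.arr_set, one_mul]
    rw [← hcap, cut]
    refine (Finset.sum_congr rfl fun u hu => ?_).le
    rw [Finset.range_add_one, Finset.insert_sdiff_of_notMem _ (by simp), Finset.sdiff_self]
    simp [hC]
  rintro k τ hk ⟨a, b, rfl, hb, hres, S, hS, hsS, htS, hcut⟩ hf
  refine ⟨by simp, fun hv => ?_, fun hv => ⟨hres, S, hS, hsS, htS, ?_⟩⟩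
  swap
  · simp only [Expr.val_reg] at hv
    simpa [hv] using hcut
  simp only [Expr.val_reg] at hv
  rw [wp_seq]
  have hW' : τ.reg rW = n + 1 := by rw [hf.reg rW (by decide)]; simp [hW]
  refine wp_call (wp_findPath (w := n + 1) (W := n + 1) (src := s) (dst := n) ?_ hW' ?_ ?_ rfl
    (by omega) (by omega) hnT hTW) ?_
  · rw [hf.reg rCount (by decide)]; simp
  · rw [hf.reg rSrc (by decide)]; simp
  · rw [hf.reg rDst (by decide)]; simp
  rintro τ₁ hf₁ ⟨hpath, hsep⟩
  have hthr : τ₁.reg rThr = τ.reg rThr := hf₁.reg _ (by decide)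
  have hval : τ₁.reg rVal = τ.reg rVal := hf₁.reg _ (by decide)
  have hmat : τ₁.arr aMat = τ.arr aMat := hf₁.arr _ (by decide)
  set thr := τ.reg rThr with hthr'
  refine ⟨by simp, fun hl => ?_, fun hl => ?_⟩
  · have hp := hpath hl
    rw [wp_seq]
    refine wp_call (wp_augment (src := s) (dst := n) ((hf₁.reg rW (by decide)).trans hW') hthr rfl
      (by rw [hmat]; exact hp) (hp.len_le.trans hnT) hTW) ?_
    intro τ₂ hf₂ hR
    have hthr₂ : τ₂.reg rThr = thr := (hf₂.reg _ (by decide)).trans hthr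
    have hval₂ : τ₂.reg rVal = τ.reg rVal := (hf₂.reg _ (by decide)).trans hval
    rw [hmat] at hR
    have hres' := hres.augment hp hR
    -- The flow through every cut grows by `thr`, so `a` can be decreased by one.
    have h1 := hres.cut_add hS hsS htS
    have h2 := hres'.cut_add hS hsS htS
    have ha : a ≠ 0 := by
      rintro rfl
      omega
    obtain ⟨a, rfl⟩ := Nat.exists_eq_succ_of_ne_zero ha
    simp +decide only [wp_assign, Expr.mulOk_add, Expr.mulOk_reg, Expr.val_add, Expr.val_reg,
      hthr₂, hval₂, true_and]
    refine ⟨_, ?_, a, b, rfl, ?_, ?_, S, hS, hsS, htS, ?_⟩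
    · omega
    · simpa [hthr₂] using hb
    · simpa using hres'
    · have : cut (mat (τ₂.arr aMat) (n + 1)) (n + 1) S ≤ a * thr := by
        rw [Nat.succ_mul] at hcut
        omega
      simpa [hthr₂] using this
  · obtain ⟨S', hS', hsS', htS', hadj⟩ := hsep hl
    simp +decide only [wp_assign, Expr.mulOk_div, Expr.mulOk_reg, Expr.mulOk_two, Expr.val_div,
      Expr.val_reg, Expr.val_two, true_and, hthr]
    have hb0 : b ≠ 0 := by
      rintro rfl
      simp only [pow_zero] at hb
      omega
    obtain ⟨b, rfl⟩ := Nat.exists_eq_succ_of_ne_zero hb0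
    refine ⟨_, ?_, 2 * (n + 1) ^ 2, b, rfl, ?_, ?_, S', hS', hsS', htS', ?_⟩
    · rw [Nat.mul_succ]
      omega
    · rw [Nat.pow_succ] at hb
      have : thr / 2 < 2 ^ b := by omega
      simpa using this
    · simpa [hmat, hval] using hres
    · have : cut (mat (τ.arr aMat) (n + 1)) (n + 1) S' ≤ 2 * (n + 1) ^ 2 * (thr / 2) := by
        have hc : ∀ u ∈ S', ∑ v ∈ Finset.range (n + 1) \ S', mat (τ.arr aMat) (n + 1) u v ≤
            (n + 1) * (2 * (thr / 2)) := by
          intro u hu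
          calc _ ≤ ∑ v ∈ Finset.range (n + 1) \ S', 2 * (thr / 2) := by
                refine Finset.sum_le_sum fun v hv => ?_
                rw [Finset.mem_sdiff, Finset.mem_range] at hv
                have := hadj u hu v hv.1 hv.2
                simp only [mat]
                omega
            _ ≤ _ := by
                rw [Finset.sum_const, smul_eq_mul]
                gcongr
                exact (Finset.card_le_card Finset.sdiff_subset).trans (by simp)
        calc _ ≤ ∑ u ∈ S', (n + 1) * (2 * (thr / 2)) := Finset.sum_le_sum hc
          _ ≤ (n + 1) * ((n + 1) * (2 * (thr / 2))) := by
              rw [Finset.sum_const, smul_eq_mul]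
              gcongr
              exact (Finset.card_le_card hS').trans (by simp)
          _ = _ := by ring
      simpa [hmat] using this

end FLRouting

namespace FLRouting

/-! ### From routings to flows -/

section Lists

variable {N : Instance}

/-- How often the list passes from `u` to `v`. -/
abbrev arcCount (l : List N.Node) (u v : N.Node) : ℕ :=
  (l.zip l.tail).count (u, v)

theorem arcCount_cons_cons (a b : N.Node) (l : List N.Node) (u v : N.Node) :
    arcCount (a :: b :: l) u v = arcCount (b :: l) u v + if a = u ∧ b = v then 1 else 0 := by
  simp [arcCount, List.count_cons, Prod.ext_iff]

theorem sum_arcCount_cons (l : List N.Node) (a b u : N.Node) (hb : (a :: l).getLast? = some b) :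
    (∑ v, arcCount (a :: l) u v) + (if u = b then 1 else 0) =
      (∑ v, arcCount (a :: l) v u) + if u = a then 1 else 0 := by
  induction l generalizing a with
  | nil =>
    obtain rfl : a = b := by simpa using hb
    simp [arcCount]
  | cons c l ih =>
    have := ih c (by simpa using hb)
    simp only [arcCount_cons_cons, Finset.sum_add_distrib]
    have h1 : (∑ v, if a = u ∧ c = v then 1 else 0) = if u = a then 1 else 0 := by
      simp only [eq_comm (a := u)]
      by_cases h : a = u <;> simp [h]
    have h2 : (∑ v, if a = v ∧ c = u then 1 else 0) = if u = c then 1 else 0 := by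
      simp only [eq_comm (a := u)]
      by_cases h : c = u <;> simp [h]
    rw [h1, h2]
    omega

/-- A path leaves every node as often as it enters it, except for its two ends. -/
theorem sum_arcCount {l : List N.Node} {a b : N.Node} (ha : l.head? = some a)
    (hb : l.getLast? = some b) (u : N.Node) :
    (∑ v, arcCount l u v) + (if u = b then 1 else 0) =
      (∑ v, arcCount l v u) + if u = a then 1 else 0 := by
  cases l with
  | nil => simp at ha
  | cons c l =>
    obtain rfl : c = a := by simpa using ha
    exact sum_arcCount_cons l c b u hb

theorem arcCount_le_one {l : List N.Node} (h : l.Nodup) (u v : N.Node) : arcCount l u v ≤ 1 := by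
  refine List.nodup_iff_count_le_one.1 ?_ _
  refine List.Nodup.of_map Prod.fst (h.sublist ?_)
  have : List.map Prod.fst (l.zip l.tail) = l.dropLast := by
    induction l with
    | nil => rfl
    | cons a l ih =>
      cases l with
      | nil => rfl
      | cons b l => simpa using ih (List.nodup_cons.1 h).2
  rw [this]
  exact List.dropLast_sublist l

theorem isChain_iff_zip {R : N.Node → N.Node → Prop} {l : List N.Node} :
    l.IsChain R ↔ ∀ p ∈ l.zip l.tail, R p.1 p.2 := by
  induction l with
  | nil => simp
  | cons a l ih =>
    cases l with
    | nil => simp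
    | cons b l =>
      rw [List.isChain_cons_cons, ih]
      simp

theorem rel_of_arcCount_ne_zero {R : N.Node → N.Node → Prop} {l : List N.Node} (h : l.IsChain R)
    {u v : N.Node} (huv : arcCount l u v ≠ 0) : R u v :=
  isChain_iff_zip.1 h (u, v) (List.count_pos_iff.1 (Nat.pos_of_ne_zero huv))

end Lists

variable {N : Instance}

theorem Instance.le_of_arcCap_pos {u v : N.Node} (h : 0 < N.arcCap u v) : u.1 ≤ v.1 := by
  unfold Instance.arcCap at h
  split_ifs at h with h1 h2
  · exact h1.1.le
  · exact Fin.le_def.2 (by omega)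
  · exact absurd h (lt_irrefl _)

/-- The snapshots do not decrease along a path. -/
theorem snapshot_le_last {l : List N.Node} (h : l.IsChain fun u v => 0 < N.arcCap u v)
    {b : N.Node} (hb : l.getLast? = some b) : ∀ u ∈ l, u.1 ≤ b.1 := by
  have h1 : l.IsChain fun u v => u.1 ≤ v.1 := h.imp fun _ _ => Instance.le_of_arcCap_pos
  have : Trans (fun u v : N.Node => u.1 ≤ v.1) (fun u v : N.Node => u.1 ≤ v.1)
      (fun u v : N.Node => u.1 ≤ v.1) := ⟨le_trans⟩
  have h2 := List.isChain_iff_pairwise.1 h1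
  intro u hu
  rw [← List.dropLast_append_getLast? b hb] at h2 hu
  rw [List.pairwise_append] at h2
  rcases List.mem_append.1 hu with hu | hu
  · exact h2.2.2 u hu b (by simp)
  · rw [List.mem_singleton.1 hu]

/-- The path that stays at satellite `c` from snapshot `j` to snapshot `k`. -/
theorem exists_cachingPath (c : Fin N.I) (k : Fin N.K) (hD : 0 < N.totalDemand) :
    ∀ (d : ℕ) (j : Fin N.K), (j : ℕ) + d = k → ∃ l : List N.Node,
      ((j, c) :: l).getLast? = some (k, c) ∧ ((j, c) :: l).Nodup ∧
      (∀ u ∈ l, u.2 = c ∧ j < u.1) ∧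
      ((j, c) :: l).IsChain fun u v => 0 < N.arcCap u v ∧ u.1 ≠ v.1 := by
  intro d
  induction d with
  | zero =>
    intro j hj
    obtain rfl : j = k := Fin.ext (by simpa using hj)
    exact ⟨[], by simp, by simp, by simp, by simp⟩
  | succ d ih =>
    intro j hj
    have hlt : (j : ℕ) + 1 < N.K := by omega
    obtain ⟨l, h1, h2, h3, h4⟩ := ih ⟨j + 1, hlt⟩ (by simp only; omega)
    have h5 : ∀ u ∈ (⟨j + 1, hlt⟩, c) :: l, u.2 = c ∧ j < u.1 := by
      intro u hu
      rcases List.mem_cons.1 hu with rfl | hu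
      · exact ⟨rfl, Fin.lt_def.2 (by simp)⟩
      · exact ⟨(h3 u hu).1, (Fin.lt_def.2 (by simp : (j : ℕ) < j + 1)).trans (h3 u hu).2⟩
    refine ⟨(⟨j + 1, hlt⟩, c) :: l, by simpa using h1, List.nodup_cons.2 ⟨fun h => ?_, h2⟩, h5,
      List.isChain_cons_cons.2 ⟨⟨?_, ?_⟩, h4⟩⟩
    · exact lt_irrefl _ (h5 _ h).2
    · rw [Instance.arcCap, if_neg (by simp), if_pos (by simp)]
      exact hD
    · exact fun h => absurd (congrArg Fin.val h) (by simp)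

/-- A path that reaches its client by snapshot `k` can be cut off at the first copy of the client
and extended by caching to the copy in snapshot `k`. -/
theorem exists_reroute (c : Fin N.I) (k : Fin N.K) (hD : 0 < N.totalDemand) {l : List N.Node}
    (hl : l.Nodup) (hc : l.IsChain fun u v => 0 < N.arcCap u v) {u₀ : N.Node}
    (hf : l.find? (fun u => u.2 = c) = some u₀) (hk : u₀.1 ≤ k) : ∃ l' : List N.Node,
      l'.head? = l.head? ∧ l'.getLast? = some (k, c) ∧ l'.Nodup ∧
      l'.IsChain (fun u v => 0 < N.arcCap u v ∧ ((u, v) ∈ l.zip l.tail ∨ u.1 ≠ v.1)) := by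
  obtain ⟨h0, A, B, rfl, hA⟩ := List.find?_eq_some_iff_append.1 hf
  obtain ⟨j, c'⟩ := u₀
  obtain rfl : c' = c := by simpa using h0
  obtain ⟨E, h1, h2, h3, h4⟩ := exists_cachingPath c' k hD (k - j) j
    (by have := Fin.le_def.1 hk; simp only at this; omega)
  refine ⟨A ++ (j, c') :: E, ?_, ?_, ?_, ?_⟩
  · cases A <;> simp
  · rw [List.getLast?_append, h1]
    rfl
  · refine List.nodup_append.2 ⟨(List.nodup_append.1 hl).1, h2, fun a ha b hb hab => ?_⟩
    subst hab
    have hc' : a.2 = c' := by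
      rcases List.mem_cons.1 hb with rfl | hb
      · rfl
      · exact (h3 a hb).1
    simpa [hc'] using hA a ha
  · refine List.isChain_split.2 ⟨?_, h4.imp fun u v h => ⟨h.1, .inr h.2⟩⟩
    have hz := isChain_iff_zip (l := A ++ (j, c') :: B)
      (R := fun u v => 0 < N.arcCap u v ∧ ((u, v) ∈ (A ++ (j, c') :: B).zip
        (A ++ (j, c') :: B).tail ∨ u.1 ≠ v.1))
    exact (List.isChain_split.1 (hz.2 fun p hp => ⟨isChain_iff_zip.1 hc p hp, .inl hp⟩)).1

theorem le_foldr_max {l : List ℕ} {a : ℕ} (h : a ∈ l) : a ≤ l.foldr max 0 := by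
  induction l with
  | nil => simp at h
  | cons b l ih =>
    rcases List.mem_cons.1 h with rfl | h
    · exact le_max_left _ _
    · exact (ih h).trans (le_max_right _ _)

theorem foldr_max_le {l : List ℕ} {b : ℕ} (h : ∀ a ∈ l, a ≤ b) : l.foldr max 0 ≤ b := by
  induction l with
  | nil => simp
  | cons a l ih =>
    exact max_le (h a (by simp)) (ih fun x hx => h x (by simp [hx]))

theorem Routing.arrival_le_makespan {R : Type} {r : Routing N R}
    {e : PathFlow N R} (he : e ∈ r) (hc : e.client ∈ N.clients e.model) :
    e.arrival ≤ r.makespan := by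
  have h1 : e.arrival ≤ r.completion e.client :=
    le_foldr_max (List.mem_map_of_mem (List.mem_filter.2 ⟨he, by simp⟩))
  exact h1.trans (Finset.le_sup (f := r.completion)
    (Finset.mem_biUnion.2 ⟨e.model, Finset.mem_univ _, hc⟩))

theorem PathFlow.IsPath.exists_find {R : Type} {e : PathFlow N R} (h : e.IsPath) :
    ∃ u₀, e.path.find? (fun u => u.2 = e.client) = some u₀ ∧ e.arrival = (u₀.1 : ℕ) + 1 := by
  obtain ⟨k, hk⟩ := h.last
  have hs : (e.path.find? fun u => u.2 = e.client).isSome := by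
    rw [List.find?_isSome]
    exact ⟨_, List.mem_of_getLast? hk, by simp⟩
  obtain ⟨u₀, hu⟩ := Option.isSome_iff_exists.1 hs
  exact ⟨u₀, hu, by rw [PathFlow.arrival, hu]; rfl⟩

section Sums

variable {R : Type} [Semifield R]

theorem Routing.sum_clientAmount (r : Routing N R) (c : Fin N.I) :
    (r.map fun e => if e.client = c then e.amount else 0).sum = ∑ m, r.delivered m c := by
  induction r with
  | nil => simp [Routing.delivered]
  | cons e r ih =>
    have h : ∀ m, Routing.delivered (e :: r) m c =
        (if e.model = m then if e.client = c then e.amount else 0 else 0)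
          + Routing.delivered r m c := by
      intro m
      by_cases h1 : e.model = m <;> by_cases h2 : e.client = c <;>
        simp [Routing.delivered, h1, h2]
    simp [h, Finset.sum_add_distrib, ih]

theorem Routing.sum_amount (r : Routing N R) :
    (r.map PathFlow.amount).sum =
      ∑ c, (r.map fun e => if e.client = c then e.amount else 0).sum := by
  induction r with
  | nil => simp
  | cons e r ih => simp [Finset.sum_add_distrib, ih]

variable [LinearOrder R] {r : Routing N R}

theorem Routing.Feasible.delivered_eq (hr : r.Feasible) (m : Fin N.M) (c : Fin N.I) :
    r.delivered m c = if c ∈ N.clients m then (N.size m : R) else 0 := by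
  split_ifs with hc
  · exact hr.delivered m c hc
  · rw [Routing.delivered, List.filter_eq_nil_iff.2, List.map_nil, List.sum_nil]
    intro e he
    have := hr.client_mem e he
    simp only [decide_eq_true_eq, not_and]
    rintro rfl rfl
    exact hc this

end Sums

theorem Routing.Feasible.sum_clientAmount_eq {r : Routing N ℝ} (hr : r.Feasible) (c : Fin N.I) :
    (r.map fun e => if e.client = c then e.amount else 0).sum = (N.clientDemand c : ℝ) := by
  rw [r.sum_clientAmount, Instance.clientDemand, NNRat.cast_sum]
  refine Finset.sum_congr rfl fun m _ => ?_
  rw [hr.delivered_eq]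
  split_ifs <;> simp

theorem Instance.sum_clientDemand (N : Instance) : ∑ c, N.clientDemand c = N.totalDemand := by
  simp only [Instance.clientDemand, Instance.totalDemand]
  rw [Finset.sum_comm]
  refine Finset.sum_congr rfl fun m _ => ?_
  rw [← Finset.sum_filter, Finset.sum_const, Finset.filter_mem_eq_inter, Finset.univ_inter]
  rw [nsmul_eq_mul, mul_comm]

theorem Routing.Feasible.sum_amount_eq {r : Routing N ℝ} (hr : r.Feasible) :
    (r.map PathFlow.amount).sum = (N.totalDemand : ℝ) := by
  rw [r.sum_amount, ← N.sum_clientDemand, NNRat.cast_sum]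
  exact Finset.sum_congr rfl fun c _ => hr.sum_clientAmount_eq c

theorem list_sum_finset_sum {α ι : Type} (s : Finset ι) (l : List α) (f : α → ι → ℝ) :
    ∑ i ∈ s, (l.map fun a => f a i).sum = (l.map fun a => ∑ i ∈ s, f a i).sum := by
  induction l with
  | nil => simp
  | cons a l ih => simp [Finset.sum_add_distrib, ih]

theorem list_sum_le {α : Type} {l : List α} {f g : α → ℝ} (h : ∀ a ∈ l, f a ≤ g a) :
    (l.map f).sum ≤ (l.map g).sum :=
  List.sum_le_sum h

theorem list_sum_sub {α : Type} (l : List α) (f g : α → ℝ) :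
    (l.map f).sum - (l.map g).sum = (l.map fun a => f a - g a).sum := by
  induction l with
  | nil => simp
  | cons a l ih => simp only [List.map_cons, List.sum_cons, ← ih]; ring

/-- A feasible routing with makespan at most `k` yields a feasible single-commodity flow: all data
stay at the first copy of their client that they reach, until snapshot `k`. -/
theorem exists_flow_of_routing {r : Routing N ℝ} (hr : r.Feasible) {k : Fin N.K}
    (hk : r.makespan ≤ (k : ℕ) + 1) :
    ∃ x : N.Node → N.Node → ℝ, IsFeasibleFlow N k x := by
  have hnew : ∀ e : PathFlow N ℝ, ∃ l' : List N.Node, e ∈ r →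
      l'.head? = some N.source ∧ l'.getLast? = some (k, e.client) ∧ l'.Nodup ∧
      l'.IsChain (fun u v => 0 < N.arcCap u v ∧
        ((u, v) ∈ e.path.zip e.path.tail ∨ u.1 ≠ v.1)) := by
    intro e
    by_cases he : e ∈ r
    · have hp := hr.isPath e he
      have hc := hr.client_mem e he
      have hD : 0 < N.totalDemand := by
        refine (Finset.sum_pos' (fun _ _ => zero_le) ⟨e.model, Finset.mem_univ _, ?_⟩)
        exact mul_pos (N.size_pos _) (Nat.cast_pos.2 (Finset.card_pos.2 ⟨_, hc⟩))
      obtain ⟨u₀, hu, ha⟩ := hp.exists_find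
      have h1 := (Routing.arrival_le_makespan he hc).trans hk
      obtain ⟨l', h⟩ := exists_reroute e.client k hD hp.nodup hp.chain hu (Fin.le_def.2 (by omega))
      rw [hp.head] at h
      exact ⟨l', fun _ => h⟩
    · exact ⟨[], fun h => absurd h he⟩
  choose new hnew using hnew
  have hpos : ∀ e ∈ r, (0 : ℝ) ≤ e.amount := fun e he => (hr.amount_pos e he).le
  have hrel : ∀ e ∈ r, ∀ u v, arcCount (new e) u v ≠ 0 → 0 < N.arcCap u v ∧
      ((u, v) ∈ e.path.zip e.path.tail ∨ u.1 ≠ v.1) := fun e he u v h =>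
    rel_of_arcCount_ne_zero (hnew e he).2.2.2 h
  have hzero : ∀ u v, (∀ e ∈ r, arcCount (new e) u v = 0) →
      (r.map fun e => (arcCount (new e) u v : ℝ) * e.amount).sum = 0 := by
    intro u v h
    refine List.sum_eq_zero fun y hy => ?_
    obtain ⟨e, he, rfl⟩ := List.mem_map.1 hy
    simp [h e he]
  refine ⟨fun u v => (r.map fun e => (arcCount (new e) u v : ℝ) * e.amount).sum, ?_, ?_, ?_, ?_⟩
  · intro u v
    refine List.sum_nonneg fun y hy => ?_
    obtain ⟨e, he, rfl⟩ := List.mem_map.1 hy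
    exact mul_nonneg (Nat.cast_nonneg _) (hpos e he)
  · intro u v
    by_cases h1 : u.1 = v.1
    · refine le_trans (list_sum_le fun e he => ?_) (hr.capacity u v)
      refine mul_le_mul_of_nonneg_right ?_ (hpos e he)
      rw [Nat.cast_le]
      by_cases h0 : arcCount (new e) u v = 0
      · rw [h0]
        exact Nat.zero_le _
      · refine (arcCount_le_one (hnew e he).2.2.1 u v).trans ?_
        have := (hrel e he u v h0).2.resolve_right (by simpa using h1)
        exact List.count_pos_iff.2 this
    · by_cases h2 : (u.1 : ℕ) + 1 = v.1 ∧ u.2 = v.2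
      · rw [Instance.arcCap, if_neg (by tauto), if_pos h2, ← hr.sum_amount_eq]
        refine list_sum_le fun e he => ?_
        have := arcCount_le_one (hnew e he).2.2.1 u v
        exact mul_le_of_le_one_left (hpos e he) (by exact_mod_cast this)
      · have h3 : N.arcCap u v = 0 := by
          rw [Instance.arcCap, if_neg (by tauto), if_neg h2]
        rw [hzero u v fun e he => ?_, h3, NNRat.cast_zero]
        by_contra h0
        exact (hrel e he u v h0).1.ne' h3
  · intro u v huv
    refine hzero u v fun e he => ?_
    by_contra h0
    have hle := snapshot_le_last ((hnew e he).2.2.2.imp fun _ _ h => h.1) (hnew e he).2.1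
    have hmem : (u, v) ∈ (new e).zip (new e).tail := List.count_pos_iff.1 (Nat.pos_of_ne_zero h0)
    have hu := hle u (List.of_mem_zip hmem).1
    have hv := hle v (List.mem_of_mem_tail (List.of_mem_zip hmem).2)
    rcases huv with h | h
    · exact absurd hu (not_le.2 h)
    · exact absurd hv (not_le.2 h)
  · intro u
    rw [list_sum_finset_sum, list_sum_finset_sum, list_sum_sub]
    have h1 : ∀ e ∈ r, (∑ v, (arcCount (new e) u v : ℝ) * e.amount) -
        ∑ v, (arcCount (new e) v u : ℝ) * e.amount =
        (if u = N.source then 1 else 0) * e.amount -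
          (if u.1 = k then 1 else 0) * if e.client = u.2 then e.amount else 0 := by
      intro e he
      have h := sum_arcCount (hnew e he).1 (hnew e he).2.1 u
      rw [← Finset.sum_mul, ← Finset.sum_mul, ← sub_mul]
      have h' : (∑ v, (arcCount (new e) u v : ℝ)) + (if u = (k, e.client) then 1 else 0) =
          (∑ v, (arcCount (new e) v u : ℝ)) + if u = N.source then 1 else 0 := by
        exact_mod_cast h
      have h2 : (if u = (k, e.client) then (1 : ℝ) else 0) =
          (if u.1 = k then 1 else 0) * if e.client = u.2 then 1 else 0 := by
        simp only [Prod.ext_iff, ite_and, eq_comm (a := e.client)]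
        split_ifs <;> simp
      rw [sub_eq_iff_eq_add.2 (by rw [add_comm, ← add_sub_assoc, eq_sub_iff_add_eq, h'] :
        (∑ v, (arcCount (new e) u v : ℝ)) = ((if u = N.source then 1 else 0) -
          if u = (k, e.client) then 1 else 0) + ∑ v, (arcCount (new e) v u : ℝ)), h2]
      split_ifs <;> simp
    rw [List.map_congr_left h1, ← list_sum_sub, List.sum_map_mul_left, List.sum_map_mul_left,
      hr.sum_amount_eq, hr.sum_clientAmount_eq]
    split_ifs <;> simp

end FLRouting

namespace FLRouting

/-! ### The network as a matrix -/

variable {N : Instance}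

/-- The number of a node. -/
def Instance.num (N : Instance) (u : N.Node) : ℕ := u.1 * N.I + u.2

/-- The node with a given number. -/
def Instance.node (N : Instance) (i : ℕ) : N.Node :=
  if h : i < N.K * N.I then finProdFinEquiv.symm ⟨i, h⟩ else N.source

theorem Instance.num_eq (u : N.Node) : N.num u = (finProdFinEquiv u : ℕ) := by
  rw [finProdFinEquiv_apply_val, Instance.num, add_comm, mul_comm]

theorem Instance.num_lt (u : N.Node) : N.num u < N.K * N.I := by
  rw [Instance.num_eq]
  exact Fin.is_lt _

theorem Instance.num_injective : Function.Injective N.num := fun u v h => by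
  rw [Instance.num_eq, Instance.num_eq] at h
  exact finProdFinEquiv.injective (Fin.ext h)

theorem Instance.num_node {i : ℕ} (h : i < N.K * N.I) : N.num (N.node i) = i := by
  rw [Instance.num_eq, Instance.node, dif_pos h, Equiv.apply_symm_apply]

theorem Instance.node_num (u : N.Node) : N.node (N.num u) = u :=
  Instance.num_injective (Instance.num_node (N.num_lt u))

theorem Instance.num_source : N.num N.source = N.server := by
  simp [Instance.num, Instance.source]

theorem Instance.num_div (u : N.Node) : N.num u / N.I = u.1 := by
  rw [Instance.num, mul_comm, Nat.mul_add_div (u.2.pos), Nat.div_eq_of_lt u.2.is_lt, add_zero]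

theorem Instance.sum_range_eq {R : Type} [AddCommMonoid R] (f : ℕ → R) :
    ∑ i ∈ Finset.range (N.K * N.I), f i = ∑ u : N.Node, f (N.num u) := by
  rw [Finset.sum_range, ← finProdFinEquiv.sum_comp]
  simp only [Instance.num_eq]

/-- `C` is the matrix of the capacities, multiplied by `D`, of the network for the trial snapshot
`k`: a sink with the number `K * I` is added, and there is an arc from the copy of each satellite in
snapshot `k` to the sink, whose capacity is the demand of the satellite. -/
structure IsNetwork (N : Instance) (D : ℕ) (k : Fin N.K) (C : ℕ → ℕ → ℕ) : Prop where
  arc : ∀ u v : N.Node, (C (N.num u) (N.num v) : ℚ≥0) = D * N.arcCap u v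
  sink : ∀ u : N.Node, (C (N.num u) (N.K * N.I) : ℚ≥0) =
    if u.1 = k then D * N.clientDemand u.2 else 0

variable {D : ℕ} {k : Fin N.K} {C R : ℕ → ℕ → ℕ}

theorem IsNetwork.sum_sink (hC : IsNetwork N D k C) :
    ((∑ u ∈ Finset.range (N.K * N.I), C u (N.K * N.I) : ℕ) : ℚ≥0) = D * N.totalDemand := by
  rw [N.sum_range_eq, Nat.cast_sum]
  simp only [hC.sink]
  rw [Fintype.sum_prod_type, Finset.sum_eq_single k (by intro j _ hj; simp [hj]) (by simp)]
  simp only [if_true, ← Finset.mul_sum, N.sum_clientDemand]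

/-- The net outflow of a set of nodes is the flow across its boundary. -/
theorem sum_sub_sum_eq (S : Finset N.Node) (x : N.Node → N.Node → ℝ) :
    ∑ u ∈ S, (∑ v, x u v - ∑ v, x v u) = ∑ u ∈ S, ∑ v ∈ Sᶜ, x u v - ∑ u ∈ S, ∑ v ∈ Sᶜ, x v u := by
  simp only [← Finset.sum_add_sum_compl S, Finset.sum_sub_distrib, Finset.sum_add_distrib]
  rw [Finset.sum_comm (s := S) (t := S)]
  ring

/-- The value of a feasible flow is at most the capacity of every cut. -/
theorem IsFeasibleFlow.total_le_cut {x : N.Node → N.Node → ℝ} (hx : IsFeasibleFlow N k x)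
    (hC : IsNetwork N D k C) {S : Finset ℕ} (hS : S ⊆ Finset.range (N.K * N.I + 1))
    (hs : N.num N.source ∈ S) (ht : N.K * N.I ∉ S) :
    (D * N.totalDemand : ℚ≥0) ≤ cut C (N.K * N.I + 1) S := by
  set S' : Finset N.Node := Finset.univ.filter fun u => N.num u ∈ S with hS'
  have hmem : ∀ u, u ∈ S' ↔ N.num u ∈ S := fun u => by simp [hS']
  have hSn : ∀ f : ℕ → ℕ, ∑ u ∈ S, f u = ∑ u ∈ S', f (N.num u) := by
    intro f
    have h1 : S = (Finset.range (N.K * N.I)).filter (· ∈ S) := by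
      ext i
      simp only [Finset.mem_filter, Finset.mem_range]
      refine ⟨fun h => ⟨?_, h⟩, fun h => h.2⟩
      have := Finset.mem_range.1 (hS h)
      have : i ≠ N.K * N.I := fun h' => ht (h' ▸ h)
      omega
    conv_lhs => rw [h1]
    rw [Finset.sum_filter, N.sum_range_eq, ← Finset.sum_filter]
  have hScn : ∀ f : ℕ → ℕ, ∑ u ∈ Finset.range (N.K * N.I + 1) \ S, f u =
      ∑ u ∈ S'ᶜ, f (N.num u) + f (N.K * N.I) := by
    intro f
    have h1 := Finset.sum_sdiff hS (f := f)
    have h2 := Finset.sum_compl_add_sum S' (fun u => f (N.num u))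
    rw [Finset.sum_range_succ, N.sum_range_eq, hSn] at h1
    omega
  have hcut : cut C (N.K * N.I + 1) S =
      ∑ u ∈ S', (∑ v ∈ S'ᶜ, C (N.num u) (N.num v) + C (N.num u) (N.K * N.I)) := by
    rw [cut, hSn]
    exact Finset.sum_congr rfl fun u _ => hScn _
  have hcut' : (cut C (N.K * N.I + 1) S : ℝ) = D * ∑ u ∈ S', (∑ v ∈ S'ᶜ, (N.arcCap u v : ℝ) +
      if u.1 = k then (N.clientDemand u.2 : ℝ) else 0) := by
    have : (cut C (N.K * N.I + 1) S : ℚ≥0) = D * ∑ u ∈ S', (∑ v ∈ S'ᶜ, N.arcCap u v +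
        if u.1 = k then N.clientDemand u.2 else 0) := by
      rw [hcut]
      push_cast
      simp only [hC.arc, hC.sink, Finset.mul_sum, mul_add, mul_ite, mul_zero]
    have h2 := congrArg (fun q : ℚ≥0 => (q : ℝ)) this
    push_cast at h2
    simpa only [apply_ite (NNRat.cast (K := ℝ)), NNRat.cast_zero] using h2
  have hflow : (N.totalDemand : ℝ) ≤ ∑ u ∈ S', (∑ v ∈ S'ᶜ, (N.arcCap u v : ℝ) +
      if u.1 = k then (N.clientDemand u.2 : ℝ) else 0) := by
    have h1 := sum_sub_sum_eq S' x
    simp only [hx.conservation, Finset.sum_sub_distrib] at h1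
    rw [Finset.sum_ite_eq', if_pos ((hmem _).2 hs)] at h1
    have h2 : ∑ u ∈ S', ∑ v ∈ S'ᶜ, x u v ≤ ∑ u ∈ S', ∑ v ∈ S'ᶜ, (N.arcCap u v : ℝ) :=
      Finset.sum_le_sum fun u _ => Finset.sum_le_sum fun v _ => hx.capacity u v
    have h3 : 0 ≤ ∑ u ∈ S', ∑ v ∈ S'ᶜ, x v u :=
      Finset.sum_nonneg fun u _ => Finset.sum_nonneg fun v _ => hx.nonneg v u
    rw [Finset.sum_add_distrib]
    linarith
  have h3 : (D : ℝ) * N.totalDemand ≤ cut C (N.K * N.I + 1) S := by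
    rw [hcut']
    exact mul_le_mul_of_nonneg_left hflow (Nat.cast_nonneg _)
  have h4 : ((D * N.totalDemand : ℚ≥0) : ℝ) ≤ ((cut C (N.K * N.I + 1) S : ℚ≥0) : ℝ) := by
    push_cast
    exact h3
  exact_mod_cast h4

theorem IsNetwork.val_le (hC : IsNetwork N D k C) {val : ℕ}
    (hR : IsResidual C R (N.K * N.I + 1) N.server (N.K * N.I) val) {total : ℕ}
    (ht : (total : ℚ≥0) = D * N.totalDemand) : val ≤ total := by
  have h1 := hR.cut_add (S := Finset.range (N.K * N.I)) (Finset.range_mono (by omega))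
    (by rw [← N.num_source]; exact Finset.mem_range.2 (N.num_lt _)) (by simp)
  have h2 : cut C (N.K * N.I + 1) (Finset.range (N.K * N.I)) = total := by
    rw [← Nat.cast_inj (R := ℚ≥0), ht, ← hC.sum_sink, cut]
    congr 1
    refine Finset.sum_congr rfl fun u hu => ?_
    rw [Finset.range_add_one, Finset.insert_sdiff_of_notMem _ (by simp), Finset.sdiff_self]
    simp
  omega

/-- If a feasible flow exists, then an integral flow that saturates some cut meets all demands. -/
theorem IsNetwork.le_val (hC : IsNetwork N D k C) {val : ℕ}
    (hR : IsResidual C R (N.K * N.I + 1) N.server (N.K * N.I) val) {S : Finset ℕ}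
    (hS : S ⊆ Finset.range (N.K * N.I + 1)) (hs : (N.server : ℕ) ∈ S) (ht : N.K * N.I ∉ S)
    (hcut : cut R (N.K * N.I + 1) S = 0) {total : ℕ} (htot : (total : ℚ≥0) = D * N.totalDemand)
    {x : N.Node → N.Node → ℝ} (hx : IsFeasibleFlow N k x) : total ≤ val := by
  have h1 := hR.cut_add hS hs ht
  have h2 := hx.total_le_cut hC hS (by rwa [N.num_source]) ht
  rw [← htot, Nat.cast_le] at h2
  omega

end FLRouting

namespace FLRouting

/-! ### Decomposing a flow into paths -/

variable {N : Instance} {D : ℕ} {k : Fin N.K} {C R G G' : ℕ → ℕ → ℕ}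
  {rem : Fin N.M → Fin N.I → ℕ} {r : Routing N (ℕ × ℕ)}

theorem count_map_range {α : Type} [DecidableEq α] [BEq α] [LawfulBEq α] (g : ℕ → α) (m : ℕ)
    (a : α) :
    ((List.range m).map g).count a = ∑ i ∈ Finset.range m, if g i = a then 1 else 0 := by
  induction m with
  | zero => simp
  | succ m ih =>
    rw [List.range_succ, List.map_append, List.count_append, ih, Finset.sum_range_succ]
    simp [List.count_singleton]

/-- The nodes on a path that is given by the numbers of the nodes. -/
def nodeList (N : Instance) (path : ℕ → ℕ) (len : ℕ) : List N.Node :=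
  (List.range len).map fun i => N.node (path i)

theorem arcCount_nodeList {path : ℕ → ℕ} {len : ℕ} (h : ∀ i < len, path i < N.K * N.I)
    (u v : N.Node) :
    arcCount (nodeList N path len) u v = pathCount path (len - 1) (N.num v) (N.num u) := by
  have h1 : (nodeList N path len).zip (nodeList N path len).tail =
      (List.range (len - 1)).map fun i => (N.node (path i), N.node (path (i + 1))) := by
    refine List.ext_getElem (by simp [nodeList]) fun i h₁ h₂ => ?_
    simp [nodeList]
  rw [arcCount, h1, count_map_range, pathCount]
  refine Finset.sum_congr rfl fun i hi => ?_
  have hi := Finset.mem_range.1 hi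
  have key : ∀ j < len, ∀ u : N.Node, N.node (path j) = u ↔ path j = N.num u := by
    refine fun j hj u => ⟨fun h' => ?_, fun h' => ?_⟩
    · rw [← h', N.num_node (h j hj)]
    · rw [h', N.node_num]
  simp only [Prod.mk.injEq, key i (by omega), key (i + 1) (by omega), and_comm]

theorem Routing.load_append {S : Type} [Semifield S] (r r' : Routing N S) (u v : N.Node) :
    Routing.load (r ++ r') u v = r.load u v + r'.load u v := by
  simp [Routing.load]

theorem Routing.delivered_append {S : Type} [Semifield S] (r r' : Routing N S) (m : Fin N.M)
    (c : Fin N.I) :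
    Routing.delivered (r ++ r') m c = r.delivered m c + r'.delivered m c := by
  simp [Routing.delivered]

/-- A stage in the decomposition of a flow: `r` has been split off, `rem m c` is the scaled amount
of model `m` that still has to reach client `c`, and `G` is the transposed matrix of the remaining
flow, so that `G v u` is the amount on the arc from `u` to `v`. -/
structure IsPartial (N : Instance) (D : ℕ) (k : Fin N.K) (G : ℕ → ℕ → ℕ)
    (rem : Fin N.M → Fin N.I → ℕ) (r : Routing N (ℕ × ℕ)) : Prop where
  conserve : ∀ u : N.Node, (∑ v ∈ Finset.range (N.K * N.I), G v (N.num u)) +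
      (if u.1 = k then ∑ m, rem m u.2 else 0) =
    (∑ v ∈ Finset.range (N.K * N.I), G (N.num u) v) +
      if u = N.source then ∑ m, ∑ c, rem m c else 0
  rem_mem : ∀ m c, rem m c ≠ 0 → c ∈ N.clients m
  client_mem : ∀ e ∈ r, e.client ∈ N.clients e.model
  isPath : ∀ e ∈ r, e.IsPath
  last : ∀ e ∈ r, e.path.getLast? = some (k, e.client)
  amount : ∀ e ∈ r, 0 < e.amount.1 ∧ e.amount.2 = D
  delivered : ∀ m, ∀ c ∈ N.clients m,
    D * r.ofFractions.delivered m c + (rem m c : ℚ≥0) = D * N.size m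
  capacity : ∀ u v, D * r.ofFractions.load u v + (G (N.num v) (N.num u) : ℚ≥0) ≤ D * N.arcCap u v

/-- Where `R u v` exceeds `C u v`, the excess is the net flow from `v` to `u`.  These amounts form a
flow that meets all demands if the value is the total demand, and nothing has been split off yet. -/
theorem IsNetwork.isPartial (hC : IsNetwork N D k C) {val : ℕ}
    (hR : IsResidual C R (N.K * N.I + 1) N.server (N.K * N.I) val)
    (hval : (val : ℚ≥0) = D * N.totalDemand)
    (hrem : ∀ m c, (rem m c : ℚ≥0) = if c ∈ N.clients m then D * N.size m else 0) :
    IsPartial N D k (fun u v => R u v - C u v) rem [] := by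
  have hsum : ∑ m, ∑ c, rem m c = val := by
    rw [← Nat.cast_inj (R := ℚ≥0), hval, Instance.totalDemand, Finset.mul_sum]
    push_cast
    refine Finset.sum_congr rfl fun m _ => ?_
    simp only [hrem]
    rw [← Finset.sum_filter, Finset.sum_const, Finset.filter_mem_eq_inter, Finset.univ_inter,
      nsmul_eq_mul]
    ring
  have hsink : ∀ u : N.Node, C (N.num u) (N.K * N.I) = if u.1 = k then ∑ m, rem m u.2 else 0 := by
    intro u
    rw [← Nat.cast_inj (R := ℚ≥0), hC.sink]
    split_ifs with h
    · push_cast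
      simp only [hrem, Instance.clientDemand, Finset.mul_sum, mul_ite, mul_zero]
    · simp
  have hRsink : ∀ u < N.K * N.I, R u (N.K * N.I) = 0 := by
    have h1 := hR.cut_add (S := Finset.range (N.K * N.I)) (Finset.range_mono (by omega))
      (by rw [← N.num_source]; exact Finset.mem_range.2 (N.num_lt _)) (by simp)
    have h2 : ∀ A : ℕ → ℕ → ℕ, cut A (N.K * N.I + 1) (Finset.range (N.K * N.I)) =
        ∑ u ∈ Finset.range (N.K * N.I), A u (N.K * N.I) := by
      intro A
      refine Finset.sum_congr rfl fun u hu => ?_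
      rw [Finset.range_add_one, Finset.insert_sdiff_of_notMem _ (by simp), Finset.sdiff_self]
      simp
    have h3 : ∑ u ∈ Finset.range (N.K * N.I), C u (N.K * N.I) = val := by
      rw [← Nat.cast_inj (R := ℚ≥0), hC.sum_sink, hval]
    rw [h2, h2, h3] at h1
    intro u hu
    exact Finset.sum_eq_zero_iff.1 (by omega : ∑ u ∈ Finset.range (N.K * N.I),
      R u (N.K * N.I) = 0) u (Finset.mem_range.2 hu)
  refine ⟨fun u => ?_, fun m c h => ?_, by simp, by simp, by simp, by simp, fun m c hc => ?_,
    fun u v => ?_⟩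
  · have hu := N.num_lt u
    have h1 := hR.row (N.num u) (by omega)
    have h2 : ∑ v ∈ Finset.range (N.K * N.I), ((R v (N.num u) - C v (N.num u)) + R (N.num u) v) =
        ∑ v ∈ Finset.range (N.K * N.I), ((R (N.num u) v - C (N.num u) v) + C (N.num u) v) := by
      refine Finset.sum_congr rfl fun v hv => ?_
      have := hR.pair (N.num u) (by omega) v (by have := Finset.mem_range.1 hv; omega)
      omega
    have h3 : N.num u = N.server ↔ u = N.source := by
      rw [← N.num_source, N.num_injective.eq_iff]
    rw [Finset.sum_range_succ, Finset.sum_range_succ, hRsink _ hu, hsink, if_neg hu.ne] at h1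
    simp only [Finset.sum_add_distrib, h3] at h1 h2
    rw [hsum]
    omega
  · by_contra hc
    exact h (by simpa [hc] using hrem m c)
  · simp [Routing.ofFractions, Routing.delivered, hrem, hc]
  · rw [← hC.arc]
    have := hR.pair (N.num u) (by have := N.num_lt u; omega) (N.num v)
      (by have := N.num_lt v; omega)
    have h : R (N.num v) (N.num u) - C (N.num v) (N.num u) ≤ C (N.num u) (N.num v) := by omega
    simp only [Routing.ofFractions, Routing.load, List.map_nil, List.sum_nil, mul_zero, zero_add]
    exact_mod_cast h

/-- Data that still have to be routed flow along some path. -/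
theorem IsPartial.not_separated (h : IsPartial N D k G rem r) {m : Fin N.M} {c : Fin N.I}
    (hc : rem m c ≠ 0) :
    ¬ Separated (fun u v => 1 ≤ G u v) (N.K * N.I) (N.num (k, c)) N.server := by
  rintro ⟨S, hS, ht, hs, hsep⟩
  have h1 : ∀ u ∈ S, (∑ v ∈ Finset.range (N.K * N.I), G v u) +
      (if u = N.num (k, c) then rem m c else 0) ≤ ∑ v ∈ Finset.range (N.K * N.I), G u v := by
    intro u hu
    have hun := Finset.mem_range.1 (hS hu)
    have h2 := h.conserve (N.node u)
    rw [N.num_node hun, if_neg (c := N.node u = N.source)] at h2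
    · rw [add_zero] at h2
      rw [← h2]
      refine Nat.add_le_add_left ?_ _
      split_ifs with h3 h4 h4
      · subst h3
        rw [N.node_num]
        exact Finset.single_le_sum (f := fun m => rem m c) (fun _ _ => Nat.zero_le _)
          (Finset.mem_univ m)
      · subst h3
        rw [N.node_num] at h4
        exact absurd rfl h4
      · exact Nat.zero_le _
      · exact le_rfl
    · intro h3
      rw [← N.num_source, ← h3, N.num_node hun] at hs
      exact hs hu
  have h2 := Finset.sum_le_sum h1
  rw [Finset.sum_add_distrib, Finset.sum_ite_eq', if_pos ht] at h2
  have h3 : ∑ u ∈ S, ∑ v ∈ Finset.range (N.K * N.I), G u v = ∑ u ∈ S, ∑ v ∈ S, G u v := by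
    refine Finset.sum_congr rfl fun u hu => (Finset.sum_subset hS fun v hv hvS => ?_).symm
    have := hsep u hu v (Finset.mem_range.1 hv) hvS
    omega
  have h4 : ∑ u ∈ S, ∑ v ∈ S, G u v ≤ ∑ u ∈ S, ∑ v ∈ Finset.range (N.K * N.I), G v u := by
    rw [Finset.sum_comm]
    exact Finset.sum_le_sum fun u _ => Finset.sum_le_sum_of_subset hS
  omega

/-- Splitting off the amount `δ` along one path. -/
theorem IsPartial.step (h : IsPartial N D k G rem r) (hD : 0 < D) {m : Fin N.M} {c : Fin N.I}
    {δ len : ℕ} {path : ℕ → ℕ} (hδ : 0 < δ) (hrem : δ ≤ rem m c)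
    (hp : IsPathTo (fun u v => 1 ≤ G u v) (N.K * N.I) (N.num (k, c)) N.server path len)
    (hG : ∀ u < N.K * N.I, ∀ v < N.K * N.I,
      G' u v + δ * pathCount path (len - 1) u v = G u v) :
    IsPartial N D k G' (fun m' c' => rem m' c' - if m' = m ∧ c' = c then δ else 0)
      (r ++ [⟨m, c, nodeList N path len, (δ, D)⟩]) := by
  have hlen := hp.pos
  have hlast : (nodeList N path len).getLast? = some (k, c) := by
    rw [nodeList, List.getLast?_map, List.getLast?_range, if_neg (by omega), Option.map_some,
      hp.last, N.node_num]
  have hDq : (D : ℚ≥0) ≠ 0 := by exact_mod_cast hD.ne'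
  have hmul : (D : ℚ≥0) * ((δ : ℚ≥0) / (D : ℚ≥0)) = δ := mul_div_cancel₀ _ hDq
  have hcm : c ∈ N.clients m := h.rem_mem m c (by omega)
  have hle : ∀ m' c', (if m' = m ∧ c' = c then δ else 0) ≤ rem m' c' := by
    intro m' c'
    split_ifs with h1
    · rw [h1.1, h1.2]
      exact hrem
    · exact Nat.zero_le _
  refine ⟨fun u => ?_, fun m' c' h0 => h.rem_mem m' c' (by omega), ?_, ?_, ?_, ?_,
    fun m' c' hc' => ?_, fun u v => ?_⟩
  · have hu := N.num_lt u
    have h1 := h.conserve u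
    have h2 := sum_pathCount_add (path := path) (W := N.K * N.I) (j := len - 1)
      (fun i hi => hp.lt i (by omega)) (N.num u)
    simp only [hp.first, hp.last, ← N.num_source, N.num_injective.eq_iff] at h2
    have h3 : ∑ v ∈ Finset.range (N.K * N.I), G' (N.num u) v +
        δ * ∑ v ∈ Finset.range (N.K * N.I), pathCount path (len - 1) (N.num u) v =
        ∑ v ∈ Finset.range (N.K * N.I), G (N.num u) v := by
      rw [Finset.mul_sum, ← Finset.sum_add_distrib]
      exact Finset.sum_congr rfl fun v hv => hG _ hu v (Finset.mem_range.1 hv)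
    have h4 : ∑ v ∈ Finset.range (N.K * N.I), G' v (N.num u) +
        δ * ∑ v ∈ Finset.range (N.K * N.I), pathCount path (len - 1) v (N.num u) =
        ∑ v ∈ Finset.range (N.K * N.I), G v (N.num u) := by
      rw [Finset.mul_sum, ← Finset.sum_add_distrib]
      exact Finset.sum_congr rfl fun v hv => hG v (Finset.mem_range.1 hv) _ hu
    have h5 : ∑ m', rem m' u.2 = (∑ m', (rem m' u.2 - if m' = m ∧ u.2 = c then δ else 0)) +
        if u.2 = c then δ else 0 := by
      have : (if u.2 = c then δ else 0) = ∑ m', if m' = m ∧ u.2 = c then δ else 0 := by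
        by_cases hc : u.2 = c <;> simp [hc]
      rw [this, ← Finset.sum_add_distrib]
      exact Finset.sum_congr rfl fun m' _ => (Nat.sub_add_cancel (hle _ _)).symm
    have h6 : ∑ m', ∑ c', rem m' c' =
        (∑ m', ∑ c', (rem m' c' - if m' = m ∧ c' = c then δ else 0)) + δ := by
      have : δ = ∑ m', ∑ c', if m' = m ∧ c' = c then δ else 0 := by
        simp [ite_and]
      conv_rhs => rw [this]
      simp only [← Finset.sum_add_distrib]
      refine Finset.sum_congr rfl fun m' _ => Finset.sum_congr rfl fun c' _ => ?_
      rw [← this]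
      exact (Nat.sub_add_cancel (hle _ _)).symm
    have h7 : (u = (k, c)) ↔ (u.1 = k ∧ u.2 = c) := Prod.ext_iff
    have h8 := congrArg (δ * ·) h2
    simp only [mul_add, mul_ite, mul_one, mul_zero, h7] at h8
    rw [h5, h6] at h1
    clear h2 h5 h6
    generalize ∑ m', (rem m' u.2 - if m' = m ∧ u.2 = c then δ else 0) = A at h1 ⊢
    generalize ∑ m', ∑ c', (rem m' c' - if m' = m ∧ c' = c then δ else 0) = B at h1 ⊢
    split_ifs at h1 h8 ⊢ <;> omega
  · intro e he
    rcases List.mem_append.1 he with he | he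
    · exact h.client_mem e he
    · rw [List.mem_singleton.1 he]
      exact hcm
  · intro e he
    rcases List.mem_append.1 he with he | he
    · exact h.isPath e he
    · rw [List.mem_singleton.1 he]
      refine ⟨?_, ?_, ⟨k, hlast⟩, ?_⟩
      · refine (List.nodup_map_iff_inj_on List.nodup_range).2 fun i hi j hj hij => ?_
        rw [List.mem_range] at hi hj
        have hij' : path i = path j := by
          rw [← N.num_node (hp.lt i hi), ← N.num_node (hp.lt j hj), hij]
        rcases lt_trichotomy i j with hlt | heq | hlt
        · exact absurd hij' (hp.inj i j hlt hj)
        · exact heq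
        · exact absurd hij'.symm (hp.inj j i hlt hi)
      · simp only [nodeList]
        rw [List.head?_map, List.head?_range, if_neg (by omega), Option.map_some, hp.first,
          ← N.num_source, N.node_num]
      · simp only [nodeList]
        rw [List.isChain_map, List.isChain_range]
        intro i hi
        have h1 := hp.adj i (by omega)
        have h2 := h.capacity (N.node (path i)) (N.node (path (i + 1)))
        rw [N.num_node (hp.lt i (by omega)), N.num_node (hp.lt (i + 1) (by omega))] at h2
        have h3 : (0 : ℚ≥0) < G (path (i + 1)) (path i) := by exact_mod_cast h1
        exact pos_of_mul_pos_right ((h3.trans_le le_add_self).trans_le h2) zero_le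
  · intro e he
    rcases List.mem_append.1 he with he | he
    · exact h.last e he
    · rw [List.mem_singleton.1 he]
      exact hlast
  · intro e he
    rcases List.mem_append.1 he with he | he
    · exact h.amount e he
    · rw [List.mem_singleton.1 he]
      exact ⟨hδ, rfl⟩
  · have h1 := h.delivered m' c' hc'
    have h2 : (rem m' c' : ℚ≥0) = ((rem m' c' - if m' = m ∧ c' = c then δ else 0 : ℕ) : ℚ≥0) +
        ((if m' = m ∧ c' = c then δ else 0 : ℕ) : ℚ≥0) := by
      rw [← Nat.cast_add, Nat.sub_add_cancel (hle _ _)]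
    rw [← h1, h2, Routing.ofFractions, List.map_append, Routing.delivered_append, mul_add,
      add_assoc]
    refine congrArg₂ (· + ·) rfl ?_
    rw [add_comm]
    refine congrArg₂ (· + ·) rfl ?_
    by_cases h3 : m' = m ∧ c' = c
    · simp [Routing.delivered, h3.1, h3.2, hmul]
    · rw [if_neg h3]
      have h4 : ¬ (m = m' ∧ c = c') := fun h5 => h3 ⟨h5.1.symm, h5.2.symm⟩
      simp [Routing.delivered, h4]
  · refine le_trans (le_of_eq ?_) (h.capacity u v)
    rw [← hG _ (N.num_lt v) _ (N.num_lt u), Routing.ofFractions, List.map_append,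
      Routing.load_append, mul_add, ← Routing.ofFractions]
    have h1 : (D : ℚ≥0) * Routing.load (N := N) (List.map (fun e : PathFlow N (ℕ × ℕ) =>
        (⟨e.model, e.client, e.path, (e.amount.1 : ℚ≥0) / (e.amount.2 : ℚ≥0)⟩ : PathFlow N ℚ≥0))
        [⟨m, c, nodeList N path len, (δ, D)⟩]) u v =
        (δ : ℚ≥0) * pathCount path (len - 1) (N.num v) (N.num u) := by
      have h2 := arcCount_nodeList hp.lt u v
      rw [arcCount] at h2
      simp only [Routing.load, List.map_cons, List.map_nil, List.sum_cons, List.sum_nil, add_zero,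
        h2]
      rw [mul_left_comm, hmul, mul_comm]
    rw [h1]
    push_cast
    ring

theorem IsPartial.feasible (h : IsPartial N D k G rem r) (hD : 0 < D)
    (hrem : ∀ m c, rem m c = 0) : r.ofFractions.Feasible := by
  have hDq : (0 : ℚ≥0) < D := by exact_mod_cast hD
  have hmem : ∀ e' ∈ r.ofFractions, ∃ e ∈ r, e' =
      ⟨e.model, e.client, e.path, (e.amount.1 : ℚ≥0) / (e.amount.2 : ℚ≥0)⟩ := by
    intro e' he'
    obtain ⟨e, he, rfl⟩ := List.mem_map.1 he'
    exact ⟨e, he, rfl⟩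
  refine ⟨fun e' he' => ?_, fun e' he' => ?_, fun e' he' => ?_, fun m c hc => ?_, fun u v => ?_⟩
  · obtain ⟨e, he, rfl⟩ := hmem e' he'
    exact h.client_mem e he
  · obtain ⟨e, he, rfl⟩ := hmem e' he'
    have := h.isPath e he
    exact ⟨this.nodup, this.head, this.last, this.chain⟩
  · obtain ⟨e, he, rfl⟩ := hmem e' he'
    obtain ⟨h1, h2⟩ := h.amount e he
    rw [h2]
    exact div_pos (by exact_mod_cast h1) hDq
  · have h1 := h.delivered m c hc
    rw [hrem, Nat.cast_zero, add_zero] at h1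
    simpa using mul_left_cancel₀ hDq.ne' h1
  · have h1 := le_trans le_self_add (h.capacity u v)
    simpa using le_of_mul_le_mul_left h1 hDq

theorem IsPartial.makespan_le (h : IsPartial N D k G rem r) :
    r.ofFractions.makespan ≤ (k : ℕ) + 1 := by
  refine Finset.sup_le fun c _ => foldr_max_le fun a ha => ?_
  obtain ⟨e', he', rfl⟩ := List.mem_map.1 ha
  obtain ⟨e, he, rfl⟩ := List.mem_map.1 (List.mem_filter.1 he').1
  obtain ⟨u₀, hu, ha⟩ := (h.isPath e he).exists_find
  have h1 := snapshot_le_last (h.isPath e he).chain (h.last e he) u₀ (List.mem_of_find?_eq_some hu)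
  have h2 : (u₀.1 : ℕ) ≤ k := Fin.le_def.1 h1
  change e.arrival ≤ _
  omega

end FLRouting

namespace RAM

theorem State.output_congr {σ τ : State} (h₁ : τ.reg 1 = σ.reg 1) (h₂ : τ.arr 1 = σ.arr 1) :
    τ.output = σ.output := by
  rw [State.output, State.output, h₁, h₂]

theorem State.output_emit (σ : State) (v : ℕ) :
    ((σ.put 1 (σ.reg 1) v).set 1 (σ.reg 1 + 1)).output = σ.output ++ [v] := by
  simp only [State.output, State.reg_set, State.arr_set, State.arr_put, if_true,
    List.range_succ, List.map_append, List.map_cons, List.map_nil, Function.update_self]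
  congr 1
  refine List.map_congr_left fun i hi => Function.update_of_ne ?_ _ _
  have := List.mem_range.1 hi
  omega

theorem State.output_put (σ : State) (i v : ℕ) :
    (σ.put 1 i v).output = σ.output.set i v := by
  refine List.ext_getElem (by simp [State.output]) fun j h₁ h₂ => ?_
  simp [State.output, List.getElem_set, Function.update_apply, eq_comm (a := i)]

end RAM

namespace FLRouting

open RAM

/-! ### Output of path flows -/

/-- The number of the pair of a model and a client whose data are being routed. -/
abbrev rPair : ℕ := 27

/-- The scaled amounts to be delivered, for all pairs of a model and a client. -/
abbrev aNeed : ℕ := 10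

/-- Append a number to the output. -/
def emit (e : Expr) : Program :=
  .store 1 (.reg 1) e ;; .assign 1 (.reg 1 + 1)

theorem wp_emit {T : ℕ} {e : Expr} {Q : State → Prop} {σ : State} (he : e.MulOk T σ)
    (h : ∀ τ : State, (∀ x, x ≠ 1 → τ.reg x = σ.reg x) → (∀ a, a ≠ 1 → τ.arr a = σ.arr a) →
      τ.output = σ.output ++ [e.val σ] → Q τ) : wp T (emit e) Q σ := by
  simp only [emit, wp_seq, wp_store, wp_assign, Expr.mulOk_add, Expr.mulOk_reg, Expr.mulOk_one,
    Expr.val_add, Expr.val_reg, Expr.val_one, State.reg_put, true_and]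
  exact ⟨he, h _ (fun x hx => by simp [hx]) (fun a ha => by simp [ha]) (State.output_emit _ _)⟩

/-- The least of `rNeed` and the flows on the arcs of the path. -/
def bottleneck : Program :=
  .assign rAmount (.reg rNeed) ;;
  .for rJ (.reg rLen - 1) (
    .assign rU (.cell aMat (.cell aPath (.reg rJ + 1) * .reg rW + .cell aPath (.reg rJ))) ;;
    .ite (.reg rAmount - .reg rU) (.assign rAmount (.reg rU)) .skip)

theorem wp_bottleneck {T W len : ℕ} {σ : State} (hW : σ.reg rW = W) (hlen : σ.reg rLen = len)
    (hTl : len ≤ T) (hTW : W.size ≤ T) :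
    wp T bottleneck (fun τ => τ.reg rAmount ≤ σ.reg rNeed ∧
      (∀ i, i + 1 < len →
        τ.reg rAmount ≤ mat (σ.arr aMat) W (σ.arr aPath (i + 1)) (σ.arr aPath i)) ∧
      (τ.reg rAmount = σ.reg rNeed ∨ ∃ i, i + 1 < len ∧
        τ.reg rAmount = mat (σ.arr aMat) W (σ.arr aPath (i + 1)) (σ.arr aPath i))) σ := by
  unfold bottleneck
  simp only [wp_seq, wp_assign, Expr.mulOk_reg, Expr.val_reg, true_and]
  refine wp_for (fun j τ => τ.reg rAmount ≤ σ.reg rNeed ∧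
      (∀ i < j, τ.reg rAmount ≤ mat (σ.arr aMat) W (σ.arr aPath (i + 1)) (σ.arr aPath i)) ∧
      (τ.reg rAmount = σ.reg rNeed ∨ ∃ i, i + 1 < len ∧
        τ.reg rAmount = mat (σ.arr aMat) W (σ.arr aPath (i + 1)) (σ.arr aPath i)))
    (len - 1) (by omega) (by decide) (fun τ hf => ?_) ?_ ?_
    fun τ hf _ h => ⟨h.1, fun i hi => h.2.1 i (by omega), h.2.2⟩
  · simp [hf.reg rLen (by decide), hlen]
  · simp
  rintro j hj τ hf hij ⟨h1, h2, h3⟩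
  have hmat : τ.arr aMat = σ.arr aMat := by rw [hf.arr aMat (by decide)]; rfl
  have hpath : τ.arr aPath = σ.arr aPath := by rw [hf.arr aPath (by decide)]; rfl
  have hW' : τ.reg rW = W := by rw [hf.reg rW (by decide)]; simpa using hW
  simp +decide only [wp_seq, wp_assign, wp_ite, wp_skip, Expr.mulOk_cell, Expr.mulOk_add,
    Expr.mulOk_sub, Expr.mulOk_mul, Expr.mulOk_reg, Expr.mulOk_one, Expr.val_reg, Expr.val_cell,
    Expr.val_add, Expr.val_sub, Expr.val_mul, Expr.val_one, State.reg_set, if_true, if_false,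
    true_and, and_true, hmat, hpath, hW', hij, hTW]
  change (_ - mat (σ.arr aMat) W (σ.arr aPath (j + 1)) (σ.arr aPath j) ≠ 0 →
    mat (σ.arr aMat) W (σ.arr aPath (j + 1)) (σ.arr aPath j) ≤ _ ∧
    (∀ i < j + 1, mat (σ.arr aMat) W (σ.arr aPath (j + 1)) (σ.arr aPath j) ≤ _) ∧
    (mat (σ.arr aMat) W (σ.arr aPath (j + 1)) (σ.arr aPath j) = _ ∨ ∃ i, i + 1 < len ∧
      mat (σ.arr aMat) W (σ.arr aPath (j + 1)) (σ.arr aPath j) = _)) ∧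
    (_ - mat (σ.arr aMat) W (σ.arr aPath (j + 1)) (σ.arr aPath j) = 0 → _)
  refine ⟨fun h => ⟨by omega, fun i hi => ?_, .inr ⟨j, by omega, rfl⟩⟩,
    fun h => ⟨h1, fun i hi => ?_, h3⟩⟩
  · rcases Nat.lt_succ_iff_lt_or_eq.1 hi with hi | rfl
    · have := h2 i hi
      omega
    · exact le_rfl
  · rcases Nat.lt_succ_iff_lt_or_eq.1 hi with hi | rfl
    · exact h2 i hi
    · omega

/-- Take the amount `rAmount` off the flow on all arcs of the path. -/
def subtractPath : Program :=
  .for rJ (.reg rLen - 1) (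
    .assign rU (.cell aPath (.reg rJ + 1) * .reg rW + .cell aPath (.reg rJ)) ;;
    .store aMat (.reg rU) (.cell aMat (.reg rU) - .reg rAmount))

theorem wp_subtractPath {T w W src dst δ len : ℕ} {adj : ℕ → ℕ → Prop} {σ : State}
    (hW : σ.reg rW = W) (hδ : σ.reg rAmount = δ) (hlen : σ.reg rLen = len)
    (hp : IsPathTo adj w src dst (σ.arr aPath) len)
    (hle : ∀ i, i + 1 < len → δ ≤ mat (σ.arr aMat) W (σ.arr aPath (i + 1)) (σ.arr aPath i))
    (hTl : len ≤ T) (hTW : W.size ≤ T) (hwW : w ≤ W) :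
    wp T subtractPath (fun τ => ∀ u < w, ∀ v < w,
      mat (τ.arr aMat) W u v + δ * pathCount (σ.arr aPath) (len - 1) u v =
        mat (σ.arr aMat) W u v) σ := by
  set path := σ.arr aPath with hpath
  refine wp_for (fun j τ => ∀ u < w, ∀ v < w,
      mat (τ.arr aMat) W u v + δ * pathCount path j u v = mat (σ.arr aMat) W u v)
    (len - 1) (by omega) (by decide) (fun τ hf => ?_) ?_ ?_ fun τ _ _ h => h
  · simp [hf.reg rLen (by decide), hlen]
  · simp [pathCount]
  intro j hj τ hf hij hI
  have hy := hp.lt j (by omega)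
  have hx := hp.lt (j + 1) (by omega)
  have hle' := hle j (by omega)
  have h1 := hI _ hx _ hy
  rw [hp.pathCount_eq_zero (by omega)] at h1
  simp +decide only [wp_seq, wp_assign, wp_store, Expr.mulOk_cell, Expr.mulOk_add, Expr.mulOk_sub,
    Expr.mulOk_mul, Expr.mulOk_reg, Expr.mulOk_one, Expr.val_reg, Expr.val_cell, Expr.val_add,
    Expr.val_sub, Expr.val_mul, Expr.val_one, State.reg_set, State.arr_set,
    State.arr_put, if_true, if_false, true_and, and_true, hf.reg rW (by decide), hW,
    hf.reg rAmount (by decide), hδ, hf.arr aPath (by decide), ← hpath, hij, hTW]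
  intro u hu v hv
  have h2 := hI u hu v hv
  rw [mat_update _ (hy.trans_le hwW) _ _ _ (hv.trans_le hwW), pathCount_succ]
  change (if _ then mat (τ.arr aMat) W (path (j + 1)) (path j) - δ else _) + _ = _
  rw [mul_add, ← add_assoc]
  by_cases h3 : u = path (j + 1) ∧ v = path j
  · obtain ⟨rfl, rfl⟩ := h3
    rw [if_pos ⟨rfl, rfl⟩, if_pos ⟨rfl, rfl⟩]
    omega
  · rw [if_neg h3, if_neg (c := path (j + 1) = u ∧ path j = v) (fun h => h3 ⟨h.1.symm, h.2.symm⟩)]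
    omega

/-- The encoding of one path flow in the output. -/
def encodePiece {N : Instance} (e : PathFlow N (ℕ × ℕ)) : List ℕ :=
  [(e.model : ℕ), (e.client : ℕ), e.amount.1, e.amount.2, e.path.length]
    ++ e.path.flatMap fun u => [(u.1 : ℕ), (u.2 : ℕ)]

/-- Write one path flow. -/
def emitPiece : Program :=
  emit (.reg rModel) ;;
  emit (.reg rClient) ;;
  emit (.reg rAmount) ;;
  emit (.reg rDen) ;;
  emit (.reg rLen) ;;
  .for rJ (.reg rLen) (
    emit (.cell aPath (.reg rJ) / .reg rI) ;;
    emit (.cell aPath (.reg rJ) - .cell aPath (.reg rJ) / .reg rI * .reg rI))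

variable {N : Instance}

theorem Instance.node_fst {i : ℕ} (h : i < N.K * N.I) : ((N.node i).1 : ℕ) = i / N.I := by
  rw [← N.num_div, N.num_node h]

theorem Instance.node_snd {i : ℕ} (h : i < N.K * N.I) :
    ((N.node i).2 : ℕ) = i - i / N.I * N.I := by
  have h1 := N.num_node h
  rw [← N.node_fst h]
  rw [Instance.num] at h1
  omega

theorem wp_emitPiece {T len : ℕ} {σ : State} {e : PathFlow N (ℕ × ℕ)}
    (hm : σ.reg rModel = e.model) (hc : σ.reg rClient = e.client)
    (hn : σ.reg rAmount = e.amount.1) (hd : σ.reg rDen = e.amount.2) (hI : σ.reg rI = N.I)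
    (hlen : σ.reg rLen = len) (hp : e.path = nodeList N (σ.arr aPath) len)
    (hlt : ∀ i < len, σ.arr aPath i < N.K * N.I) (hTl : len ≤ T) (hTI : N.I.size ≤ T) :
    wp T emitPiece (fun τ => τ.output = σ.output ++ encodePiece e) σ := by
  unfold emitPiece
  refine wp_emit trivial fun σ₁ hr₁ ha₁ ho₁ => wp_emit trivial fun σ₂ hr₂ ha₂ ho₂ =>
    wp_emit trivial fun σ₃ hr₃ ha₃ ho₃ => wp_emit trivial fun σ₄ hr₄ ha₄ ho₄ =>
    wp_emit trivial fun σ₅ hr₅ ha₅ ho₅ => ?_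
  have hreg : ∀ x, x ≠ 1 → σ₅.reg x = σ.reg x := fun x hx => by
    rw [hr₅ x hx, hr₄ x hx, hr₃ x hx, hr₂ x hx, hr₁ x hx]
  have hpath : σ₅.arr aPath = σ.arr aPath := by
    rw [ha₅ _ (by decide), ha₄ _ (by decide), ha₃ _ (by decide), ha₂ _ (by decide),
      ha₁ _ (by decide)]
  have hout : σ₅.output = σ.output ++ [(e.model : ℕ), (e.client : ℕ), e.amount.1, e.amount.2,
      e.path.length] := by
    have hl : e.path.length = len := by simp [hp, nodeList]
    simp +decide [ho₅, ho₄, ho₃, ho₂, ho₁, hr₄, hr₃, hr₂, hr₁, hl, hm, hc, hn, hd, hlen]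
  refine wp_for (fun j τ => τ.output = σ₅.output ++
      (nodeList N (σ.arr aPath) j).flatMap fun u => [(u.1 : ℕ), (u.2 : ℕ)]) len hTl (by decide)
    (fun τ hf => ?_) ?_ ?_ ?_
  · simp [hf.reg rLen (by decide), hreg, hlen]
  · rw [State.output_congr (σ := σ₅) (by simp) (by simp)]
    simp [nodeList]
  · intro j hj τ hf hij hI'
    have hpath' : τ.arr aPath = σ.arr aPath := by rw [hf.arr aPath (by decide), hpath]
    have hI'' : τ.reg rI = N.I := by
      rw [hf.reg rI (by decide), hreg _ (by decide), hI]
    refine wp_emit ⟨trivial, trivial⟩ fun τ₁ hr₁ ha₁ ho₁ => wp_emit ?_ fun τ₂ hr₂ ha₂ ho₂ => ?_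
    · simp [hr₁, hI'', hTI]
    rw [State.output_congr (σ := τ₂) (by simp) (by simp), ho₂, ho₁, hI']
    simp only [Expr.val_sub, Expr.val_mul, Expr.val_div, Expr.val_cell, Expr.val_reg,
      hr₁ rJ (by decide), hr₁ rI (by decide), ha₁ aPath (by decide), hI'', hij, hpath']
    simp [nodeList, List.range_succ, N.node_fst (hlt j hj), N.node_snd (hlt j hj)]
  · intro τ hf hij hI'
    rw [hI', hout, encodePiece, hp, List.append_assoc]

end FLRouting

namespace FLRouting

open RAM

/-! ### The decomposition as a program -/

/-- Split off one path for the current model and client. -/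
def splitPath : Program :=
  findPath ;;
  bottleneck ;;
  subtractPath ;;
  .assign rNeed (.reg rNeed - .reg rAmount) ;;
  emitPiece ;;
  .assign rPieces (.reg rPieces + 1)

variable {N : Instance}

/-- The contents of the registers during the decomposition. -/
structure SplitEnv (N : Instance) (D : ℕ) (k : Fin N.K) (σ : State) : Prop where
  hI : σ.reg rI = N.I
  hW : σ.reg rW = N.K * N.I + 1
  hDen : σ.reg rDen = D
  hTrial : σ.reg rTrial = k
  hThr : σ.reg rThr = 1
  hCount : σ.reg rCount = N.K * N.I
  hDst : σ.reg rDst = N.server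

theorem SplitEnv.mono {D : ℕ} {k : Fin N.K} {σ τ : State} {X : List ℕ} (h : SplitEnv N D k σ)
    (hX : ∀ x ∈ [rI, rW, rDen, rTrial, rThr, rCount, rDst], x ∉ X)
    (hτ : ∀ x, x ∉ X → τ.reg x = σ.reg x) : SplitEnv N D k τ := by
  constructor
  · rw [hτ _ (hX _ (by decide)), h.hI]
  · rw [hτ _ (hX _ (by decide)), h.hW]
  · rw [hτ _ (hX _ (by decide)), h.hDen]
  · rw [hτ _ (hX _ (by decide)), h.hTrial]
  · rw [hτ _ (hX _ (by decide)), h.hThr]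
  · rw [hτ _ (hX _ (by decide)), h.hCount]
  · rw [hτ _ (hX _ (by decide)), h.hDst]

/-- The arcs that carry flow. -/
def flowArcs (G : ℕ → ℕ → ℕ) (n : ℕ) : Finset (ℕ × ℕ) :=
  (Finset.range n ×ˢ Finset.range n).filter fun p => G p.1 p.2 ≠ 0

theorem card_flowArcs_le (G : ℕ → ℕ → ℕ) (n : ℕ) : (flowArcs G n).card ≤ n ^ 2 := by
  refine (Finset.card_filter_le _ _).trans_eq ?_
  rw [Finset.card_product, Finset.card_range, sq]

/-- Subtracting the bottleneck of a path removes an arc from the flow. -/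
theorem card_flowArcs_lt {G G' : ℕ → ℕ → ℕ} {n δ j i : ℕ} {path : ℕ → ℕ}
    (hG : ∀ u < n, ∀ v < n, G' u v + δ * pathCount path j u v = G u v)
    (hi : i < j) (hlt : ∀ i ≤ j, path i < n) (hδ : 0 < δ) (he : δ = G (path (i + 1)) (path i)) :
    (flowArcs G' n).card < (flowArcs G n).card := by
  have hx := hlt (i + 1) hi
  have hy := hlt i hi.le
  refine Finset.card_lt_card ((Finset.ssubset_iff_of_subset fun p hp => ?_).2
    ⟨(path (i + 1), path i), ?_, ?_⟩)
  · simp only [flowArcs, Finset.mem_filter, Finset.mem_product, Finset.mem_range] at hp ⊢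
    have := hG p.1 hp.1.1 p.2 hp.1.2
    exact ⟨hp.1, by omega⟩
  · simp only [flowArcs, Finset.mem_filter, Finset.mem_product, Finset.mem_range]
    exact ⟨⟨hx, hy⟩, by omega⟩
  · simp only [flowArcs, Finset.mem_filter, not_and, not_not]
    intro _
    have h1 := hG _ hx _ hy
    have h2 : 1 ≤ pathCount path j (path (i + 1)) (path i) := by
      have := Finset.single_le_sum (f := fun i' =>
        if path (i' + 1) = path (i + 1) ∧ path i' = path i then 1 else 0)
        (fun _ _ => Nat.zero_le _) (Finset.mem_range.2 hi)
      rw [if_pos ⟨rfl, rfl⟩] at this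
      exact this
    have h3 : δ ≤ δ * pathCount path j (path (i + 1)) (path i) := Nat.le_mul_of_pos_right _ h2
    omega

/-- After each path, either the client is served or there are fewer arcs that carry flow. -/
theorem wp_splitPath {T D : ℕ} {k : Fin N.K} {σ : State} {m : Fin N.M} {c : Fin N.I}
    {rem : Fin N.M → Fin N.I → ℕ} {r : Routing N (ℕ × ℕ)} {x : ℕ}
    (hT : (N.K * N.I + 1) ^ 2 ≤ T) (hD : 0 < D) (henv : SplitEnv N D k σ)
    (hpart : IsPartial N D k (mat (σ.arr aMat) (N.K * N.I + 1)) rem r)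
    (hm : σ.reg rModel = m) (hc : σ.reg rClient = c) (hsrc : σ.reg rSrc = N.num (k, c))
    (hneed : rem m c = σ.reg rNeed) (h0 : σ.reg rNeed ≠ 0)
    (hout : σ.output = 1 :: x :: r.flatMap encodePiece) (hpieces : σ.reg rPieces = r.length) :
    wp T splitPath (fun τ => ∃ r',
      IsPartial N D k (mat (τ.arr aMat) (N.K * N.I + 1))
        (fun m' c' => if m' = m ∧ c' = c then τ.reg rNeed else rem m' c') r' ∧
      τ.output = 1 :: x :: r'.flatMap encodePiece ∧ τ.reg rPieces = r'.length ∧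
      (τ.reg rNeed = 0 ∨ (flowArcs (mat (τ.arr aMat) (N.K * N.I + 1)) (N.K * N.I)).card <
        (flowArcs (mat (σ.arr aMat) (N.K * N.I + 1)) (N.K * N.I)).card)) σ := by
  have hT' : N.K * N.I + 1 ≤ T := le_trans (by nlinarith) hT
  have hTW : (N.K * N.I + 1).size ≤ T := (Nat.size_le_self _).trans hT'
  have hTI : N.I.size ≤ T := by
    refine (Nat.size_le_self _).trans (le_trans ?_ hT')
    have := Nat.le_mul_of_pos_left N.I N.K_pos
    omega
  unfold splitPath
  rw [wp_seq]
  refine wp_call (wp_findPath (w := N.K * N.I) henv.hCount henv.hW hsrc henv.hDst henv.hThr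
    (N.num_lt _) (by rw [← N.num_source]; exact N.num_lt _) (by omega) hTW) ?_
  rintro τ₁ hf₁ ⟨hpath, hsep⟩
  have hlen : τ₁.reg rLen ≠ 0 := fun h => hpart.not_separated (by rw [hneed]; exact h0) (hsep h)
  have hp := hpath hlen
  set len := τ₁.reg rLen with hlen'
  set path := τ₁.arr aPath with hpath'
  have hmat₁ : τ₁.arr aMat = σ.arr aMat := hf₁.arr _ (by decide)
  have hneed₁ : τ₁.reg rNeed = σ.reg rNeed := hf₁.reg _ (by decide)
  have henv₁ : SplitEnv N D k τ₁ := henv.mono (by decide) hf₁.reg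
  have hlenT : len ≤ T := hp.len_le.trans (by omega)
  rw [wp_seq]
  refine wp_call (wp_bottleneck henv₁.hW rfl hlenT hTW) ?_
  rintro τ₂ hf₂ ⟨hle, hlearc, heq⟩
  set δ := τ₂.reg rAmount with hδ
  rw [hneed₁] at hle heq
  rw [hmat₁] at hlearc heq
  have hmat₂ : τ₂.arr aMat = σ.arr aMat := (hf₂.arr _ (by decide)).trans hmat₁
  have hpath₂ : τ₂.arr aPath = path := hf₂.arr _ (by decide)
  have hlen₂ : τ₂.reg rLen = len := hf₂.reg _ (by decide)
  have henv₂ : SplitEnv N D k τ₂ := henv₁.mono (by decide) hf₂.reg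
  have hδ0 : 0 < δ := by
    rcases heq with h | ⟨i, hi, h⟩
    · omega
    · rw [h]
      exact hp.adj i hi
  rw [wp_seq]
  refine wp_call (wp_subtractPath henv₂.hW rfl hlen₂ (by rw [hpath₂]; exact hp)
    (by rw [hmat₂, hpath₂]; exact hlearc) hlenT hTW (Nat.le_succ _)) ?_
  intro τ₃ hf₃ hG
  rw [hpath₂, hmat₂, ← hδ] at hG
  have hneed₃ : τ₃.reg rNeed = σ.reg rNeed := by
    rw [hf₃.reg _ (by decide), hf₂.reg _ (by decide), hneed₁]
  have hamount₃ : τ₃.reg rAmount = δ := hf₃.reg _ (by decide)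
  have henv₃ : SplitEnv N D k τ₃ := henv₂.mono (by decide) hf₃.reg
  have hpath₃ : τ₃.arr aPath = path := (hf₃.arr _ (by decide)).trans hpath₂
  have hlen₃ : τ₃.reg rLen = len := (hf₃.reg _ (by decide)).trans hlen₂
  have hout₃ : τ₃.output = σ.output := State.output_congr
    (by rw [hf₃.reg _ (by decide), hf₂.reg _ (by decide), hf₁.reg _ (by decide)])
    (by rw [hf₃.arr _ (by decide), hf₂.arr _ (by decide), hf₁.arr _ (by decide)])
  have hm₃ : τ₃.reg rModel = m := by
    rw [hf₃.reg _ (by decide), hf₂.reg _ (by decide), hf₁.reg _ (by decide), hm]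
  have hc₃ : τ₃.reg rClient = c := by
    rw [hf₃.reg _ (by decide), hf₂.reg _ (by decide), hf₁.reg _ (by decide), hc]
  have hpieces₃ : τ₃.reg rPieces = r.length := by
    rw [hf₃.reg _ (by decide), hf₂.reg _ (by decide), hf₁.reg _ (by decide), hpieces]
  simp +decide only [wp_seq, wp_assign, Expr.mulOk_sub, Expr.mulOk_reg, Expr.val_sub, Expr.val_reg,
    hneed₃, hamount₃, true_and]
  refine wp_call (wp_emitPiece (e := ⟨m, c, nodeList N path len, (δ, D)⟩) (len := len) ?_ ?_ ?_ ?_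
    ?_ ?_ ?_ ?_ hlenT hTI) ?_
  · simpa using hm₃
  · simpa using hc₃
  · simpa using hamount₃
  · simpa using henv₃.hDen
  · simpa using henv₃.hI
  · simpa using hlen₃
  · simp [hpath₃]
  · simpa [hpath₃] using hp.lt
  intro τ₄ hf₄ hout₄
  have hmat₄ : τ₄.arr aMat = τ₃.arr aMat := by rw [hf₄.arr _ (by decide)]; simp
  have hpieces₄ : τ₄.reg rPieces = r.length := by
    rw [hf₄.reg _ (by decide)]
    simpa using hpieces₃
  have hneed₄ : τ₄.reg rNeed = σ.reg rNeed - δ := by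
    rw [hf₄.reg _ (by decide)]
    simp
  simp +decide only [wp_assign, Expr.mulOk_add, Expr.mulOk_reg, Expr.mulOk_one, Expr.val_add,
    Expr.val_reg, Expr.val_one, State.reg_set, State.arr_set, if_true, if_false, true_and,
    hpieces₄, hmat₄, hneed₄]
  refine ⟨r ++ [⟨m, c, nodeList N path len, (δ, D)⟩], ?_, ?_, ?_, ?_⟩
  · have h1 := hpart.step (m := m) hD hδ0 (by omega) hp hG
    convert h1 using 3 with m' c'
    split_ifs with h2
    · rw [h2.1, h2.2, hneed]
    · rw [Nat.sub_zero]
  · rw [State.output_congr (σ := τ₄) (by simp) (by simp), hout₄,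
      State.output_congr (σ := τ₃) (by simp) (by simp), hout₃, hout]
    simp
  · simp
  · rcases heq with h | ⟨i, hi, h⟩
    · left
      omega
    · right
      exact card_flowArcs_lt hG (by omega) (fun i hi => hp.lt i (by omega)) hδ0 h

theorem IsPartial.congr {D : ℕ} {k : Fin N.K} {G G' : ℕ → ℕ → ℕ} {rem : Fin N.M → Fin N.I → ℕ}
    {r : Routing N (ℕ × ℕ)} (h : IsPartial N D k G rem r)
    (hG : ∀ u < N.K * N.I, ∀ v < N.K * N.I, G' u v = G u v) : IsPartial N D k G' rem r := by
  refine ⟨fun u => ?_, h.rem_mem, h.client_mem, h.isPath, h.last, h.amount, h.delivered,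
    fun u v => ?_⟩
  · rw [Finset.sum_congr rfl fun v hv => hG v (Finset.mem_range.1 hv) _ (N.num_lt u),
      Finset.sum_congr rfl fun v hv => hG _ (N.num_lt u) v (Finset.mem_range.1 hv)]
    exact h.conserve u
  · rw [hG _ (N.num_lt v) _ (N.num_lt u)]
    exact h.capacity u v

/-- Split off the paths for the pair `rPair` of a model and a client. -/
def routePair : Program :=
  .assign rModel (.reg rPair / .reg rI) ;;
  .assign rClient (.reg rPair - .reg rPair / .reg rI * .reg rI) ;;
  .assign rNeed (.cell aNeed (.reg rPair)) ;;
  .assign rSrc (.reg rTrial * .reg rI + .reg rClient) ;;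
  .loop (.reg rNeed) splitPath

theorem wp_routePair {T D j x : ℕ} {k : Fin N.K} {σ : State} {need : Fin N.M → Fin N.I → ℕ}
    {r : Routing N (ℕ × ℕ)} (hT : (N.K * N.I + 1) ^ 2 ≤ T) (hj : j < N.M * N.I) (hD : 0 < D)
    (henv : SplitEnv N D k σ) (hij : σ.reg rPair = j)
    (hneed : ∀ (m : Fin N.M) (c : Fin N.I), σ.arr aNeed ((m : ℕ) * N.I + c) = need m c)
    (hr : IsPartial N D k (mat (σ.arr aMat) (N.K * N.I + 1))
      (fun m c => if (m : ℕ) * N.I + c < j then 0 else need m c) r)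
    (hout : σ.output = 1 :: x :: r.flatMap encodePiece) (hpieces : σ.reg rPieces = r.length) :
    wp T routePair (fun τ => ∃ r x, IsPartial N D k (mat (τ.arr aMat) (N.K * N.I + 1))
      (fun m c => if (m : ℕ) * N.I + c < j + 1 then 0 else need m c) r ∧
      τ.output = 1 :: x :: r.flatMap encodePiece ∧ τ.reg rPieces = r.length) σ := by
  have hT' : N.K * N.I + 1 ≤ T := le_trans (by nlinarith) hT
  have hTI : N.I.size ≤ T := by
    refine (Nat.size_le_self _).trans (le_trans ?_ hT')
    have := Nat.le_mul_of_pos_left N.I N.K_pos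
    omega
  unfold routePair
  have hI0 : 0 < N.I := N.server.pos
  have hm : j / N.I < N.M := Nat.div_lt_of_lt_mul (by rwa [mul_comm])
  have hdm : j / N.I * N.I + j % N.I = j := Nat.div_add_mod' j N.I
  have hc : j - j / N.I * N.I < N.I := by
    have := Nat.mod_lt j hI0
    omega
  obtain ⟨m, hm'⟩ : ∃ m : Fin N.M, (m : ℕ) = j / N.I := ⟨⟨_, hm⟩, rfl⟩
  obtain ⟨c, hc'⟩ : ∃ c : Fin N.I, (c : ℕ) = j - j / N.I * N.I := ⟨⟨_, hc⟩, rfl⟩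
  have hmc : (m : ℕ) * N.I + c = j := by rw [hm', hc']; omega
  have hmc' : ∀ (m' : Fin N.M) (c' : Fin N.I), (m' : ℕ) * N.I + c' = j ↔ m' = m ∧ c' = c := by
    intro m' c'
    rw [← hmc, mul_add_inj c'.2 c.2, Fin.ext_iff, Fin.ext_iff]
  simp +decide only [wp_seq, wp_assign, Expr.mulOk_reg, Expr.mulOk_cell, Expr.mulOk_add,
    Expr.mulOk_sub, Expr.mulOk_mul, Expr.mulOk_div, Expr.val_reg, Expr.val_cell, Expr.val_add,
    Expr.val_sub, Expr.val_mul, Expr.val_div, State.reg_set, State.arr_set, if_true, if_false,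
    true_and, and_true, henv.hI, henv.hTrial, hij, hTI, ← hm']
  have hc'' : j - m * N.I = c := by rw [hc', hm']
  rw [hc'']
  have henv₃ : SplitEnv N D k ((((σ.set rModel m).set rClient c).set rNeed
      (σ.arr aNeed j)).set rSrc (k * N.I + c)) := by
    constructor <;> simp +decide [henv.hI, henv.hW, henv.hDen, henv.hTrial, henv.hThr,
      henv.hCount, henv.hDst]
  have hneedj : σ.arr aNeed j = need m c := by rw [← hmc, hneed]
  rw [hneedj] at henv₃ ⊢
  set σ₂ : State := (((σ.set rModel m).set rClient c).set rNeed
      (need m c)).set rSrc (k * N.I + c) with hσ₂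
  have hmat₂ : σ₂.arr aMat = σ.arr aMat := by simp [hσ₂]
  refine wp_loop (fun a ρ => ∃ r x, IsPartial N D k (mat (ρ.arr aMat) (N.K * N.I + 1))
      (fun m' c' => if m' = m ∧ c' = c then ρ.reg rNeed else
        if (m' : ℕ) * N.I + c' < j then 0 else need m' c') r ∧
      ρ.output = 1 :: x :: r.flatMap encodePiece ∧ ρ.reg rPieces = r.length ∧
      (ρ.reg rNeed = 0 ∨ (flowArcs (mat (ρ.arr aMat) (N.K * N.I + 1)) (N.K * N.I)).card < a))
    ((N.K * N.I) ^ 2 + 1) (by nlinarith) ⟨r, x, ?_, ?_, ?_, ?_⟩ ?_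
  · rw [hmat₂]
    convert hr using 3 with m' c'
    split_ifs with h1 h2
    · have := (hmc' m' c').2 h1
      omega
    · simp +decide [hσ₂, h1.1, h1.2]
    · rfl
    · rfl
  · rw [← hout]
    exact State.output_congr (by simp +decide [hσ₂]) (by simp [hσ₂])
  · simpa +decide [hσ₂] using hpieces
  · exact .inr (Nat.lt_succ_of_le (card_flowArcs_le _ _))
  rintro a ρ ha ⟨r₁, x₁, hr₁, hout₁, hpieces₁, hcard⟩ hf₃
  refine ⟨trivial, fun h0 => ?_, fun h0 => ?_⟩
  · simp only [Expr.val_reg] at h0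
    have hcard' := hcard.resolve_left h0
    have henv₄ : SplitEnv N D k ρ := henv₃.mono (by decide) hf₃.reg
    refine wp_call (wp_splitPath (m := m) (c := c) hT hD henv₄ hr₁ ?_ ?_ ?_ ?_ h0 hout₁
      hpieces₁) ?_
    · rw [hf₃.reg _ (by decide)]
      simp +decide [hσ₂]
    · rw [hf₃.reg _ (by decide)]
      simp +decide [hσ₂]
    · rw [hf₃.reg _ (by decide)]
      simp [hσ₂, Instance.num]
    · rw [if_pos ⟨rfl, rfl⟩]
    rintro ρ' hf₄ ⟨r₂, hr₂, hout₂, hpieces₂, hcard₂⟩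
    by_cases h1 : ρ'.reg rNeed = 0
    · refine ⟨0, by omega, r₂, x₁, ?_, hout₂, hpieces₂, .inl h1⟩
      convert hr₂ using 3 with m' c'
      split_ifs <;> rfl
    · refine ⟨_, hcard', r₂, x₁, ?_, hout₂, hpieces₂, .inr (hcard₂.resolve_left h1)⟩
      convert hr₂ using 3 with m' c'
      split_ifs <;> rfl
  · simp only [Expr.val_reg] at h0
    refine ⟨r₁, x₁, ?_, hout₁, hpieces₁⟩
    convert hr₁ using 3 with m' c'
    by_cases h1 : m' = m ∧ c' = c
    · have := (hmc' m' c').2 h1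
      rw [if_pos (by omega), if_pos h1, h0]
    · have := mt (hmc' m' c').1 h1
      rw [if_neg h1]
      exact if_congr (by omega) rfl rfl

/-- Turn the residual capacities into a flow, and write it out as a routing.  Cell `1` of the
output, which holds the number of path flows, is filled in at the end. -/
def decompose : Program :=
  .for rV (.reg rW * .reg rW)
    (.store aMat (.reg rV) (.cell aMat (.reg rV) - .cell aCap (.reg rV))) ;;
  .assign rThr 1 ;;
  .assign rCount (.reg rN) ;;
  .assign rDst (.reg rServer) ;;
  .assign rPieces 0 ;;
  .store 1 0 1 ;;
  .assign 1 2 ;;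
  .for rPair (.reg rM * .reg rI) routePair ;;
  .store 1 1 (.reg rPieces)

theorem wp_decompose {T D : ℕ} {k : Fin N.K} {σ : State} {need : Fin N.M → Fin N.I → ℕ}
    (hT : (N.K * N.I + 1) ^ 2 ≤ T) (hTM : N.M * N.I ≤ T) (hD : 0 < D)
    (hI : σ.reg rI = N.I) (hM : σ.reg rM = N.M) (hN : σ.reg rN = N.K * N.I)
    (hW : σ.reg rW = N.K * N.I + 1) (hDen : σ.reg rDen = D) (hTrial : σ.reg rTrial = k)
    (hServer : σ.reg rServer = N.server)
    (hneed : ∀ (m : Fin N.M) (c : Fin N.I), σ.arr aNeed ((m : ℕ) * N.I + c) = need m c)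
    (hpart : IsPartial N D k (fun u v => mat (σ.arr aMat) (N.K * N.I + 1) u v -
      mat (σ.arr aCap) (N.K * N.I + 1) u v) need []) :
    wp T decompose (fun τ => ∃ r G, IsPartial N D k G (fun _ _ => 0) r ∧
      τ.output = encodeAnswer N (some r)) σ := by
  have hT' : N.K * N.I + 1 ≤ T := le_trans (by nlinarith) hT
  have hTW : (N.K * N.I + 1).size ≤ T := (Nat.size_le_self _).trans hT'
  have hTI : N.I.size ≤ T := by
    refine (Nat.size_le_self _).trans (le_trans ?_ hT')
    have := Nat.le_mul_of_pos_left N.I N.K_pos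
    omega
  unfold decompose
  rw [wp_seq]
  refine wp_for (fun j τ => ∀ i, τ.arr aMat i =
      if i < j then σ.arr aMat i - σ.arr aCap i else σ.arr aMat i)
    ((N.K * N.I + 1) * (N.K * N.I + 1)) (by rwa [← sq]) (by decide) (fun τ hf => ?_) ?_ ?_ ?_
  · simp [hf.reg rW (by decide), hW, hTW]
  · simp
  · intro j hj τ hf hij hinv
    simp +decide only [wp_store, Expr.mulOk_reg, Expr.mulOk_cell, Expr.mulOk_sub, Expr.val_reg,
      Expr.val_cell, Expr.val_sub, State.arr_set, State.arr_put, if_true, true_and, hij,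
      hf.arr aCap (by decide)]
    intro i
    rw [Function.update_apply, hinv j, hinv i]
    split_ifs <;> first | omega | (subst_vars; rfl)
  intro τ hf hij hmat
  have hG : ∀ u < N.K * N.I + 1, ∀ v < N.K * N.I + 1, mat (τ.arr aMat) (N.K * N.I + 1) u v =
      mat (σ.arr aMat) (N.K * N.I + 1) u v - mat (σ.arr aCap) (N.K * N.I + 1) u v := by
    intro u hu v hv
    have : u * (N.K * N.I + 1) + v < (N.K * N.I + 1) * (N.K * N.I + 1) := by nlinarith
    simp only [mat, hmat, if_pos this]
  have hpart' : IsPartial N D k (mat (τ.arr aMat) (N.K * N.I + 1)) need [] :=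
    hpart.congr fun u hu v hv => hG u (by omega) v (by omega)
  simp +decide only [wp_seq, wp_assign, wp_store, Expr.mulOk_reg, Expr.mulOk_zero, Expr.mulOk_one,
    Expr.mulOk_two, Expr.val_reg, Expr.val_zero, Expr.val_one, Expr.val_two, State.reg_set,
    if_false, true_and]
  have henv : SplitEnv N D k ((((((((τ.set rThr 1).set rCount (τ.reg rN)).set rDst
      (τ.reg rServer)).set rPieces 0).put 1 0 1).set 1 2))) := by
    constructor <;> simp +decide [hf.reg rI (by decide), hf.reg rW (by decide),
      hf.reg rDen (by decide), hf.reg rTrial (by decide), hf.reg rN (by decide),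
      hf.reg rServer (by decide), hI, hW, hDen, hTrial, hN, hServer]
  set σ₁ : State := ((((((τ.set rThr 1).set rCount (τ.reg rN)).set rDst
      (τ.reg rServer)).set rPieces 0).put 1 0 1).set 1 2) with hσ₁
  have hM₁ : σ₁.reg rM = N.M := by simp +decide [hσ₁, hf.reg rM (by decide), hM]
  have hneed₁ : σ₁.arr aNeed = σ.arr aNeed := by simp +decide [hσ₁, hf.arr aNeed (by decide)]
  have hmat₁ : σ₁.arr aMat = τ.arr aMat := by simp +decide [hσ₁]
  refine wp_for (fun j τ => ∃ r x, IsPartial N D k (mat (τ.arr aMat) (N.K * N.I + 1))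
      (fun m c => if (m : ℕ) * N.I + c < j then 0 else need m c) r ∧
      τ.output = 1 :: x :: r.flatMap encodePiece ∧ τ.reg rPieces = r.length)
    (N.M * N.I) hTM (by decide) (fun τ' hf' => ?_) ?_ ?_ ?_
  · simp [hf'.reg rM (by decide), hM₁, hf'.reg rI (by decide), henv.hI, hTI]
  · refine ⟨[], τ.arr 1 1, ?_, ?_, ?_⟩
    · simpa [hmat₁] using hpart'
    · simp [State.output, List.range_succ, hσ₁]
    · simp +decide [hσ₁]
  · rintro j hj τ₂ hf₂ hij ⟨r, x, hr, hout, hpieces⟩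
    refine wp_call (wp_routePair hT hj hD (henv.mono (by decide) hf₂.reg) hij (fun m c => ?_) hr
      hout hpieces) ?_
    · rw [hf₂.arr _ (by decide), hneed₁, hneed]
    rintro τ₃ - ⟨r', x', hr', hout', hpieces'⟩
    refine ⟨r', x', hr', ?_, ?_⟩
    · rw [← hout']
      exact State.output_congr (by simp) (by simp)
    · simpa +decide using hpieces'
  · rintro τ₂ hf₂ - ⟨r, x, hr, hout, hpieces⟩
    simp only [wp_store, Expr.mulOk_reg, Expr.mulOk_one, Expr.val_reg, Expr.val_one, true_and]
    refine ⟨r, mat (τ₂.arr aMat) (N.K * N.I + 1), ?_, ?_⟩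
    · convert hr using 3 with m c
      rw [if_pos]
      have h1 := m.2
      have h2 := c.2
      nlinarith
    · rw [State.output_put, hout, hpieces]
      rfl

end FLRouting

namespace FLRouting

open RAM

/-! ### Reading the input -/

theorem getD_flatMap {α β : Type} {f : α → List β} {w : ℕ} (hf : ∀ a, (f a).length = w) (d : β) :
    ∀ (l : List α) (i j : ℕ) (hi : i < l.length), j < w →
      (l.flatMap f).getD (i * w + j) d = (f l[i]).getD j d := by
  intro l
  induction l with
  | nil => intro i j hi; simp at hi
  | cons a l ih =>
    rintro (_ | i) j hi hj
    · rw [List.flatMap_cons, zero_mul, zero_add, List.getD_append _ _ _ _ (by rwa [hf])]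
      rfl
    · rw [List.flatMap_cons, List.getD_append_right _ _ _ _ (by rw [hf]; nlinarith), hf,
        show (i + 1) * w + j - w = i * w + j by rw [add_mul]; omega,
        ih i j (by simpa using hi) hj]
      rfl

theorem getD_flatMap_finRange {β : Type} {n w : ℕ} {f : Fin n → List β}
    (hf : ∀ a, (f a).length = w) (d : β) (i : Fin n) {j : ℕ} (hj : j < w) :
    ((List.finRange n).flatMap f).getD (i * w + j) d = (f i).getD j d := by
  rw [getD_flatMap hf d _ i j (by simp) hj]
  simp

theorem length_flatMap_finRange {β : Type} {n w : ℕ} {f : Fin n → List β}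
    (hf : ∀ a, (f a).length = w) : ((List.finRange n).flatMap f).length = n * w := by
  simp [List.length_flatMap, hf]

/-- The array `A` holds the encoding of `N`. -/
structure IsInput (N : Instance) (A : ℕ → ℕ) : Prop where
  hI : A 0 = N.I
  hK : A 1 = N.K
  hM : A 2 = N.M
  hServer : A 3 = N.server
  cap : ∀ (u : N.Node) (j : Fin N.I), A (2 * (N.num u * N.I + j) + 4) = (N.cap u.1 u.2 j).num ∧
    A (2 * (N.num u * N.I + j) + 5) = (N.cap u.1 u.2 j).den
  size : ∀ m : Fin N.M, A (2 * (N.K * N.I * N.I + m) + 4) = (N.size m).num ∧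
    A (2 * (N.K * N.I * N.I + m) + 5) = (N.size m).den
  client : ∀ (m : Fin N.M) (c : Fin N.I), A (2 * (N.K * N.I * N.I + N.M) + 4 + (m * N.I + c)) =
    if c ∈ N.clients m then 1 else 0

variable {N : Instance}

theorem length_encodeInstance (N : Instance) : (encodeInstance N).length =
    4 + N.K * (N.I * (N.I * 2)) + N.M * 2 + N.M * N.I := by
  simp only [encodeInstance, List.length_append]
  rw [length_flatMap_finRange (w := N.I * (N.I * 2)), length_flatMap_finRange (w := 2),
    length_flatMap_finRange (w := N.I)]
  · rfl
  · simp
  · simp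
  · intro k
    rw [length_flatMap_finRange (w := N.I * 2)]
    intro i
    rw [length_flatMap_finRange (w := 2)]
    simp

theorem isInput_encodeInstance (N : Instance) :
    IsInput N fun i => (encodeInstance N).getD i 0 := by
  set l₁ : List ℕ := [N.I, N.K, N.M, N.server] with h₁
  set f : Fin N.K → Fin N.I → Fin N.I → List ℕ :=
    fun k i j => [(N.cap k i j).num, (N.cap k i j).den] with hf
  set l₂ : List ℕ := (List.finRange N.K).flatMap fun k => (List.finRange N.I).flatMap fun i =>
    (List.finRange N.I).flatMap fun j => f k i j with h₂
  set g : Fin N.M → List ℕ := fun m => [(N.size m).num, (N.size m).den] with hg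
  set l₃ : List ℕ := (List.finRange N.M).flatMap g with h₃
  set b : Fin N.M → List ℕ :=
    fun m => (List.finRange N.I).map fun c => if c ∈ N.clients m then 1 else 0 with hb
  set l₄ : List ℕ := (List.finRange N.M).flatMap b with h₄
  have henc : encodeInstance N = l₁ ++ (l₂ ++ (l₃ ++ l₄)) := by
    simp only [encodeInstance, List.append_assoc, h₁, h₂, h₃, h₄, hf, hg, hb]
  have hf1 : ∀ k i j, (f k i j).length = 2 := fun _ _ _ => rfl
  have hf2 : ∀ k i, ((List.finRange N.I).flatMap fun j => f k i j).length = N.I * 2 :=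
    fun k i => length_flatMap_finRange (hf1 k i)
  have hf3 : ∀ k, ((List.finRange N.I).flatMap fun i =>
      (List.finRange N.I).flatMap fun j => f k i j).length = N.I * (N.I * 2) :=
    fun k => length_flatMap_finRange (hf2 k)
  have hg1 : ∀ m, (g m).length = 2 := fun _ => rfl
  have hb1 : ∀ m, (b m).length = N.I := fun m => by simp [hb]
  have hl₁ : l₁.length = 4 := rfl
  have hl₂ : l₂.length = 2 * (N.K * N.I * N.I) := by
    rw [h₂, length_flatMap_finRange hf3]
    ring
  have hl₃ : l₃.length = N.M * 2 := length_flatMap_finRange hg1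
  have hcap : ∀ (u : N.Node) (j : Fin N.I), ∀ t < 2,
      (encodeInstance N).getD (2 * (N.num u * N.I + j) + 4 + t) 0 =
        (f u.1 u.2 j).getD t 0 := by
    intro u j t ht
    have e : 2 * (N.num u * N.I + j) + 4 + t - 4 =
        u.1 * (N.I * (N.I * 2)) + (u.2 * (N.I * 2) + (j * 2 + t)) := by
      rw [show 2 * (N.num u * N.I + j) + 4 + t - 4 = 2 * (N.num u * N.I + j) + t by omega,
        Instance.num]
      ring
    have h1 : (j : ℕ) * 2 + t < N.I * 2 := by
      have := j.2
      omega
    have h2 : (u.2 : ℕ) * (N.I * 2) + (j * 2 + t) < N.I * (N.I * 2) := by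
      have := u.2.2
      nlinarith
    rw [henc, List.getD_append_right _ _ _ _ (by rw [hl₁]; omega), hl₁, e,
      List.getD_append _ _ _ _ ?_, h₂, getD_flatMap_finRange hf3 _ _ h2,
      getD_flatMap_finRange (hf2 _) _ _ h1, getD_flatMap_finRange (hf1 _ _) _ _ ht]
    rw [h₂, length_flatMap_finRange hf3]
    have := u.1.2
    nlinarith
  have hsize : ∀ (m : Fin N.M), ∀ t < 2,
      (encodeInstance N).getD (2 * (N.K * N.I * N.I + m) + 4 + t) 0 = (g m).getD t 0 := by
    intro m t ht
    rw [henc, List.getD_append_right _ _ _ _ (by rw [hl₁]; omega), hl₁,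
      List.getD_append_right _ _ _ _ (by rw [hl₂]; omega), hl₂,
      show 2 * (N.K * N.I * N.I + m) + 4 + t - 4 - 2 * (N.K * N.I * N.I) = m * 2 + t by omega,
      List.getD_append _ _ _ _ (by rw [hl₃]; have := m.2; omega), h₃,
      getD_flatMap_finRange hg1 _ _ ht]
  refine ⟨rfl, rfl, rfl, rfl, fun u j => ⟨hcap u j 0 (by omega), hcap u j 1 (by omega)⟩,
    fun m => ⟨hsize m 0 (by omega), hsize m 1 (by omega)⟩, fun m c => ?_⟩
  show (encodeInstance N).getD _ 0 = _
  rw [henc, List.getD_append_right _ _ _ _ (by rw [hl₁]; omega), hl₁,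
    List.getD_append_right _ _ _ _ (by rw [hl₂]; omega), hl₂,
    List.getD_append_right _ _ _ _ (by rw [hl₃]; omega), hl₃,
    show 2 * (N.K * N.I * N.I + N.M) + 4 + (m * N.I + c) - 4 - 2 * (N.K * N.I * N.I) - N.M * 2 =
      m * N.I + c by omega, h₄, getD_flatMap_finRange hb1 _ _ c.2, hb]
  simp [List.getD_eq_getElem?_getD]

theorem IsInput.den_ne_zero {A : ℕ → ℕ} (hA : IsInput N A) {p : ℕ}
    (hp : p < N.K * N.I * N.I + N.M) : A (2 * p + 5) ≠ 0 := by
  by_cases h : p < N.K * N.I * N.I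
  · have hI0 : 0 < N.I := N.server.pos
    have h1 : p / N.I < N.K * N.I := Nat.div_lt_of_lt_mul (by rwa [mul_comm])
    have h2 := (hA.cap (N.node (p / N.I)) ⟨p % N.I, Nat.mod_lt p hI0⟩).2
    rw [N.num_node h1] at h2
    simp only [Nat.div_add_mod'] at h2
    rw [h2]
    exact NNRat.den_ne_zero _
  · obtain ⟨m, rfl⟩ := Nat.exists_eq_add_of_le (not_lt.1 h)
    rw [(hA.size ⟨m, by omega⟩).2]
    exact NNRat.den_ne_zero _

end FLRouting

namespace FLRouting

open RAM

/-! ### Scaling to integers -/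

/-- The number of fractions in the input. -/
abbrev rFractions : ℕ := 28

/-- Read the dimensions, and multiply all amounts by the product of all denominators.  The second
factor of every product is an input number or a dimension, and hence short. -/
def setup : Program :=
  .assign rI (.cell 0 0) ;;
  .assign rK (.cell 0 1) ;;
  .assign rM (.cell 0 2) ;;
  .assign rServer (.cell 0 (.const 3)) ;;
  .assign rN (.reg rK * .reg rI) ;;
  .assign rW (.reg rN + 1) ;;
  .assign rFractions (.reg rN * .reg rI + .reg rM) ;;
  .assign rDen 1 ;;
  .for rJ (.reg rFractions) (.assign rDen (.reg rDen * .cell 0 (2 * .reg rJ + .const 5))) ;;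
  .for rJ (.reg rFractions) (.store aScaled (.reg rJ)
    (.reg rDen / .cell 0 (2 * .reg rJ + .const 5) * .cell 0 (2 * .reg rJ + .const 4))) ;;
  .for rPair (.reg rM * .reg rI) (.store aNeed (.reg rPair)
    (.cell aScaled (.reg rN * .reg rI + .reg rPair / .reg rI) *
      .cell 0 (2 * .reg rFractions + .const 4 + .reg rPair))) ;;
  .assign rTotal 0 ;;
  .for rClient (.reg rI) (
    .assign rAmount 0 ;;
    .for rModel (.reg rM)
      (.assign rAmount (.reg rAmount + .cell aNeed (.reg rModel * .reg rI + .reg rClient))) ;;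
    .store aDemand (.reg rClient) (.reg rAmount) ;;
    .assign rTotal (.reg rTotal + .reg rAmount))

variable {N : Instance}

/-- The state after the setup: the dimensions, and all amounts multiplied by `D`. -/
structure IsScaled (N : Instance) (D : ℕ) (σ : State) : Prop where
  pos : 0 < D
  hI : σ.reg rI = N.I
  hK : σ.reg rK = N.K
  hM : σ.reg rM = N.M
  hServer : σ.reg rServer = N.server
  hN : σ.reg rN = N.K * N.I
  hW : σ.reg rW = N.K * N.I + 1
  hDen : σ.reg rDen = D
  cap : ∀ (u : N.Node) (j : Fin N.I),
    (σ.arr aScaled (N.num u * N.I + j) : ℚ≥0) = D * N.cap u.1 u.2 j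
  need : ∀ (m : Fin N.M) (c : Fin N.I),
    (σ.arr aNeed (m * N.I + c) : ℚ≥0) = if c ∈ N.clients m then D * N.size m else 0
  demand : ∀ c : Fin N.I, (σ.arr aDemand c : ℚ≥0) = D * N.clientDemand c
  total : (σ.reg rTotal : ℚ≥0) = D * N.totalDemand

theorem size_prod_le {f : ℕ → ℕ} {L : ℕ} (hf : ∀ p, (f p).size ≤ L) (n : ℕ) :
    (∏ p ∈ Finset.range n, f p).size ≤ n * L + 1 := by
  induction n with
  | zero => simp
  | succ n ih =>
    rw [Finset.prod_range_succ]
    have h1 := RAM.Nat.size_mul_le (∏ p ∈ Finset.range n, f p) (f n)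
    have h2 := hf n
    rw [add_mul]
    omega

/-- Scaling a fraction by a multiple of its denominator. -/
theorem cast_div_mul {D a b : ℕ} {q : ℚ≥0} (ha : a = q.num) (hb : b = q.den) (h : b ∣ D) :
    ((D / b * a : ℕ) : ℚ≥0) = D * q := by
  have hb0 : (b : ℚ≥0) ≠ 0 := by
    rw [hb]
    exact_mod_cast NNRat.den_ne_zero q
  rw [Nat.cast_mul, Nat.cast_div h hb0]
  conv_rhs => rw [← NNRat.num_div_den q, ← ha, ← hb]
  rw [div_mul_eq_mul_div, mul_div_assoc]

theorem wp_setup {T L : ℕ} {σ : State} (hA : IsInput N (σ.arr 0))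
    (hL : ∀ i, (σ.arr 0 i).size ≤ L) (hLT : L ≤ T) (hF : N.K * N.I * N.I + N.M ≤ T)
    (hMI : N.M * N.I ≤ T) :
    wp T setup (fun τ => ∃ D, IsScaled N D τ ∧
      D.size ≤ (N.K * N.I * N.I + N.M) * L + 1) σ := by
  have hI0 : 0 < N.I := N.server.pos
  have hIT : N.I ≤ T := by
    have := Nat.mul_le_mul (Nat.mul_le_mul N.K_pos (le_refl N.I)) (Nat.succ_le_of_lt hI0)
    omega
  have hTI : N.I.size ≤ T := (Nat.size_le_self _).trans hIT
  have hcell : ∀ i, (σ.arr 0 i).size ≤ T := fun i => (hL i).trans hLT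
  unfold setup
  simp +decide only [wp_seq, wp_assign, Expr.mulOk_reg, Expr.mulOk_cell, Expr.mulOk_const,
    Expr.mulOk_zero, Expr.mulOk_one, Expr.mulOk_two, Expr.mulOk_add, Expr.mulOk_mul, Expr.val_reg,
    Expr.val_cell, Expr.val_const, Expr.val_zero, Expr.val_one, Expr.val_two, Expr.val_add,
    Expr.val_mul, State.reg_set, State.arr_set, if_true, if_false, true_and, and_true, hA.hI, hA.hK,
    hA.hM, hA.hServer, hTI]
  set F := N.K * N.I * N.I + N.M with hFdef
  generalize hσ₀ : State.set _ rDen 1 = σ₀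
  have hin : σ₀.arr 0 = σ.arr 0 := by rw [← hσ₀]; rfl
  have h0I : σ₀.reg rI = N.I := by rw [← hσ₀]; simp +decide
  have h0K : σ₀.reg rK = N.K := by rw [← hσ₀]; simp +decide
  have h0M : σ₀.reg rM = N.M := by rw [← hσ₀]; simp +decide
  have h0S : σ₀.reg rServer = N.server := by rw [← hσ₀]; simp +decide
  have h0N : σ₀.reg rN = N.K * N.I := by rw [← hσ₀]; simp +decide
  have h0W : σ₀.reg rW = N.K * N.I + 1 := by rw [← hσ₀]; simp +decide
  have h0F : σ₀.reg rFractions = F := by rw [← hσ₀]; simp +decide [hFdef]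
  have h0D : σ₀.reg rDen = 1 := by rw [← hσ₀]; simp +decide
  -- the common denominator
  refine wp_for (fun j τ => τ.reg rDen = ∏ p ∈ Finset.range j, σ.arr 0 (2 * p + 5)) F hF
    (by decide) (fun τ hf => ?_) ?_ ?_ ?_
  · simp [hf.reg rFractions (by decide), h0F]
  · simp +decide [h0D]
  · intro j hj τ hf hij hinv
    simp +decide only [wp_assign, Expr.mulOk_reg, Expr.mulOk_cell, Expr.mulOk_const, Expr.mulOk_two,
      Expr.mulOk_add, Expr.mulOk_mul, Expr.val_reg, Expr.val_cell, Expr.val_const, Expr.val_two,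
      Expr.val_add, Expr.val_mul, State.reg_set, if_true, if_false, true_and, and_true, hij, hinv,
      hf.arr 0 (by decide), hin, hcell, ← Finset.prod_range_succ]
    exact (Nat.size_le_self _).trans (by omega)
  rintro τ₁ hf₁ - hD₁
  set D := ∏ p ∈ Finset.range F, σ.arr 0 (2 * p + 5) with hD
  have hin₁ : τ₁.arr 0 = σ.arr 0 := (hf₁.arr 0 (by decide)).trans hin
  have hpos : 0 < D := Nat.pos_of_ne_zero
    (Finset.prod_ne_zero_iff.2 fun p hp => hA.den_ne_zero (Finset.mem_range.1 hp))
  have hdvd : ∀ p < F, σ.arr 0 (2 * p + 5) ∣ D :=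
    fun p hp => Finset.dvd_prod_of_mem _ (Finset.mem_range.2 hp)
  -- the scaled fractions
  rw [wp_seq]
  refine wp_for (fun j τ => ∀ p < j, τ.arr aScaled p =
      D / σ.arr 0 (2 * p + 5) * σ.arr 0 (2 * p + 4)) F hF
    (by decide) (fun τ hf => ?_) (by simp) ?_ ?_
  · simp [hf.reg rFractions (by decide), hf₁.reg rFractions (by decide), h0F]
  · intro j hj τ hf hij hinv
    simp +decide only [wp_store, Expr.mulOk_reg, Expr.mulOk_cell, Expr.mulOk_const, Expr.mulOk_two,
      Expr.mulOk_add, Expr.mulOk_mul, Expr.mulOk_div, Expr.val_reg, Expr.val_cell, Expr.val_const,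
      Expr.val_two, Expr.val_add, Expr.val_mul, Expr.val_div, State.arr_set, State.arr_put,
      if_true, true_and, and_true, hij, hf.reg rDen (by decide), hD₁, hf.arr 0 (by decide), hin₁,
      hcell]
    have hjT : j.size ≤ T := (Nat.size_le_self j).trans (by omega)
    refine ⟨⟨hjT, hjT⟩, fun p hp => ?_⟩
    rw [Function.update_apply]
    split_ifs with h
    · rw [h]
    · exact hinv p (by omega)
  rintro τ₂ hf₂ - hscaled
  have hin₂ : τ₂.arr 0 = σ.arr 0 := (hf₂.arr 0 (by decide)).trans hin₁
  have hreg₂ : ∀ x, x ∉ [rDen, rJ] → τ₂.reg x = σ₀.reg x := fun x hx =>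
    (hf₂.reg x (by simp [Program.for, Program.regs] at hx ⊢; tauto)).trans
      (hf₁.reg x (by simp [Program.for, Program.regs] at hx ⊢; tauto))
  -- the amounts to be delivered
  rw [wp_seq]
  refine wp_for (fun j τ => ∀ p < j, τ.arr aNeed p = τ₂.arr aScaled (N.K * N.I * N.I + p / N.I) *
      σ.arr 0 (2 * F + 4 + p)) (N.M * N.I) hMI
    (by decide) (fun τ hf => ?_) (by simp) ?_ ?_
  · simp [hf.reg rM (by decide), hreg₂ rM (by decide), h0M, hf.reg rI (by decide),
      hreg₂ rI (by decide), h0I, hTI]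
  · intro j hj τ hf hij hinv
    simp +decide only [wp_store, Expr.mulOk_reg, Expr.mulOk_cell, Expr.mulOk_const, Expr.mulOk_two,
      Expr.mulOk_add, Expr.mulOk_mul, Expr.mulOk_div, Expr.val_reg, Expr.val_cell, Expr.val_const,
      Expr.val_two, Expr.val_add, Expr.val_mul, Expr.val_div, State.arr_set, State.arr_put,
      if_true, true_and, and_true, hij, hf.reg rN (by decide), hreg₂ rN (by decide), h0N,
      hf.reg rI (by decide), hreg₂ rI (by decide), h0I, hf.reg rFractions (by decide),
      hreg₂ rFractions (by decide), h0F, hf.arr 0 (by decide), hin₂,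
      hf.arr aScaled (by decide), hcell, hTI]
    refine ⟨(Nat.size_le_self _).trans hF, fun p hp => ?_⟩
    rw [Function.update_apply]
    split_ifs with h
    · rw [h]
    · exact hinv p (by omega)
  rintro τ₃ hf₃ - hneed
  have hreg₃ : ∀ x, x ∉ [rDen, rJ, rPair] → τ₃.reg x = σ₀.reg x := fun x hx =>
    (hf₃.reg x (by simp [Program.for, Program.regs] at hx ⊢; tauto)).trans
      (hreg₂ x (by simp at hx ⊢; tauto))
  -- the demands
  simp +decide only [wp_seq, wp_assign, Expr.mulOk_zero, Expr.val_zero, true_and]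
  refine wp_for (fun j τ => (∀ c < j, τ.arr aDemand c =
      ∑ m ∈ Finset.range N.M, τ₃.arr aNeed (m * N.I + c)) ∧
      τ.reg rTotal = ∑ c ∈ Finset.range j, ∑ m ∈ Finset.range N.M, τ₃.arr aNeed (m * N.I + c))
    N.I hIT (by decide) (fun τ hf => ?_) (by simp +decide) ?_ ?_
  · simp +decide [hf.reg rI (by decide), hreg₃ rI (by decide), h0I]
  · rintro j hj τ hf hij ⟨hinv₁, hinv₂⟩
    have hneed' : τ.arr aNeed = τ₃.arr aNeed := by rw [hf.arr aNeed (by decide)]; rfl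
    have hM' : τ.reg rM = N.M := by
      rw [hf.reg rM (by decide)]
      simp +decide [hreg₃ rM (by decide), h0M]
    have hI' : τ.reg rI = N.I := by
      rw [hf.reg rI (by decide)]
      simp +decide [hreg₃ rI (by decide), h0I]
    simp +decide only [wp_seq, wp_assign, Expr.mulOk_zero, Expr.val_zero, true_and]
    refine wp_for (fun j' τ' => τ'.reg rAmount =
      ∑ m ∈ Finset.range j', τ₃.arr aNeed (m * N.I + j)) N.M
      ((Nat.le_add_left _ _).trans hF) (by decide) (fun τ' hf' => ?_) (by simp +decide) ?_ ?_
    · simp +decide [hf'.reg rM (by decide), hM']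
    · intro j' hj' τ' hf' hij' hinv
      simp +decide only [wp_assign, Expr.mulOk_reg, Expr.mulOk_cell, Expr.mulOk_add, Expr.mulOk_mul,
        Expr.val_reg, Expr.val_cell, Expr.val_add, Expr.val_mul, State.reg_set, State.arr_set,
        if_true, if_false, and_true, hij', hinv, hf'.reg rI (by decide), hI',
        hf'.reg rClient (by decide), hij, hf'.arr aNeed (by decide), hneed', hTI,
        Finset.sum_range_succ]
    · rintro τ' hf' - hinv
      simp +decide only [wp_seq, wp_assign, wp_store, Expr.mulOk_reg, Expr.mulOk_add,
        Expr.val_reg, Expr.val_add, State.reg_set, State.reg_put, State.arr_set, State.arr_put,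
        if_true, if_false, true_and, hinv, hf'.reg rClient (by decide), hij,
        hf'.reg rTotal (by decide), hf'.arr aDemand (by decide), hinv₂, Finset.sum_range_succ,
        and_true]
      intro c hc
      rw [Function.update_apply]
      split_ifs with h
      · rw [h]
      · exact hinv₁ c (by omega)
  rintro τ₄ hf₄ - ⟨hdemand, htotal⟩
  have hreg₄ : ∀ x, x ∉ [rDen, rJ, rPair, rClient, rModel, rAmount, rTotal] →
      τ₄.reg x = σ₀.reg x := by
    intro x hx
    rw [hf₄.reg x (by simp [Program.for, Program.regs] at hx ⊢; tauto)]
    simp only [List.mem_cons, not_or] at hx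
    rw [State.reg_set, if_neg (by tauto), hreg₃ x (by simp; tauto)]
  have hneed₄ : ∀ (m : Fin N.M) (c : Fin N.I),
      (τ₃.arr aNeed (m * N.I + c) : ℚ≥0) = if c ∈ N.clients m then D * N.size m else 0 := by
    intro m c
    have h1 : ((m : ℕ) * N.I + c) / N.I = m := by
      rw [mul_comm, Nat.mul_add_div hI0, Nat.div_eq_of_lt c.2, add_zero]
    have h2 : N.K * N.I * N.I + (m : ℕ) < F := Nat.add_lt_add_left m.2 _
    rw [hneed _ (by nlinarith [m.2, c.2]), h1, hscaled _ h2, hA.client, Nat.cast_mul,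
      cast_div_mul (hA.size m).1 (hA.size m).2 (hdvd _ h2)]
    split_ifs <;> simp
  have hdemand₄ : ∀ c : Fin N.I,
      ((∑ m ∈ Finset.range N.M, τ₃.arr aNeed (m * N.I + c) : ℕ) : ℚ≥0) =
        D * N.clientDemand c := by
    intro c
    rw [Nat.cast_sum, Finset.sum_range, Instance.clientDemand, Finset.mul_sum]
    refine Finset.sum_congr rfl fun m _ => ?_
    rw [hneed₄, mul_ite, mul_zero]
  refine ⟨D, ⟨hpos, ?_, ?_, ?_, ?_, ?_, ?_, ?_, ?_, ?_, ?_, ?_⟩, size_prod_le (fun p => hL _) F⟩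
  · rw [hreg₄ _ (by decide), h0I]
  · rw [hreg₄ _ (by decide), h0K]
  · rw [hreg₄ _ (by decide), h0M]
  · rw [hreg₄ _ (by decide), h0S]
  · rw [hreg₄ _ (by decide), h0N]
  · rw [hreg₄ _ (by decide), h0W]
  · rw [hf₄.reg _ (by decide), State.reg_set, if_neg (by decide), hf₃.reg _ (by decide),
      hf₂.reg _ (by decide), hD₁]
  · intro u j
    have h1 : N.num u * N.I + j < N.K * N.I * N.I := by
      have := N.num_lt u
      nlinarith [j.2]
    rw [hf₄.arr _ (by decide), State.arr_set, hf₃.arr _ (by decide), hscaled _ (by omega),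
      cast_div_mul (hA.cap u j).1 (hA.cap u j).2 (hdvd _ (by omega))]
  · intro m c
    rw [hf₄.arr _ (by decide), State.arr_set, hneed₄]
  · intro c
    rw [hdemand c c.2, hdemand₄]
  · rw [htotal, Nat.cast_sum, Finset.sum_range, ← N.sum_clientDemand, Finset.mul_sum]
    exact Finset.sum_congr rfl fun c _ => hdemand₄ c

end FLRouting

namespace FLRouting

open RAM

/-! ### Building the network -/

/-- The capacities of the network for the trial snapshot `k`, given the scaled capacities `A` and
the scaled demands `d`.  Node `u` is the copy of satellite `u - u / I * I` in snapshot `u / I`, and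
`n` is the sink. -/
def netEntry (A d : ℕ → ℕ) (I n total k u v : ℕ) : ℕ :=
  if u < n then
    if v < n then
      if u / I = v / I then
        if u = v then 0 else A (u * I + (v - v / I * I))
      else if u + I = v then total else 0
    else if u / I = k then d (u - u / I * I) else 0
  else 0

/-- Fill both the matrix of the capacities and that of the residual capacities. -/
def buildNetwork : Program :=
  .for rJ (.reg rW * .reg rW) (
    .assign rU (.reg rJ / .reg rW) ;;
    .assign rV (.reg rJ - .reg rU * .reg rW) ;;
    .assign rSrc (.reg rU / .reg rI) ;;
    .assign rDst (.reg rV / .reg rI) ;;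
    .assign rAmount 0 ;;
    .ite (.reg rN - .reg rU)
      (.ite (.reg rN - .reg rV)
        (.ite ((.reg rSrc - .reg rDst) + (.reg rDst - .reg rSrc))
          (.ite ((.reg rU + .reg rI - .reg rV) + (.reg rV - (.reg rU + .reg rI)))
            .skip
            (.assign rAmount (.reg rTotal)))
          (.ite ((.reg rU - .reg rV) + (.reg rV - .reg rU))
            (.assign rAmount
              (.cell aScaled (.reg rU * .reg rI + (.reg rV - .reg rDst * .reg rI))))
            .skip))
        (.ite ((.reg rSrc - .reg rTrial) + (.reg rTrial - .reg rSrc))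
          .skip
          (.assign rAmount (.cell aDemand (.reg rU - .reg rSrc * .reg rI)))))
      .skip ;;
    .store aCap (.reg rJ) (.reg rAmount) ;;
    .store aMat (.reg rJ) (.reg rAmount))

variable {N : Instance}

theorem wp_buildNetwork {T I n W total k : ℕ} {σ : State} (hI : σ.reg rI = I) (hN : σ.reg rN = n)
    (hW : σ.reg rW = W) (htotal : σ.reg rTotal = total) (hk : σ.reg rTrial = k)
    (hTW : W * W ≤ T) (hTI : I.size ≤ T) (hTW' : W.size ≤ T) :
    wp T buildNetwork (fun τ => ∀ u < W, ∀ v < W,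
      mat (τ.arr aCap) W u v = netEntry (σ.arr aScaled) (σ.arr aDemand) I n total k u v ∧
      mat (τ.arr aMat) W u v = netEntry (σ.arr aScaled) (σ.arr aDemand) I n total k u v) σ := by
  set f := netEntry (σ.arr aScaled) (σ.arr aDemand) I n total k with hf
  refine wp_for (fun j τ => ∀ p < j, τ.arr aCap p = f (p / W) (p - p / W * W) ∧
    τ.arr aMat p = f (p / W) (p - p / W * W)) (W * W) hTW (by decide) (fun τ hf => ?_) (by simp)
    ?_ ?_
  · simp [hf.reg rW (by decide), hW, hTW']
  · intro j hj τ hf' hij hinv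
    have hI' : τ.reg rI = I := (hf'.reg rI (by decide)).trans hI
    have hN' : τ.reg rN = n := (hf'.reg rN (by decide)).trans hN
    have hW' : τ.reg rW = W := (hf'.reg rW (by decide)).trans hW
    have ht' : τ.reg rTotal = total := (hf'.reg rTotal (by decide)).trans htotal
    have hk' : τ.reg rTrial = k := (hf'.reg rTrial (by decide)).trans hk
    have hs' : τ.arr aScaled = σ.arr aScaled := hf'.arr aScaled (by decide)
    have hd' : τ.arr aDemand = σ.arr aDemand := hf'.arr aDemand (by decide)
    simp +decide only [wp_seq, wp_assign, Expr.mulOk_reg, Expr.mulOk_zero, Expr.mulOk_sub,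
      Expr.mulOk_mul, Expr.mulOk_div, Expr.val_reg, Expr.val_zero, Expr.val_sub, Expr.val_mul,
      Expr.val_div, State.reg_set, if_true, if_false, true_and, hij, hI', hW', hTW']
    set u := j / W with hu
    set v := j - u * W with hv
    -- All cases end with the same two assignments.
    have key : ∀ ρ : State, (∀ x, x ≠ rAmount → ρ.reg x = ((((τ.set rU u).set rV v).set rSrc
        (u / I)).set rDst (v / I)).reg x) → ρ.arr = τ.arr → ρ.reg rAmount = f u v →
        wp T (.store aCap (.reg rJ) (.reg rAmount) ;; .store aMat (.reg rJ) (.reg rAmount))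
          (fun τ' => ∀ p < j + 1, (τ'.set rJ (j + 1)).arr aCap p = f (p / W) (p - p / W * W) ∧
            (τ'.set rJ (j + 1)).arr aMat p = f (p / W) (p - p / W * W)) ρ := by
      intro ρ hρ hρa hρf
      have hJ : ρ.reg rJ = j := by
        rw [hρ _ (by decide)]
        simpa +decide using hij
      simp +decide only [wp_seq, wp_store, Expr.mulOk_reg, Expr.val_reg, State.reg_put,
        State.arr_put, State.arr_set, if_true, if_false, true_and, hρa, hρf, hJ]
      intro p hp
      rw [Function.update_apply, Function.update_apply]
      by_cases h : p = j
      · rw [if_pos h, if_pos h, h]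
        exact ⟨rfl, rfl⟩
      · rw [if_neg h, if_neg h]
        exact hinv p (by omega)
    simp +decide only [wp_ite, wp_skip, wp_assign, Expr.mulOk_reg, Expr.mulOk_cell, Expr.mulOk_add,
      Expr.mulOk_sub, Expr.mulOk_mul, Expr.val_reg, Expr.val_cell, Expr.val_add, Expr.val_sub,
      Expr.val_mul, State.reg_set, State.arr_set, if_true, if_false, true_and, hI', hN', ht', hk',
      hs', hd', hTI]
    refine ⟨fun h1 => ⟨fun h2 => ⟨fun h3 => ⟨fun h4 => ?_, fun h4 => ?_⟩,
      fun h3 => ⟨fun h4 => ?_, fun h4 => ?_⟩⟩, fun h2 => ⟨fun h3 => ?_, fun h3 => ?_⟩⟩,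
      fun h1 => ?_⟩
    all_goals
      refine key _ (fun x hx => by simp +decide [hx]) rfl ?_
      simp +decide only [State.reg_set, if_true, if_false]
      rw [hf, netEntry]
    · rw [if_pos (by omega), if_pos (by omega), if_neg (by omega), if_neg (by omega)]
    · rw [if_pos (by omega), if_pos (by omega), if_neg (by omega), if_pos (by omega)]
    · rw [if_pos (by omega), if_pos (by omega), if_pos (by omega), if_neg (by omega)]
    · rw [if_pos (by omega), if_pos (by omega), if_pos (by omega), if_pos (by omega)]
    · rw [if_pos (by omega), if_neg (by omega), if_neg (by omega)]
    · rw [if_pos (by omega), if_neg (by omega), if_pos (by omega)]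
    · rw [if_neg (by omega)]
  · rintro τ - - h u hu v hv
    have h1 : u * W + v < W * W := by nlinarith
    have h2 : (u * W + v) / W = u := by
      rw [mul_comm, Nat.mul_add_div (by omega), Nat.div_eq_of_lt hv, add_zero]
    have h3 := h _ h1
    rwa [h2, Nat.add_sub_cancel_left] at h3

theorem IsScaled.isNetwork {D : ℕ} {σ : State} (h : IsScaled N D σ) (k : Fin N.K) {C : ℕ → ℕ → ℕ}
    (hC : ∀ u < N.K * N.I + 1, ∀ v < N.K * N.I + 1, C u v =
      netEntry (σ.arr aScaled) (σ.arr aDemand) N.I (N.K * N.I) (σ.reg rTotal) k u v) :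
    IsNetwork N D k C := by
  have hsub : ∀ u : N.Node, N.num u - u.1 * N.I = u.2 := fun u => by
    rw [Instance.num, Nat.add_sub_cancel_left]
  refine ⟨fun u v => ?_, fun u => ?_⟩
  · have hu := N.num_lt u
    have hv := N.num_lt v
    rw [hC _ (by omega) _ (by omega), netEntry, if_pos hu, if_pos hv, N.num_div, N.num_div, hsub,
      Instance.arcCap]
    by_cases h1 : u.1 = v.1
    · rw [if_pos (by rw [h1])]
      by_cases h2 : u.2 = v.2
      · rw [if_pos (by rw [Prod.ext h1 h2]), if_neg (fun h3 => h3.2 h2),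
          if_neg (fun h3 => by have := h3.1; rw [h1] at this; omega)]
        simp
      · rw [if_neg (fun h3 => h2 (by rw [N.num_injective h3])), if_pos ⟨h1, h2⟩, h.cap]
    · rw [if_neg (fun h3 => h1 (Fin.ext h3)),
        if_neg (c := u.1 = v.1 ∧ u.2 ≠ v.2) (fun h3 => h1 h3.1)]
      have h2 : N.num u + N.I = N.num v ↔ (u.1 : ℕ) + 1 = v.1 ∧ u.2 = v.2 := by
        rw [Fin.ext_iff, ← mul_add_inj u.2.2 v.2.2, Instance.num, Instance.num, add_mul, one_mul,
          add_right_comm]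
      by_cases h3 : N.num u + N.I = N.num v
      · rw [if_pos h3, if_pos (h2.1 h3), h.total]
      · rw [if_neg h3, if_neg (mt h2.2 h3)]
        simp
  · have hu := N.num_lt u
    rw [hC _ (by omega) _ (by omega), netEntry, if_pos hu, if_neg (lt_irrefl _), N.num_div, hsub]
    by_cases h1 : u.1 = k
    · rw [if_pos (by rw [h1]), if_pos h1, h.demand]
    · rw [if_neg (fun h3 => h1 (Fin.ext h3)), if_neg h1]
      simp

/-- The numerators of the sizes bound the total demand. -/
theorem IsScaled.size_total_le {D L : ℕ} {σ : State} (h : IsScaled N D σ)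
    (hL : ∀ m, (N.size m).num.size ≤ L) :
    (σ.reg rTotal).size ≤ D.size + (L + (N.M * N.I).size) := by
  have h1 : (σ.reg rTotal : ℚ≥0) ≤ (D * (2 ^ L * (N.M * N.I)) : ℕ) := by
    rw [h.total, Nat.cast_mul]
    refine mul_le_mul_right ?_ _
    have h2 : ∀ m, N.size m * (N.clients m).card ≤ 2 ^ L * N.I := fun m => by
      have h3 : N.size m ≤ (N.size m).num := by
        conv_lhs => rw [← NNRat.num_div_den (N.size m)]
        refine div_le_self (by positivity) ?_
        exact_mod_cast Nat.one_le_iff_ne_zero.2 (NNRat.den_ne_zero _)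
      have h4 : ((N.size m).num : ℚ≥0) ≤ 2 ^ L := by
        exact_mod_cast (Nat.size_le.1 (hL m)).le
      have h5 : ((N.clients m).card : ℚ≥0) ≤ N.I := by
        exact_mod_cast (Finset.card_le_univ _).trans_eq (Fintype.card_fin _)
      exact mul_le_mul' (h3.trans h4) h5
    refine (Finset.sum_le_sum fun m _ => h2 m).trans_eq ?_
    rw [Finset.sum_const, Finset.card_univ, Fintype.card_fin, nsmul_eq_mul]
    push_cast
    ring
  have h2 : σ.reg rTotal ≤ D * (2 ^ L * (N.M * N.I)) := by exact_mod_cast h1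
  refine Nat.size_le.2 (h2.trans_lt ?_)
  rw [pow_add, pow_add]
  have h3 := Nat.lt_size_self D
  have h4 := Nat.lt_size_self (N.M * N.I)
  exact Nat.mul_lt_mul'' h3 (Nat.mul_lt_mul_of_le_of_lt le_rfl h4 (by positivity))

end FLRouting

namespace FLRouting

open RAM

/-! ### The search for the optimal snapshot -/

/-- Compute a maximum flow for the snapshot `rTrial`.  If it meets all demands, then write it out as
a routing and finish; otherwise go on to the next snapshot. -/
def tryTrial : Program :=
  buildNetwork ;;
  maxFlow ;;
  .ite (.reg rTotal - .reg rVal)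
    (.assign rTrial (.reg rTrial + 1))
    (decompose ;; .assign rTrial (.reg rK))

/-- The whole algorithm.  The output is initialized to the answer that there is no feasible
routing. -/
def distribute : Program :=
  .assign 1 1 ;;
  setup ;;
  .assign rTrial 0 ;;
  .loop (.reg rK - .reg rTrial) tryTrial

variable {N : Instance}

theorem IsScaled.congr {D : ℕ} {σ τ : State} (h : IsScaled N D σ)
    (hr : ∀ x ∈ [rI, rK, rM, rServer, rN, rW, rDen, rTotal], τ.reg x = σ.reg x)
    (ha : ∀ a ∈ [aScaled, aNeed, aDemand], τ.arr a = σ.arr a) : IsScaled N D τ := by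
  refine ⟨h.pos, ?_, ?_, ?_, ?_, ?_, ?_, ?_, ?_, ?_, ?_, ?_⟩
  · rw [hr _ (by decide), h.hI]
  · rw [hr _ (by decide), h.hK]
  · rw [hr _ (by decide), h.hM]
  · rw [hr _ (by decide), h.hServer]
  · rw [hr _ (by decide), h.hN]
  · rw [hr _ (by decide), h.hW]
  · rw [hr _ (by decide), h.hDen]
  · rw [ha _ (by decide)]
    exact h.cap
  · rw [ha _ (by decide)]
    exact h.need
  · rw [ha _ (by decide)]
    exact h.demand
  · rw [hr _ (by decide), h.total]

/-- A trial either shows that there is no feasible flow, or outputs a feasible routing. -/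
theorem wp_tryTrial {T D : ℕ} {k : Fin N.K} {σ : State} (h : IsScaled N D σ)
    (hk : σ.reg rTrial = k) (hT : (N.K * N.I + 1) ^ 2 ≤ T) (hTM : N.M * N.I ≤ T)
    (hTt : 1 + (2 * (N.K * N.I + 1) ^ 2 + 1) * (σ.reg rTotal).size ≤ T) :
    wp T tryTrial (fun τ =>
      (IsScaled N D τ ∧ τ.reg rTrial = k + 1 ∧ τ.reg rTotal = σ.reg rTotal ∧
        τ.output = σ.output ∧ ¬ ∃ x, IsFeasibleFlow N k x) ∨
      (τ.reg rTrial = τ.reg rK ∧ ∃ r, r.ofFractions.Feasible ∧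
        r.ofFractions.makespan ≤ (k : ℕ) + 1 ∧ τ.output = encodeAnswer N (some r))) σ := by
  have hT' : N.K * N.I + 1 ≤ T := le_trans (by nlinarith) hT
  have hTW : (N.K * N.I + 1).size ≤ T := (Nat.size_le_self _).trans hT'
  have hTI : N.I.size ≤ T := by
    refine (Nat.size_le_self _).trans (le_trans ?_ hT')
    have := Nat.le_mul_of_pos_left N.I N.K_pos
    omega
  have hs : (N.server : ℕ) < N.K * N.I := by
    rw [← N.num_source]
    exact N.num_lt _
  unfold tryTrial
  rw [wp_seq]
  refine wp_call (wp_buildNetwork h.hI h.hN h.hW rfl hk (by rwa [← sq]) hTI hTW) ?_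
  intro τ₁ hf₁ hC
  have hnet := h.isNetwork k fun u hu v hv => (hC u hu v hv).2
  have h₁ : IsScaled N D τ₁ := h.congr
    (fun x hx => hf₁.reg x (by revert x; decide)) (fun a ha => hf₁.arr a (by revert a; decide))
  have htot₁ : τ₁.reg rTotal = σ.reg rTotal := hf₁.reg _ (by decide)
  have hsink : ∑ u ∈ Finset.range (N.K * N.I), mat (τ₁.arr aMat) (N.K * N.I + 1) u (N.K * N.I) =
      τ₁.reg rTotal := by
    rw [← Nat.cast_inj (R := ℚ≥0), hnet.sum_sink, h₁.total]
  rw [wp_seq]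
  refine wp_call (wp_maxFlow h₁.hN h₁.hW h₁.hServer rfl hs (by rwa [htot₁]) hT' hsink) ?_
  rintro τ₂ hf₂ ⟨hres, S, hS, hsS, htS, hcut⟩
  have h₂ : IsScaled N D τ₂ := h₁.congr
    (fun x hx => hf₂.reg x (by revert x; decide)) (fun a ha => hf₂.arr a (by revert a; decide))
  have htot₂ : τ₂.reg rTotal = τ₁.reg rTotal := hf₂.reg _ (by decide)
  have hk₂ : τ₂.reg rTrial = k := by
    rw [hf₂.reg _ (by decide), hf₁.reg _ (by decide), hk]
  have hval := hnet.val_le hres h₁.total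
  rw [wp_ite]
  refine ⟨⟨trivial, trivial⟩, fun hv => ?_, fun hv => ?_⟩
  · simp only [Expr.val_sub, Expr.val_reg] at hv
    simp +decide only [wp_assign, Expr.mulOk_add, Expr.mulOk_reg, Expr.mulOk_one, Expr.val_add,
      Expr.val_reg, Expr.val_one, State.reg_set, if_true, if_false, true_and, hk₂]
    refine .inl ⟨h₂.congr (fun x hx => ?_) fun _ _ => rfl, htot₂.trans htot₁, ?_, ?_⟩
    · rw [State.reg_set, if_neg]
      revert x
      decide
    · refine State.output_congr ?_ ?_
      · rw [State.reg_set, if_neg (by decide), hf₂.reg _ (by decide), hf₁.reg _ (by decide)]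
      · rw [State.arr_set, hf₂.arr _ (by decide), hf₁.arr _ (by decide)]
    · rintro ⟨x, hx⟩
      have := hnet.le_val hres hS hsS htS hcut h₁.total hx
      omega
  · simp only [Expr.val_sub, Expr.val_reg] at hv
    have hval' : ((τ₂.reg rVal : ℕ) : ℚ≥0) = D * N.totalDemand := by
      rw [← h₁.total]
      congr 1
      omega
    have hpart := hnet.isPartial (rem := fun m c => τ₂.arr aNeed (m * N.I + c)) hres hval' h₂.need
    rw [wp_seq]
    refine wp_call (wp_decompose hT hTM h.pos h₂.hI h₂.hM h₂.hN h₂.hW h₂.hDen hk₂ h₂.hServer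
      (fun _ _ => rfl) (hpart.congr fun u hu v hv => ?_)) ?_
    · have := hC u (by omega) v (by omega)
      rw [hf₂.arr aCap (by decide), this.1, this.2]
    rintro τ₃ hf₃ ⟨r, G, hr, hout⟩
    simp +decide only [wp_assign, Expr.mulOk_reg, Expr.val_reg, State.reg_set, if_true, if_false,
      true_and]
    refine .inr ⟨r, hr.feasible h.pos fun _ _ => rfl, hr.makespan_le, ?_⟩
    rw [← hout]
    exact State.output_congr (by simp) rfl

/-- What the algorithm achieves: it finds a routing for the first snapshot whose network has a
feasible flow, if there is any. -/
theorem wp_distribute {T L : ℕ} {σ : State} (hA : IsInput N (σ.arr 0))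
    (hL : ∀ i, (σ.arr 0 i).size ≤ L) (hF : N.K * N.I * N.I + N.M ≤ L) (hMI : N.M * N.I ≤ L)
    (hT : 1 + (2 * (L + 1) ^ 2 + 1) * (L + 1) ^ 2 ≤ T) (h0 : σ.arr 1 0 = 0) :
    wp T distribute (fun τ =>
      ((∀ k, ¬ ∃ x, IsFeasibleFlow N k x) ∧ τ.output = encodeAnswer N none) ∨
      ∃ (k : Fin N.K) (r : Routing N (ℕ × ℕ)), (∀ k' < k, ¬ ∃ x, IsFeasibleFlow N k' x) ∧
        r.ofFractions.Feasible ∧ r.ofFractions.makespan ≤ (k : ℕ) + 1 ∧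
        τ.output = encodeAnswer N (some r)) σ := by
  have hI0 : 0 < N.I := N.server.pos
  have hKI : N.K * N.I ≤ L := by
    have := Nat.le_mul_of_pos_right (N.K * N.I) hI0
    omega
  have hK : N.K ≤ L := (Nat.le_mul_of_pos_right _ hI0).trans hKI
  have hLT : (L + 1) ^ 2 ≤ T := le_trans (by nlinarith [sq_nonneg (L + 1)]) hT
  have hLT' : L ≤ T := le_trans (by nlinarith) hLT
  have hW : (N.K * N.I + 1) ^ 2 ≤ (L + 1) ^ 2 := Nat.pow_le_pow_left (by omega) 2
  unfold distribute
  simp only [wp_seq, wp_assign, Expr.mulOk_one, Expr.val_one, true_and]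
  refine wp_call (wp_setup (L := L) hA hL hLT' (hF.trans hLT') (hMI.trans hLT')) ?_
  rintro τ₁ hf₁ ⟨D, h₁, hD⟩
  simp only [wp_seq, wp_assign, Expr.mulOk_zero, Expr.val_zero, true_and]
  have hsize : (τ₁.reg rTotal).size ≤ (L + 1) ^ 2 := by
    have h2 := h₁.size_total_le (L := L) fun m => by rw [← (hA.size m).1]; exact hL _
    have h3 : (N.M * N.I).size ≤ L := (Nat.size_le_self _).trans hMI
    have h4 : (N.K * N.I * N.I + N.M) * L ≤ L * L := Nat.mul_le_mul_right _ hF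
    nlinarith
  have hTt : 1 + (2 * (N.K * N.I + 1) ^ 2 + 1) * (τ₁.reg rTotal).size ≤ T :=
    le_trans (by gcongr) hT
  refine wp_loop (fun n τ =>
    (∃ j ≤ N.K, n = N.K - j ∧ τ.reg rTrial = j ∧ IsScaled N D τ ∧
      τ.reg rTotal = τ₁.reg rTotal ∧ τ.output = encodeAnswer N none ∧
      ∀ k : Fin N.K, (k : ℕ) < j → ¬ ∃ x, IsFeasibleFlow N k x) ∨
    (τ.reg rTrial = τ.reg rK ∧
      ∃ (k : Fin N.K) (r : Routing N (ℕ × ℕ)), (∀ k' < k, ¬ ∃ x, IsFeasibleFlow N k' x) ∧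
        r.ofFractions.Feasible ∧ r.ofFractions.makespan ≤ (k : ℕ) + 1 ∧
        τ.output = encodeAnswer N (some r))) N.K (hK.trans hLT') (.inl ⟨0, ?_⟩) ?_
  · refine ⟨Nat.zero_le _, rfl, by simp, h₁.congr (fun x hx => ?_) fun _ _ => rfl,
      by simp +decide, ?_, fun k hk => absurd hk (Nat.not_lt_zero _)⟩
    · rw [State.reg_set, if_neg]
      revert x
      decide
    · rw [State.output_congr (σ := σ.set 1 1)]
      · simp [State.output, encodeAnswer, h0]
      · rw [State.reg_set, if_neg (by decide), hf₁.reg _ (by decide)]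
      · rw [State.arr_set, hf₁.arr _ (by decide)]
  rintro n τ hn hinv -
  refine ⟨⟨trivial, trivial⟩, fun hv => ?_, fun hv => ?_⟩
  · simp only [Expr.val_sub, Expr.val_reg] at hv
    obtain ⟨j, hj, rfl, hjτ, hτ, htot, hout, hno⟩ | ⟨h, -⟩ := hinv
    · rw [hτ.hK, hjτ] at hv
      refine wp_call (wp_tryTrial (k := ⟨j, by omega⟩) hτ hjτ (hW.trans hLT) (hMI.trans hLT')
        (by rwa [htot])) ?_
      rintro τ' - (⟨hτ', hj', htot', hout', hno'⟩ | ⟨hj', r, hr, hm, hout'⟩)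
      · refine ⟨N.K - (j + 1), by omega, .inl ⟨j + 1, by omega, rfl, hj', hτ', htot'.trans htot,
          hout'.trans hout, fun k hk => ?_⟩⟩
        rcases Nat.lt_succ_iff_lt_or_eq.1 hk with hk | hk
        · exact hno k hk
        · rwa [show k = ⟨j, by omega⟩ from Fin.ext hk]
      · exact ⟨0, by omega, .inr ⟨hj', _, r, fun k' hk' => hno k' hk', hr, hm, hout'⟩⟩
    · omega
  · simp only [Expr.val_sub, Expr.val_reg] at hv
    obtain ⟨j, hj, rfl, hjτ, hτ, htot, hout, hno⟩ | ⟨-, h⟩ := hinv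
    · rw [hτ.hK, hjτ] at hv
      exact .inl ⟨fun k => hno k (by omega), hout⟩
    · exact .inr h

theorem slowOutput_distribute : distribute.SlowOutput := by
  simp +decide [distribute, setup, tryTrial, buildNetwork, maxFlow, decompose, routePair, splitPath,
    findPath, bfs, augment, bottleneck, subtractPath, emitPiece, emit, Program.for,
    Program.SlowOutput]
  tauto

end FLRouting

namespace FLRouting

open RAM

/-! ### Optimality -/

variable {N : Instance}

theorem Routing.makespan_le {R : Type} (r : Routing N R) : r.makespan ≤ N.K := by
  refine Finset.sup_le fun c _ => foldr_max_le fun a ha => ?_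
  obtain ⟨e, -, rfl⟩ := List.mem_map.1 ha
  rw [PathFlow.arrival]
  cases e.path.find? fun u => u.2 = e.client with
  | none => exact Nat.zero_le _
  | some u => exact u.1.2

theorem Routing.Feasible.makespan_pos {r : Routing N ℝ} (hr : r.Feasible) {m : Fin N.M}
    {c : Fin N.I} (hc : c ∈ N.clients m) : 0 < r.makespan := by
  have h1 : (r.filter fun e => e.model = m ∧ e.client = c) ≠ [] := by
    intro h
    have h2 := hr.delivered m c hc
    rw [Routing.delivered, h, List.map_nil, List.sum_nil] at h2
    have h3 : (0 : ℝ) < N.size m := by exact_mod_cast N.size_pos m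
    exact h3.ne h2
  obtain ⟨e, he⟩ := List.exists_mem_of_ne_nil _ h1
  have he' := (List.mem_filter.1 he).1
  obtain ⟨u, -, hu⟩ := (hr.isPath e he').exists_find
  have := Routing.arrival_le_makespan he' (hr.client_mem e he')
  omega

/-- The first snapshot with a feasible flow is optimal. -/
theorem isOptimalAnswer_some {k : Fin N.K} {r : Routing N (ℕ × ℕ)}
    (hno : ∀ k' < k, ¬ ∃ x, IsFeasibleFlow N k' x) (hr : r.ofFractions.Feasible)
    (hm : r.ofFractions.makespan ≤ (k : ℕ) + 1) : IsOptimalAnswer N (some r) := by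
  refine ⟨hr, fun r' hr' => ?_⟩
  rcases Nat.eq_zero_or_pos r'.makespan with h0 | h0
  · have h1 : Finset.univ.biUnion N.clients = ∅ := by
      rw [Finset.eq_empty_iff_forall_notMem]
      intro c hc
      obtain ⟨m, -, hc⟩ := Finset.mem_biUnion.1 hc
      exact (hr'.makespan_pos hc).ne' h0
    rw [Routing.makespan, h1]
    exact Nat.zero_le _
  · have h1 := r'.makespan_le
    by_contra! h2
    exact hno ⟨r'.makespan - 1, by omega⟩ (Fin.lt_def.2 (by simp only; omega))
      (exists_flow_of_routing hr' (by simp only; omega))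

theorem isOptimalAnswer_none (hno : ∀ k, ¬ ∃ x, IsFeasibleFlow N k x) :
    IsOptimalAnswer N none := by
  intro r' hr'
  have h1 := r'.makespan_le
  have h2 := N.K_pos
  exact hno ⟨N.K - 1, by omega⟩ (exists_flow_of_routing hr' (by simp only; omega))

/-- Read rational amounts as real numbers. -/
def Routing.toReal (r : Routing N ℚ≥0) : Routing N ℝ :=
  r.map fun e => ⟨e.model, e.client, e.path, (e.amount : ℝ)⟩

theorem Routing.makespan_toReal (r : Routing N ℚ≥0) : r.toReal.makespan = r.makespan := by
  refine Finset.sup_congr rfl fun c _ => ?_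
  rw [Routing.completion, Routing.completion, Routing.toReal, List.filter_map, List.map_map]
  rfl

theorem NNRat.cast_list_sum (l : List ℚ≥0) : ((l.sum : ℚ≥0) : ℝ) = (l.map (↑)).sum :=
  map_list_sum (NNRat.castHom ℝ) l

theorem Routing.Feasible.toReal {r : Routing N ℚ≥0} (hr : r.Feasible) : r.toReal.Feasible := by
  refine ⟨fun e' he' => ?_, fun e' he' => ?_, fun e' he' => ?_, fun m c hc => ?_, fun u v => ?_⟩
  · obtain ⟨e, he, rfl⟩ := List.mem_map.1 he'
    exact hr.client_mem e he
  · obtain ⟨e, he, rfl⟩ := List.mem_map.1 he'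
    have := hr.isPath e he
    exact ⟨this.nodup, this.head, this.last, this.chain⟩
  · obtain ⟨e, he, rfl⟩ := List.mem_map.1 he'
    exact NNRat.cast_pos.2 (hr.amount_pos e he)
  · have h1 := congrArg (NNRat.cast (K := ℝ)) (hr.delivered m c hc)
    rw [Routing.delivered, NNRat.cast_list_sum, List.map_map] at h1
    rw [Routing.delivered, Routing.toReal, List.filter_map, List.map_map]
    rw [NNRat.cast_id] at h1
    exact h1
  · have h1 := NNRat.cast_le (K := ℝ).2 (hr.capacity u v)
    rw [Routing.load, NNRat.cast_list_sum, List.map_map] at h1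
    rw [Routing.load, Routing.toReal, List.map_map]
    simpa [Function.comp_def] using h1

/-! ### Polynomial time -/

/-- A bound, in terms of the bit length `X` of the input, on the number of the rounds of every loop
and on the bit lengths of all second factors.  There are at most `X + 1` nodes, including the sink,
and the scaled total demand has at most `(X + 1) ^ 2` bits. -/
noncomputable def timeBound : Polynomial ℕ := 1 + (2 * (.X + 1) ^ 2 + 1) * (.X + 1) ^ 2

theorem wp_distribute_encodeInstance (N : Instance) :
    wp (timeBound.eval (bitSize (encodeInstance N))) distribute (fun τ =>
      ((∀ k, ¬ ∃ x, IsFeasibleFlow N k x) ∧ τ.output = encodeAnswer N none) ∨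
      ∃ (k : Fin N.K) (r : Routing N (ℕ × ℕ)), (∀ k' < k, ¬ ∃ x, IsFeasibleFlow N k' x) ∧
        r.ofFractions.Feasible ∧ r.ofFractions.makespan ≤ (k : ℕ) + 1 ∧
        τ.output = encodeAnswer N (some r)) (State.init (encodeInstance N)) := by
  have hlen := length_le_bitSize (encodeInstance N)
  rw [length_encodeInstance] at hlen
  have h1 : N.K * (N.I * (N.I * 2)) = 2 * (N.K * N.I * N.I) := by ring
  refine wp_distribute (L := bitSize (encodeInstance N)) ?_ (fun i => ?_) (by omega) (by omega) ?_
    (by simp [State.init])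
  · simpa [State.init] using isInput_encodeInstance N
  · simpa [State.init] using size_getD_le_bitSize (encodeInstance N) i
  · simp [timeBound]

/-- A feasible flow is found by the algorithm, and so gives rise to a feasible routing. -/
theorem exists_routing_of_flow {k : Fin N.K} {x : N.Node → N.Node → ℝ}
    (hx : IsFeasibleFlow N k x) : ∃ r : Routing N ℝ, r.Feasible ∧ r.makespan ≤ (k : ℕ) + 1 := by
  obtain ⟨σ, n, h, -⟩ := exists_run _ (wp_distribute_encodeInstance N)
  obtain ⟨hno, -⟩ | ⟨k', r, hno, hr, hm, -⟩ := h
  · exact absurd ⟨x, hx⟩ (hno k)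
  · refine ⟨_, hr.toReal, ?_⟩
    have h1 : k' ≤ k := not_lt.1 fun h => hno k h ⟨x, hx⟩
    have h2 := Fin.le_def.1 h1
    rw [Routing.makespan_toReal]
    omega

end FLRouting

theorem mainTheorem3 :
    RAM.PolyTimeSolvable FLRouting.encodeInstance FLRouting.encodeAnswer
        FLRouting.IsOptimalAnswer ∧
      ∀ (N : FLRouting.Instance) (k : Fin N.K),
        (∃ r : FLRouting.Routing N ℝ, r.Feasible ∧ r.makespan ≤ (k : ℕ) + 1) ↔
          ∃ x : N.Node → N.Node → ℝ, FLRouting.IsFeasibleFlow N k x := by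
  refine ⟨RAM.polyTimeSolvable_of_wp FLRouting.distribute FLRouting.slowOutput_distribute
    FLRouting.timeBound fun N => RAM.wp_mono _ (FLRouting.wp_distribute_encodeInstance N) ?_,
    fun N k => ⟨fun ⟨r, hr, hm⟩ => FLRouting.exists_flow_of_routing hr hm,
      fun ⟨x, hx⟩ => FLRouting.exists_routing_of_flow hx⟩⟩
  rintro σ (⟨hno, hout⟩ | ⟨k, r, hno, hr, hm, hout⟩)
  · exact ⟨none, FLRouting.isOptimalAnswer_none hno, hout⟩
  · exact ⟨some r, FLRouting.isOptimalAnswer_some hno hr hm, hout⟩
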